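/- **Setting.** Let $d\ge 1$, $U>0$, $\mathcal V=[0,U]\times\mathbb S^{d-1}$ with the measure $dv\,d\hat v$ (Lebesgue times surface measure) and $\varepsilon_0>0$. For $0<\varepsilon\le\varepsilon_0$ let $T_\varepsilon=T_\varepsilon(x,v,\hat v)$ be a turning kernel on $\mathbb R^d\times\mathcal V$ (for instance the nonlocal kernel $T[\mathcal S]_\varepsilon$), with $\int_{\mathcal V}T_\varepsilon(x,v,\hat v)\,dv\,d\hat v=1$ for all $x$, and suppose that for constants $T_->0$, $L_M$ independent of $\varepsilon$ $$T_-\le T_\varepsilon\le L_M,\qquad T_\varepsilon\ \text{is } L_M\text{-Lipschitz in } x \text{ and in } (v,\hat v),\qquad T_\varepsilon\to T_0\ \text{ uniformly on } \mathbb R^d\times\mathcal V \text{ as } \varepsilon\to0 .$$ Let $f_\varepsilon=e^{-\varphi_\varepsilon/\varepsilon}$ be a locally bounded solution (along characteristics) on $[0,\infty)\times\mathbb R^d\times\mathcal V$ of $$\partial_t f_\varepsilon+v\hat v\cdot\nabla_x f_\varepsilon=\tfrac1\varepsilon\big(\rho_\varepsilon T_\varepsilon-f_\varepsilon\big),\qquad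 \rho_\varepsilon(t,x)=\int_{\mathcal V}f_\varepsilon\,dv\,d\hat v ,$$ whose initial phase $\varphi^0_\varepsilon=\varphi_\varepsilon(0,\cdot)$ satisfies, with constants independent of $\varepsilon$: $\varphi_\varepsilon^0$ is $K_0$-Lipschitz in $x$, and $|\varphi^0_\varepsilon(x,v,\hat v)-\varphi^0(x)|\le C_0\varepsilon$ for a function $\varphi^0$ on $\mathbb R^d$. Put $\underline H(p)=-1+\max_{\mathcal V}v\hat v\cdot p$. Let $P\in[0,\infty]$ be such that for all $p\in\mathbb R^d$ with $|p|<P$ the nondegeneracy condition holds: $$\inf_{x}\int_{\mathcal V}\frac{T_0(x,v,\hat v)}{1+\underline H(p)-v\hat v\cdot p}\,dv\,d\hat v>1 .$$ ($P=\infty$ is the condition for all $p$.) Let $H(x,p)$ be the infimum of the $h$ with $1+h-v\hat v\cdot p>0$ on $\mathcal V$ and $\int_{\mathcal V}\frac{T_0(x,v,\hat v)}{1+h-v\hat v\cdot p}\,dv\,d\hat v\le1$. Call $\tau\in(0,\infty]$ *admissible* if for every $t<\tau$ there is $K<P$ such that $\varphi_\varepsilon(s,\cdot,v,\hat v)$ is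 $K$-Lipschitz in $x$ for all $s\le t$, all $0<\varepsilon\le\varepsilon_0$ and all $(v,\hat v)\in\mathcal V$. **Theorem.** (i) The $\varphi_\varepsilon$ are bounded on $[0,t]\times B\times\mathcal V$ for every $t$ and every bounded $B\subset\mathbb R^d$, uniformly in $\varepsilon$; if the $\varphi_\varepsilon^0$ are uniformly bounded, so are the $\varphi_\varepsilon$ on $[0,t]\times\mathbb R^d\times\mathcal V$ for every $t$. For every $t$ they are Lipschitz in $(s,x)$ on $[0,t]\times\mathbb R^d$, uniformly in $\varepsilon$ and $(v,\hat v)$; if the $\varphi_\varepsilon^0$ are Lipschitz in $(v,\hat v)$ uniformly in $\varepsilon$ and $x$, then the $\varphi_\varepsilon$ are Lipschitz in $(s,x,v,\hat v)$ on $[0,t]\times\mathbb R^d\times\mathcal V$, uniformly in $\varepsilon$. In particular, if $P=\infty$ then $\tau=\infty$ is admissible; and if $K_0<P$ then some $\tau>0$ is admissible. (ii) For $|p|<P$ and every $x$, $H(x,p)$ is the unique number $h$ with $1+h-v\hat v\cdot p>0$ on $\mathcal V$ and $$1=\int_{\mathcal V}\frac{T_0(x,v,\hat v)}{1+h-v\hat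 v\cdot p}\,dv\,d\hat v ,$$ and $p\mapsto H(x,p)$ is convex on $\mathbb R^d$. Let $\tau$ be admissible. Every sequence $\varepsilon_k\to0$ has a subsequence along which $\varphi_{\varepsilon_k}$ converges, locally uniformly on $[0,\tau)\times\mathbb R^d\times\mathcal V$, to a function $\varphi(t,x)$ that does not depend on $(v,\hat v)$. This $\varphi$ is the viscosity solution (it is one, and it is unique among continuous functions on $[0,\tau)\times\mathbb R^d$) of $$\partial_t\varphi+H(x,\nabla_x\varphi)=0\ \text{ in } (0,\tau)\times\mathbb R^d,\qquad \varphi(0,\cdot)=\varphi^0 .$$ (iii) Suppose in addition that $\int f^0_\varepsilon\,dx\,dv\,d\hat v=1$ and that $\int|x|f_\varepsilon^0\,dx\,dv\,d\hat v$ is bounded uniformly in $\varepsilon$. Then the subsequence in (ii) can be chosen such that there is a measure $\mu$ on $[0,\tau)\times\mathbb R^d\times\mathcal V$, supported in $\{\varphi=0\}$ and giving mass $t$ to $[0,t]\times\mathbb R^d\times\mathcal V$, such that for every $t\in[0,\tau)$ the measures $f_{\varepsilon_k}\,ds\,dx\,dv\,d\hat v$ on $[0,t]\times\mathbb R^d\times\mathcal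 V$ converge weakly (against bounded continuous functions) to the restriction of $\mu$. Also, for each $t\in[0,\tau)$, along a further subsequence $f_{\varepsilon_k}(t,\cdot)\,dx\,dv\,d\hat v$ converges weakly to a probability measure on $\mathbb R^d\times\mathcal V$ supported in $\{\varphi(t,\cdot)=0\}$. -/

import Mathlib

open Set Filter Topology MeasureTheory
open scoped NNReal ENNReal BoundedContinuousFunction

noncomputable section

namespace BGK

/-- The physical space `ℝ^d`, with its Euclidean norm. -/
abbrev Space (d : ℕ) : Type := EuclideanSpace ℝ (Fin d)

/-- The velocity set `𝒱 = [0,U] × 𝕊^{d-1}` of pairs (speed, direction). -/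
abbrev Vel (d : ℕ) (U : ℝ) : Type :=
  Set.Icc (0 : ℝ) U × Metric.sphere (0 : Space d) 1

/-- The velocity vector `v v̂ ∈ ℝ^d` of a pair `(v, v̂)`. -/
def vec {d : ℕ} {U : ℝ} (w : Vel d U) : Space d := (w.1 : ℝ) • (w.2 : Space d)

/-- The measure `dv dv̂` on `𝒱`: Lebesgue measure times surface measure
(counting measure on `{1, -1}` if `d = 1`). -/
def velMeasure (d : ℕ) (U : ℝ) : Measure (Vel d U) :=
  ((volume : Measure ℝ).comap (Subtype.val : Set.Icc (0 : ℝ) U → ℝ)).prod (volume : Measure (Space d)).toSphere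

/-- The measure `dx dv dv̂` on the phase space. -/
def phaseMeasure (d : ℕ) (U : ℝ) : Measure (Space d × Vel d U) :=
  (volume : Measure (Space d)).prod (velMeasure d U)

/-- The Hopf–Cole transform `f = exp (-φ/ε)`. -/
def hopfCole {d : ℕ} {U : ℝ} (ε : ℝ) (φ : ℝ → Space d → Vel d U → ℝ) :
    ℝ → Space d → Vel d U → ℝ :=
  fun t x w => Real.exp (-(φ t x w) / ε)

/-- The number density `ρ(t,x) = ∫_𝒱 f(t,x,v,v̂) dv dv̂`. -/
def density {d : ℕ} {U : ℝ} (f : ℝ → Space d → Vel d U → ℝ) (t : ℝ) (x : Space d) : ℝ :=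
  ∫ w, f t x w ∂(velMeasure d U)

/-- `f` solves `∂_t f + v v̂ · ∇_x f = (ρ T - f) / ε` for `t ≥ 0`. The transport operator is the
derivative along `s ↦ (s, x + (s - t) v v̂)` at `s = t`; in particular every classical solution is
a solution in this sense. Solutions are measurable on phase space and locally bounded. -/
structure IsKineticSolution {d : ℕ} {U : ℝ} (ε : ℝ) (T : Space d → Vel d U → ℝ)
    (f : ℝ → Space d → Vel d U → ℝ) : Prop where
  measurable : ∀ t, 0 ≤ t → Measurable (fun z : Space d × Vel d U => f t z.1 z.2)
  locallyBounded : ∀ R : ℝ, ∃ M : ℝ, ∀ t ∈ Set.Icc 0 R, ∀ x : Space d, ‖x‖ ≤ R →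
    ∀ w, |f t x w| ≤ M
  equation : ∀ t, 0 ≤ t → ∀ x w,
    HasDerivWithinAt (fun s => f s (x + (s - t) • vec w) w)
      ((density f t x * T x w - f t x w) / ε) (Set.Ici 0) t

/-- `-1 + max_{(v,v̂) ∈ 𝒱} v v̂ · p`, the largest value of `H` at which the denominator
`1 + H - v v̂ · p` vanishes somewhere on `𝒱`. -/
def lowerH {d : ℕ} (U : ℝ) (p : Space d) : ℝ :=
  -1 + ⨆ w : Vel d U, inner ℝ (vec w) p

/-- The nondegeneracy condition at `p`:
`inf_x ∫_𝒱 T₀ / (1 + lowerH(p) - v v̂ · p) dv dv̂ > 1`, the integral being possibly `+∞`. -/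
def Nondegenerate {d : ℕ} {U : ℝ} (T₀ : Space d → Vel d U → ℝ) (p : Space d) : Prop :=
  1 < ⨅ x : Space d, ∫⁻ w, ENNReal.ofReal (T₀ x w) /
    ENNReal.ofReal (1 + lowerH U p - inner ℝ (vec w) p) ∂(velMeasure d U)

/-- `h` solves `1 = ∫_𝒱 T₀ / (1 + h - v v̂ · p) dv dv̂`, with positive denominators. -/
def IsRoot {d : ℕ} {U : ℝ} (T₀ : Space d → Vel d U → ℝ) (x p : Space d) (h : ℝ) : Prop :=
  (∀ w : Vel d U, 0 < 1 + h - inner ℝ (vec w) p) ∧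
    ∫ w, T₀ x w / (1 + h - inner ℝ (vec w) p) ∂(velMeasure d U) = 1

/-- The effective Hamiltonian `H(x,p)`. The integral decreases strictly in `h`, so this is the root
of the implicit equation whenever there is one; otherwise it is `lowerH U p`. -/
def hamiltonian {d : ℕ} {U : ℝ} (T₀ : Space d → Vel d U → ℝ) (x p : Space d) : ℝ :=
  sInf {h : ℝ | (∀ w : Vel d U, 0 < 1 + h - inner ℝ (vec w) p) ∧
    ∫ w, T₀ x w / (1 + h - inner ℝ (vec w) p) ∂(velMeasure d U) ≤ 1}

/-- The set of `(t, x)` with `0 ≤ t < τ`; the horizon `τ` may be `∞`. -/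
def slab (d : ℕ) (τ : ℝ≥0∞) : Set (ℝ × Space d) :=
  {z | 0 ≤ z.1 ∧ ENNReal.ofReal z.1 < τ}

/-- `u` is a (continuous) viscosity solution of `∂_t u + H(x, ∇u) = 0` on `(0,τ) × ℝ^d`
with `u(0,·) = u₀`, continuous on `[0,τ) × ℝ^d`. -/
structure IsViscositySolution {d : ℕ} (H : Space d → Space d → ℝ) (τ : ℝ≥0∞)
    (u₀ : Space d → ℝ) (u : ℝ → Space d → ℝ) : Prop where
  continuousOn : ContinuousOn (fun z : ℝ × Space d => u z.1 z.2) (slab d τ)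
  initial : ∀ x, u 0 x = u₀ x
  subsolution : ∀ ψ : ℝ × Space d → ℝ, ContDiff ℝ 1 ψ → ∀ (t : ℝ) (x : Space d),
    0 < t → ENNReal.ofReal t < τ →
    IsLocalMax (fun z : ℝ × Space d => u z.1 z.2 - ψ z) (t, x) →
    deriv (fun s => ψ (s, x)) t + H x (gradient (fun y => ψ (t, y)) x) ≤ 0
  supersolution : ∀ ψ : ℝ × Space d → ℝ, ContDiff ℝ 1 ψ → ∀ (t : ℝ) (x : Space d),
    0 < t → ENNReal.ofReal t < τ →
    IsLocalMin (fun z : ℝ × Space d => u z.1 z.2 - ψ z) (t, x) →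
    0 ≤ deriv (fun s => ψ (s, x)) t + H x (gradient (fun y => ψ (t, y)) x)

/-- Up to every time `t < τ`, the functions `φ_ε(s,·,v,v̂)`, `s ≤ t`, `0 < ε ≤ ε₀`, have a common
Lipschitz constant in `x` that is smaller than `P`. -/
def SlopesBelow {d : ℕ} {U : ℝ} (ε₀ : ℝ) (φ : ℝ → ℝ → Space d → Vel d U → ℝ)
    (P τ : ℝ≥0∞) : Prop :=
  ∀ t : ℝ, 0 ≤ t → ENNReal.ofReal t < τ → ∃ K : ℝ≥0, (K : ℝ≥0∞) < P ∧
    ∀ ε ∈ Set.Ioc 0 ε₀, ∀ s ∈ Set.Icc 0 t, ∀ w, LipschitzWith K (fun x => φ ε s x w)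

/-- Weak convergence of measures, tested against bounded continuous functions. -/
def ConvergesWeakly {X : Type*} [TopologicalSpace X] [MeasurableSpace X]
    (m : ℕ → Measure X) (μ : Measure X) : Prop :=
  ∀ g : X →ᵇ ℝ, Tendsto (fun k => ∫ z, g z ∂(m k)) atTop (𝓝 (∫ z, g z ∂μ))

/-- The measure `f(t,x,v,v̂) dx dv dv̂` on phase space, at a fixed time `t`. -/
def measureAt {d : ℕ} {U : ℝ} (f : ℝ → Space d → Vel d U → ℝ) (t : ℝ) :
    Measure (Space d × Vel d U) :=
  (phaseMeasure d U).withDensity (fun z => ENNReal.ofReal (f t z.1 z.2))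

/-- The measure `f(s,x,v,v̂) ds dx dv dv̂` on `[0,t] × ℝ^d × 𝒱`. -/
def measureUpTo {d : ℕ} {U : ℝ} (f : ℝ → Space d → Vel d U → ℝ) (t : ℝ) :
    Measure (ℝ × Space d × Vel d U) :=
  (((volume : Measure ℝ).restrict (Set.Icc 0 t)).prod (phaseMeasure d U)).withDensity
    (fun z => ENNReal.ofReal (f z.1 z.2.1 z.2.2))

end BGK

end

namespace BGK

variable {d : ℕ} {U : ℝ}

/-! ### The velocity set -/

/-! The kinetic equation is linear with a nonnegative gain term, so it has a comparison principle
(`IsKineticSolution.le_of_supersolution`). The a priori bounds come from comparing a solution with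
multiples of its initial value or of its translates. In the Hopf–Cole variable a factor `exp (A/ε)`
in such a comparison is an additive error `A`, uniformly in `ε`. Time translates give the Lipschitz
bound in time. Space translates solve an equation with a translated kernel; the excess is a fraction
of the gain term, and the gain is itself controlled by the Lipschitz constants (`Setup.gain_le`),
which closes a Gronwall-type loop (`Setup.abs_phase_sub_space_le`). Since the kernel is bounded
below, the density is comparable to `f` at every velocity, so the dependence of the phase on the
velocity disappears in the limit (`eventually_osc_le`). With Arzelà–Ascoli this gives compactness on
all of `[0,∞)`; the horizon `τ` matters only for identifying the limit.

The limit is identified by perturbed test functions. At a slope `p` put `Q = T₀ / (1 + H - v v̂ ·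
p)`; the implicit equation says that `Q` has integral one. At an extremum of `φ_ε + ε log Q - ψ`,
integrating the extremality in velocity compares `f` with `Q ρ`, and the kinetic equation turns into
the required inequality for `∂_t ψ + H`, up to small errors (`eventually_exists_test_point`,
`limit_isViscositySolution`). The root `H` is available because gradients of test functions are
bounded by a Lipschitz constant below `P` (`norm_gradient_le_of_isLocalMax`). Uniqueness is a
doubling of variables; as `H` is `U`-Lipschitz in `p`, an exponential barrier localizes it to a
backward cone and no growth condition is needed (`viscosity_le`).

For the measures, `∫ T = 1` conserves mass and the speed bound `U` propagates the first moment, so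
there is tightness. Weighted by `e^{-s}` in time, the space-time measures are probability measures
with one fixed time marginal; a single Prokhorov extraction then serves all times, and the marginal
shows that no mass sits on the boundary of a time interval. The limit phase is nonnegative, since
otherwise the mass would blow up, and where it is positive `f` is exponentially small, so the limit
measures live on its zero set. -/

instance : IsFiniteMeasure ((volume : Measure ℝ).comap (Subtype.val : Set.Icc (0 : ℝ) U → ℝ)) where
  measure_univ_lt_top := by
    rw [(MeasurableEmbedding.subtype_coe measurableSet_Icc).comap_apply, image_univ,
      Subtype.range_coe]
    exact measure_Icc_lt_top

instance : IsFiniteMeasure (velMeasure d U) := by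
  unfold velMeasure; infer_instance

theorem isOpenPosMeasure_Icc (hU : 0 < U) :
    ((volume : Measure ℝ).comap (Subtype.val : Set.Icc (0 : ℝ) U → ℝ)).IsOpenPosMeasure where
  open_pos := by
    rintro V hV ⟨x, hx⟩
    rw [(MeasurableEmbedding.subtype_coe measurableSet_Icc).comap_apply]
    obtain ⟨O, hO, rfl⟩ := isOpen_induced_iff.1 hV
    rw [Subtype.image_preimage_coe]
    have hx' : (x : ℝ) ∈ closure (Ioo 0 U) := by
      rw [closure_Ioo hU.ne]; exact x.2
    obtain ⟨z, hzO, hz⟩ := mem_closure_iff.1 hx' O hO hx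
    have hpos : 0 < volume (O ∩ Ioo 0 U) := (hO.inter isOpen_Ioo).measure_pos _ ⟨z, hzO, hz⟩
    refine (hpos.trans_le (measure_mono ?_)).ne'
    exact fun a ha => ⟨Ioo_subset_Icc_self ha.2, ha.1⟩

/-- Full support makes integrals of positive continuous functions positive and gives velocity balls
positive mass. -/
theorem isOpenPosMeasure_velMeasure (hU : 0 < U) : (velMeasure d U).IsOpenPosMeasure := by
  have := isOpenPosMeasure_Icc hU
  unfold velMeasure; infer_instance

theorem nonempty_vel (hd : 0 < d) (hU : 0 < U) : Nonempty (Vel d U) := by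
  have : Nonempty (Fin d) := ⟨⟨0, hd⟩⟩
  have : Nontrivial (Space d) := inferInstance
  obtain ⟨z, hz⟩ := (NormedSpace.sphere_nonempty (x := (0 : Space d)) (r := 1)).2 zero_le_one
  exact ⟨⟨⟨0, left_mem_Icc.2 hU.le⟩, ⟨z, hz⟩⟩⟩

theorem norm_vec_le (w : Vel d U) : ‖vec w‖ ≤ U := by
  have h1 : ‖(w.2 : Space d)‖ = 1 := by simp
  rw [vec, norm_smul, h1, mul_one, Real.norm_of_nonneg w.1.2.1]
  exact w.1.2.2

theorem norm_vec_sub_le (w w' : Vel d U) : ‖vec w - vec w'‖ ≤ (1 + U) * dist w w' := by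
  have h1 : ‖(w'.2 : Space d)‖ = 1 := by simp
  have e : vec w - vec w' = (w.1 : ℝ) • ((w.2 : Space d) - w'.2)
      + ((w.1 : ℝ) - w'.1) • (w'.2 : Space d) := by
    simp only [vec, smul_sub, sub_smul]; abel
  have a1 : ‖(w.2 : Space d) - w'.2‖ ≤ dist w w' := by
    rw [← dist_eq_norm]; exact le_max_right _ _
  have a2 : |(w.1 : ℝ) - w'.1| ≤ dist w w' := by
    rw [← Real.dist_eq]; exact le_max_left _ _
  have hw := w.1.2
  calc ‖vec w - vec w'‖ ≤ ‖(w.1 : ℝ) • ((w.2 : Space d) - w'.2)‖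
        + ‖((w.1 : ℝ) - w'.1) • (w'.2 : Space d)‖ := by rw [e]; exact norm_add_le _ _
    _ = (w.1 : ℝ) * ‖(w.2 : Space d) - w'.2‖ + |(w.1 : ℝ) - w'.1| := by
        rw [norm_smul, norm_smul, h1, mul_one, Real.norm_of_nonneg hw.1, Real.norm_eq_abs]
    _ ≤ U * dist w w' + dist w w' := by
        gcongr
        · exact hw.1.trans hw.2
        · exact hw.2
    _ = _ := by ring

theorem continuous_vec : Continuous (vec : Vel d U → Space d) := by
  unfold vec; fun_prop

/-! ### Duhamel inequality along characteristics -/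

/-- Comparing derivatives pointwise, rather than integrating them, means that nothing has to be
known about the regularity of the density along a characteristic. -/
theorem sub_le_sub_of_deriv_le {E E' G G' : ℝ → ℝ} {t : ℝ} (ht : 0 ≤ t)
    (hE : ∀ s ∈ Icc 0 t, HasDerivWithinAt E (E' s) (Ici 0) s)
    (hG : ∀ s ∈ Icc 0 t, HasDerivWithinAt G (G' s) (Ici 0) s)
    (hle : ∀ s ∈ Icc 0 t, E' s ≤ G' s) : E t - E 0 ≤ G t - G 0 := by
  have key := image_le_of_deriv_right_le_deriv_boundary (f := E) (f' := E') (a := 0) (b := t)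
    (B := fun s => G s + (E 0 - G 0)) (B' := G')
    (fun s hs => (hE s hs).continuousWithinAt.mono Icc_subset_Ici_self)
    (fun s hs => (hE s (Ico_subset_Icc_self hs)).mono (Ici_subset_Ici.2 hs.1))
    (by simp)
    (fun s hs => ((hG s hs).continuousWithinAt.mono Icc_subset_Ici_self).add
      continuousWithinAt_const)
    (fun s hs => ((hG s (Ico_subset_Icc_self hs)).mono (Ici_subset_Ici.2 hs.1)).add_const _)
    (fun s hs => hle s (Ico_subset_Icc_self hs))
  have := key (right_mem_Icc.2 ht)
  linarith

namespace IsKineticSolution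

variable {ε : ℝ} {T : Space d → Vel d U → ℝ} {f : ℝ → Space d → Vel d U → ℝ}

theorem measurable_section (hf : IsKineticSolution ε T f) {t : ℝ} (ht : 0 ≤ t) (x : Space d) :
    Measurable (f t x) :=
  (hf.measurable t ht).comp (measurable_const.prodMk measurable_id)

theorem exists_bound (hf : IsKineticSolution ε T f) {t : ℝ} (ht : 0 ≤ t) (x : Space d) :
    ∃ M, ∀ w, |f t x w| ≤ M := by
  obtain ⟨M, hM⟩ := hf.locallyBounded (max t ‖x‖)
  exact ⟨M, fun w => hM t ⟨ht, le_max_left _ _⟩ x (le_max_right _ _) w⟩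

theorem integrable_section (hf : IsKineticSolution ε T f) {t : ℝ} (ht : 0 ≤ t) (x : Space d) :
    Integrable (f t x) (velMeasure d U) := by
  obtain ⟨M, hM⟩ := hf.exists_bound ht x
  exact Integrable.of_bound (hf.measurable_section ht x).aestronglyMeasurable M
    (Eventually.of_forall hM)

theorem hasDerivWithinAt_char (hf : IsKineticSolution ε T f) (y : Space d) (w : Vel d U) {s : ℝ}
    (hs : 0 ≤ s) :
    HasDerivWithinAt (fun σ => f σ (y + σ • vec w) w)
      ((density f s (y + s • vec w) * T (y + s • vec w) w - f s (y + s • vec w) w) / ε)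
      (Ici 0) s := by
  have h := hf.equation s hs (y + s • vec w) w
  have e : (fun σ => f σ (y + s • vec w + (σ - s) • vec w) w)
      = fun σ => f σ (y + σ • vec w) w := by
    funext σ
    congr 1
    rw [sub_smul]; abel
  rwa [e] at h

/-- The integrating factor cancels the loss term, so only the nonnegative gain remains. -/
theorem hasDerivWithinAt_exp_char (hf : IsKineticSolution ε T f) (hε : 0 < ε) (y : Space d)
    (w : Vel d U) {s : ℝ} (hs : 0 ≤ s) :
    HasDerivWithinAt (fun σ => Real.exp (σ / ε) * f σ (y + σ • vec w) w)
      (Real.exp (s / ε) * (density f s (y + s • vec w) * T (y + s • vec w) w) / ε) (Ici 0) s := by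
  have h1 : HasDerivWithinAt (fun σ : ℝ => Real.exp (σ / ε)) (Real.exp (s / ε) * (1 / ε))
      (Ici 0) s := ((hasDerivAt_id s).div_const ε).exp.hasDerivWithinAt
  refine (h1.mul (hf.hasDerivWithinAt_char y w hs)).congr_deriv ?_
  field_simp
  ring

theorem exp_mul_sub_le (hf : IsKineticSolution ε T f) (hε : 0 < ε) (y : Space d)
    (w : Vel d U) {t : ℝ} (ht : 0 ≤ t) {G G' : ℝ → ℝ}
    (hG : ∀ s ∈ Icc 0 t, HasDerivWithinAt G (G' s) (Ici 0) s)
    (hle : ∀ s ∈ Icc 0 t,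
      Real.exp (s / ε) * (density f s (y + s • vec w) * T (y + s • vec w) w) / ε ≤ G' s) :
    Real.exp (t / ε) * f t (y + t • vec w) w - f 0 y w ≤ G t - G 0 := by
  have := sub_le_sub_of_deriv_le ht
    (fun s hs => hf.hasDerivWithinAt_exp_char hε y w hs.1) hG hle
  simpa using this

theorem le_exp_mul_sub (hf : IsKineticSolution ε T f) (hε : 0 < ε) (y : Space d)
    (w : Vel d U) {t : ℝ} (ht : 0 ≤ t) {G G' : ℝ → ℝ}
    (hG : ∀ s ∈ Icc 0 t, HasDerivWithinAt G (G' s) (Ici 0) s)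
    (hle : ∀ s ∈ Icc 0 t,
      G' s ≤ Real.exp (s / ε) * (density f s (y + s • vec w) * T (y + s • vec w) w) / ε) :
    G t - G 0 ≤ Real.exp (t / ε) * f t (y + t • vec w) w - f 0 y w := by
  have := sub_le_sub_of_deriv_le ht hG
    (fun s hs => hf.hasDerivWithinAt_exp_char hε y w hs.1) hle
  simpa using this

/-- Comparison principle. The majorant `F` is a supersolution in the sense of the Duhamel formula:
along each characteristic the time integral of the gain term of `F` is dominated by a differentiable
function. -/
theorem le_of_supersolution (hf : IsKineticSolution ε T f) (hU : 0 < U) (hε : 0 < ε)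
    (hT : ∀ x w, 0 ≤ T x w) {F : ℝ → Space d → Vel d U → ℝ} {S : ℝ} (hS : 0 ≤ S)
    (hFm : ∀ t ∈ Icc 0 S, ∀ x, Measurable (F t x))
    (hFb : ∀ R, ∃ c, 0 < c ∧ ∃ M, ∀ t ∈ Icc 0 S, ∀ x, ‖x‖ ≤ R → ∀ w, c ≤ F t x w ∧ F t x w ≤ M)
    (h0 : ∀ x w, f 0 x w ≤ F 0 x w)
    (hsup : ∀ t ∈ Icc 0 S, ∀ y w, ∃ G G' : ℝ → ℝ,
      (∀ s ∈ Icc 0 t, HasDerivWithinAt G (G' s) (Ici 0) s) ∧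
      (∀ s ∈ Icc 0 t,
        Real.exp (s / ε) * (density F s (y + s • vec w) * T (y + s • vec w) w) / ε ≤ G' s) ∧
      F 0 y w ≤ G 0 ∧ G t ≤ Real.exp (t / ε) * F t (y + t • vec w) w) :
    ∀ t ∈ Icc 0 S, ∀ x w, f t x w ≤ F t x w := by
  intro t₁ ht₁ x₁ w₁
  -- The argument runs in the cone `‖x‖ ≤ R + U (S - t)`: backward characteristics do not leave it,
  -- and it is bounded, so the local bounds on `f` and `F` suffice.
  set R := ‖x₁‖ with hR
  have hR0 : 0 ≤ R := norm_nonneg _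
  obtain ⟨c, hc, M, hFM⟩ := hFb (R + U * S)
  obtain ⟨Mf, hMf⟩ := hf.locallyBounded (max (R + U * S) S)
  have hM : 0 < M := by
    have := hFM t₁ ht₁ x₁ (by nlinarith) w₁
    linarith [this.1, this.2]
  have hcM : c ≤ M := by
    have := hFM t₁ ht₁ x₁ (by nlinarith) w₁
    linarith [this.1, this.2]
  have hball : ∀ t ∈ Icc 0 S, ∀ x : Space d, ‖x‖ ≤ R + U * (S - t) → ‖x‖ ≤ R + U * S := by
    intro t ht x hx
    nlinarith [ht.1]
  -- With this choice `exp (t/ε) * lam * F t ≤ F 0` along characteristics: a fixed fraction of the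
  -- majorant comes from the initial value.
  set lam := Real.exp (-(S / ε)) * (c / M) with hlam
  have hlam0 : 0 < lam := by positivity
  have hlam1 : lam ≤ 1 := by
    have e1 : Real.exp (-(S / ε)) ≤ 1 := Real.exp_le_one_iff.2 (by
      have : 0 ≤ S / ε := by positivity
      linarith)
    have e2 : c / M ≤ 1 := (div_le_one hM).2 hcM
    calc lam ≤ 1 * 1 := mul_le_mul e1 e2 (by positivity) zero_le_one
      _ = 1 := one_mul 1
  -- In Duhamel's formula only the gain carries the factor `m`; the initial term carries the factor
  -- `1`. Hence the excess `m - 1` shrinks by `1 - lam`, and iteration removes it.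
  have step : ∀ m : ℝ, 1 ≤ m →
      (∀ t ∈ Icc 0 S, ∀ x, ‖x‖ ≤ R + U * (S - t) → ∀ w, f t x w ≤ m * F t x w) →
      ∀ t ∈ Icc 0 S, ∀ x, ‖x‖ ≤ R + U * (S - t) → ∀ w,
        f t x w ≤ (1 + (m - 1) * (1 - lam)) * F t x w := by
    intro m hm hle t ht x hx w
    set y := x - t • vec w with hy
    have hxy : y + t • vec w = x := by simp [hy]
    have hcone : ∀ s ∈ Icc 0 t, ‖y + s • vec w‖ ≤ R + U * (S - s) := by
      intro s hs
      have e : y + s • vec w = x - (t - s) • vec w := by rw [hy, sub_smul]; abel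
      calc ‖y + s • vec w‖ ≤ ‖x‖ + ‖(t - s) • vec w‖ := by rw [e]; exact norm_sub_le _ _
        _ ≤ (R + U * (S - t)) + (t - s) * U := by
            rw [norm_smul, Real.norm_of_nonneg (by linarith [hs.2])]
            exact add_le_add hx (mul_le_mul_of_nonneg_left (norm_vec_le w) (by linarith [hs.2]))
        _ = _ := by ring
    obtain ⟨G, G', hG, hGG, hG0, hGt⟩ := hsup t ht y w
    have hd := hf.exp_mul_sub_le hε y w ht.1 (G := fun s => m * G s) (G' := fun s => m * G' s)
      (fun s hs => (hG s hs).const_mul m) (by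
        intro s hs
        have hsS : s ∈ Icc 0 S := ⟨hs.1, hs.2.trans ht.2⟩
        refine le_trans ?_ (mul_le_mul_of_nonneg_left (hGG s hs) (by linarith))
        have hden : density f s (y + s • vec w) ≤ m * density F s (y + s • vec w) := by
          unfold density
          rw [← integral_const_mul]
          refine integral_mono (hf.integrable_section hs.1 _) ?_ (fun w' => hle s hsS _ (hcone s hs) w')
          refine Integrable.const_mul ?_ m
          refine Integrable.of_bound (hFm s hsS _).aestronglyMeasurable M
            (Eventually.of_forall fun w' => ?_)
          have := hFM s hsS _ (hball s hsS _ (hcone s hs)) w'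
          rw [Real.norm_of_nonneg (hc.le.trans this.1)]
          exact this.2
        have e : m * (Real.exp (s / ε) * (density F s (y + s • vec w) * T (y + s • vec w) w) / ε)
          = Real.exp (s / ε) * ((m * density F s (y + s • vec w)) * T (y + s • vec w) w) / ε := by
          ring
        rw [e]
        have := hT (y + s • vec w) w
        gcongr)
    rw [hxy] at hd hGt
    have hF0 : c ≤ F 0 y w := by
      have h := hcone 0 ⟨le_rfl, ht.1⟩
      rw [zero_smul, add_zero] at h
      exact (hFM 0 ⟨le_rfl, hS⟩ y (by simpa using h) w).1
    have hFt := hFM t ht x (hball t ht x hx) w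
    have hexp : Real.exp (t / ε) * Real.exp (-(S / ε)) ≤ 1 := by
      rw [← Real.exp_add]
      refine Real.exp_le_one_iff.2 ?_
      have : t / ε ≤ S / ε := by gcongr; exact ht.2
      linarith
    have hkey : Real.exp (t / ε) * lam * F t x w ≤ F 0 y w := by
      calc Real.exp (t / ε) * lam * F t x w
          = (Real.exp (t / ε) * Real.exp (-(S / ε))) * (c * (F t x w / M)) := by
            rw [hlam]; ring
        _ ≤ 1 * (c * 1) := by
            have : F t x w / M ≤ 1 := (div_le_one hM).2 hFt.2
            have h3 : 0 ≤ F t x w / M := div_nonneg (hc.le.trans hFt.1) hM.le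
            gcongr
        _ ≤ F 0 y w := by linarith
    have hE : 0 < Real.exp (t / ε) := Real.exp_pos _
    refine le_of_mul_le_mul_left (a := Real.exp (t / ε)) ?_ hE
    have h1 := h0 y w
    have h2 : m * G t ≤ m * (Real.exp (t / ε) * F t x w) :=
      mul_le_mul_of_nonneg_left hGt (by linarith)
    have h3 : m * F 0 y w ≤ m * G 0 := mul_le_mul_of_nonneg_left hG0 (by linarith)
    have h4 : (m - 1) * (Real.exp (t / ε) * lam * F t x w) ≤ (m - 1) * F 0 y w :=
      mul_le_mul_of_nonneg_left hkey (by linarith)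
    nlinarith
  -- A crude first factor: the upper bound of `f` over the lower bound of `F` on the cone.
  set m₀ := max 1 (Mf / c) with hm₀
  have hm₀1 : 1 ≤ m₀ := le_max_left _ _
  have iter : ∀ n : ℕ, ∀ t ∈ Icc 0 S, ∀ x, ‖x‖ ≤ R + U * (S - t) → ∀ w,
      f t x w ≤ (1 + (m₀ - 1) * (1 - lam) ^ n) * F t x w := by
    intro n
    induction n with
    | zero =>
      intro t ht x hx w
      have hxb := hball t ht x hx
      have h1 := hMf t ⟨ht.1, ht.2.trans (le_max_right _ _)⟩ x (hxb.trans (le_max_left _ _)) w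
      have h2 := (hFM t ht x hxb w).1
      have h3 : Mf / c ≤ m₀ := le_max_right _ _
      have h4 : Mf ≤ m₀ * c := (div_le_iff₀ hc).1 h3
      calc f t x w ≤ |f t x w| := le_abs_self _
        _ ≤ m₀ * c := h1.trans h4
        _ ≤ m₀ * F t x w := mul_le_mul_of_nonneg_left h2 (by linarith)
        _ = _ := by ring
    | succ n ih =>
      intro t ht x hx w
      have hq : 0 ≤ (m₀ - 1) * (1 - lam) ^ n :=
        mul_nonneg (by linarith) (pow_nonneg (by linarith) n)
      have := step _ (by linarith) ih t ht x hx w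
      refine this.trans_eq ?_
      ring
  have hlim : Tendsto (fun n : ℕ => (1 + (m₀ - 1) * (1 - lam) ^ n) * F t₁ x₁ w₁) atTop
      (𝓝 ((1 + (m₀ - 1) * 0) * F t₁ x₁ w₁)) :=
    (((tendsto_pow_atTop_nhds_zero_of_lt_one (by linarith) (by linarith)).const_mul _).const_add
      _).mul_const _
  have := ge_of_tendsto' hlim (fun n => iter n t₁ ht₁ x₁ (by nlinarith [ht₁.2]) w₁)
  simpa using this

end IsKineticSolution


/-! ### A priori estimates for a fixed parameter -/

theorem hopfCole_pos (ε : ℝ) (φ : ℝ → Space d → Vel d U → ℝ) (t : ℝ) (x : Space d) (w : Vel d U) :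
    0 < hopfCole ε φ t x w := Real.exp_pos _

theorem density_hopfCole_nonneg (ε : ℝ) (φ : ℝ → Space d → Vel d U → ℝ) (t : ℝ) (x : Space d) :
    0 ≤ density (hopfCole ε φ) t x :=
  integral_nonneg fun w => (hopfCole_pos ε φ t x w).le

theorem hopfCole_le_exp_mul_iff {ε : ℝ} (hε : 0 < ε) (φ : ℝ → Space d → Vel d U → ℝ) {t s : ℝ}
    {x y : Space d} {w w' : Vel d U} {A : ℝ} :
    hopfCole ε φ t x w ≤ Real.exp (A / ε) * hopfCole ε φ s y w' ↔ φ s y w' - φ t x w ≤ A := by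
  unfold hopfCole
  rw [← Real.exp_add, Real.exp_le_exp, ← add_div, div_le_div_iff_of_pos_right hε]
  constructor <;> intro h <;> linarith

namespace IsKineticSolution

variable {ε : ℝ} {T : Space d → Vel d U → ℝ} {f : ℝ → Space d → Vel d U → ℝ}

theorem shift_time (hf : IsKineticSolution ε T f) {δ : ℝ} (hδ : 0 ≤ δ) :
    IsKineticSolution ε T (fun t => f (t + δ)) where
  measurable t ht := hf.measurable (t + δ) (by linarith)
  locallyBounded R := by
    obtain ⟨M, hM⟩ := hf.locallyBounded (R + δ)
    exact ⟨M, fun t ht x hx w => hM _ ⟨by linarith [ht.1], by linarith [ht.2]⟩ x (by linarith) w⟩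
  equation t ht x w := by
    have h := hf.equation (t + δ) (by linarith) x w
    have hc : HasDerivWithinAt (fun s : ℝ => s + δ) 1 (Ici 0) t :=
      ((hasDerivAt_id t).add_const δ).hasDerivWithinAt
    have hm : MapsTo (fun s : ℝ => s + δ) (Ici 0) (Ici 0) := fun s hs => by
      have : (0 : ℝ) ≤ s := hs
      exact add_nonneg this hδ
    have := HasDerivWithinAt.scomp t h hc hm
    simpa [Function.comp_def, density] using this

theorem shift_space (hf : IsKineticSolution ε T f) (h : Space d) :
    IsKineticSolution ε (fun x => T (x + h)) (fun t x => f t (x + h)) where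
  measurable t ht := (hf.measurable t ht).comp
    ((measurable_fst.add_const h).prodMk measurable_snd)
  locallyBounded R := by
    obtain ⟨M, hM⟩ := hf.locallyBounded (R + ‖h‖)
    refine ⟨M, fun t ht x hx w => hM _ ⟨ht.1, ?_⟩ _ ?_ w⟩
    · linarith [ht.2, norm_nonneg h]
    · exact (norm_add_le _ _).trans (by linarith)
  equation t ht x w := by
    have := hf.equation t ht (x + h) w
    simpa [density, add_right_comm] using this

end IsKineticSolution

/-- The data of the theorem at one value of the parameter. -/
structure Setup (ε Tmin LM : ℝ) (K₀ : ℝ≥0) (C₀ : ℝ) (T : Space d → Vel d U → ℝ)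
    (φ : ℝ → Space d → Vel d U → ℝ) : Prop where
  dim_pos : 0 < d
  speed_pos : 0 < U
  eps_pos : 0 < ε
  min_pos : 0 < Tmin
  prob : ∀ x, ∫ w, T x w ∂(velMeasure d U) = 1
  lower : ∀ x w, Tmin ≤ T x w
  upper : ∀ x w, T x w ≤ LM
  lip_x : ∀ x y w, |T x w - T y w| ≤ LM * ‖x - y‖
  lip_v : ∀ x w w', |T x w - T x w'| ≤ LM * dist w w'
  sol : IsKineticSolution ε T (hopfCole ε φ)
  init_lip : ∀ w, LipschitzWith K₀ (fun x => φ 0 x w)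
  init_osc : ∀ x w w', |φ 0 x w - φ 0 x w'| ≤ 2 * C₀ * ε

/-- The ratio of gain and loss terms at time zero is at most this constant. -/
noncomputable def gainConst (d : ℕ) (U LM C₀ : ℝ) : ℝ :=
  LM * Real.exp (2 * C₀) * (velMeasure d U).real univ

/-- Lipschitz constant of the phases in time. -/
noncomputable def timeLip (d : ℕ) (U LM : ℝ) (K₀ : ℝ≥0) (C₀ : ℝ) : ℝ :=
  K₀ * U + gainConst d U LM C₀ + 1

/-- Lipschitz constant of the phases in space at time `t`. -/
noncomputable def spaceLip (d : ℕ) (U Tmin LM : ℝ) (K₀ : ℝ≥0) (C₀ t : ℝ) : ℝ :=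
  K₀ + LM / Tmin * (1 + timeLip d U LM K₀ C₀) * t +
    (K₀ + (1 + timeLip d U LM K₀ C₀) / (2 * U)) * (Real.exp (2 * (LM / Tmin) * U * t) - 1)

namespace Setup

variable {ε Tmin LM : ℝ} {K₀ : ℝ≥0} {C₀ : ℝ} {T : Space d → Vel d U → ℝ}
  {φ : ℝ → Space d → Vel d U → ℝ}

theorem T_pos (h : Setup ε Tmin LM K₀ C₀ T φ) (x : Space d) (w : Vel d U) : 0 < T x w :=
  h.min_pos.trans_le (h.lower x w)

theorem LM_pos (h : Setup ε Tmin LM K₀ C₀ T φ) : 0 < LM := by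
  obtain ⟨w⟩ := nonempty_vel h.dim_pos h.speed_pos
  exact (h.T_pos 0 w).trans_le (h.upper 0 w)

theorem C₀_nonneg (h : Setup ε Tmin LM K₀ C₀ T φ) : 0 ≤ C₀ := by
  obtain ⟨w⟩ := nonempty_vel h.dim_pos h.speed_pos
  have := (abs_nonneg _).trans (h.init_osc 0 w w)
  by_contra hc
  nlinarith [mul_pos (neg_pos.2 (not_le.1 hc)) h.eps_pos]

theorem gainConst_nonneg (h : Setup ε Tmin LM K₀ C₀ T φ) : 0 ≤ gainConst d U LM C₀ := by
  have := h.LM_pos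
  unfold gainConst; positivity

theorem timeLip_nonneg (h : Setup ε Tmin LM K₀ C₀ T φ) : 0 ≤ timeLip d U LM K₀ C₀ := by
  have := h.gainConst_nonneg
  have := h.speed_pos
  unfold timeLip; positivity

theorem init_sub_le (h : Setup ε Tmin LM K₀ C₀ T φ) (x y : Space d) (w : Vel d U) :
    φ 0 x w - φ 0 y w ≤ K₀ * ‖x - y‖ := by
  have := (h.init_lip w).dist_le_mul x y
  rw [Real.dist_eq, dist_eq_norm] at this
  exact (le_abs_self _).trans this

/-- The initial oscillation in velocity is of order `ε`, so after division by `ε` it costs only the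
factor `exp (2 * C₀)`. -/
theorem init_gain_le (h : Setup ε Tmin LM K₀ C₀ T φ) (x : Space d) (w : Vel d U) :
    density (hopfCole ε φ) 0 x * T x w ≤ gainConst d U LM C₀ * hopfCole ε φ 0 x w := by
  have h1 : density (hopfCole ε φ) 0 x
      ≤ (velMeasure d U).real univ * (Real.exp (2 * C₀) * hopfCole ε φ 0 x w) := by
    calc density (hopfCole ε φ) 0 x
        ≤ ∫ _w', Real.exp (2 * C₀) * hopfCole ε φ 0 x w ∂(velMeasure d U) := by
          refine integral_mono (h.sol.integrable_section le_rfl x) (integrable_const _) fun w' => ?_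
          have : 2 * C₀ = 2 * C₀ * ε / ε := by field_simp [h.eps_pos.ne']
          rw [this]
          rw [hopfCole_le_exp_mul_iff h.eps_pos]
          exact (le_abs_self _).trans (h.init_osc x w w')
      _ = _ := by rw [integral_const, smul_eq_mul]
  have h2 := density_hopfCole_nonneg ε φ 0 x
  have h3 := h.LM_pos
  calc density (hopfCole ε φ) 0 x * T x w ≤ density (hopfCole ε φ) 0 x * LM :=
        mul_le_mul_of_nonneg_left (h.upper x w) h2
    _ ≤ (velMeasure d U).real univ * (Real.exp (2 * C₀) * hopfCole ε φ 0 x w) * LM :=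
        mul_le_mul_of_nonneg_right h1 h3.le
    _ = _ := by unfold gainConst; ring

theorem init_bound (h : Setup ε Tmin LM K₀ C₀ T φ) (R : ℝ) :
    ∃ M, ∀ x : Space d, ‖x‖ ≤ R → ∀ w, |φ 0 x w| ≤ M := by
  obtain ⟨w₀⟩ := nonempty_vel h.dim_pos h.speed_pos
  refine ⟨K₀ * R + |φ 0 0 w₀| + 2 * C₀ * ε, fun x hx w => ?_⟩
  have h1 := h.init_osc x w w₀
  have h2 := (h.init_lip w₀).dist_le_mul x 0
  rw [Real.dist_eq, dist_zero_right] at h2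
  have h3 : (K₀ : ℝ) * ‖x‖ ≤ K₀ * R := mul_le_mul_of_nonneg_left hx K₀.2
  rw [abs_le] at *
  constructor <;> linarith [neg_abs_le (φ 0 0 w₀), le_abs_self (φ 0 0 w₀), h1.1, h1.2, h2.1, h2.2]

theorem norm_char_sub (y : Space d) (w : Vel d U) {s t : ℝ} (hst : s ≤ t) :
    ‖y + s • vec w - (y + t • vec w)‖ ≤ U * (t - s) := by
  have : y + s • vec w - (y + t • vec w) = -((t - s) • vec w) := by rw [sub_smul]; abel
  rw [this, norm_neg, norm_smul, Real.norm_of_nonneg (by linarith), mul_comm]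
  exact mul_le_mul_of_nonneg_right (norm_vec_le w) (by linarith)

/-- Dropping the gain leaves free transport with decay `exp (-t/ε)`: the phase grows by at most `t`,
and moving the foot of the characteristic back to `x` costs `K₀ U t`. -/
theorem init_le_add (h : Setup ε Tmin LM K₀ C₀ T φ) {t : ℝ} (ht : 0 ≤ t) (x : Space d)
    (w : Vel d U) : φ t x w ≤ φ 0 x w + timeLip d U LM K₀ C₀ * t := by
  have hd := h.sol.le_exp_mul_sub h.eps_pos (x - t • vec w) w ht (G := fun _ => 0)
    (G' := fun _ => 0) (fun s _ => hasDerivWithinAt_const _ _ _) (fun s hs => by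
      have := density_hopfCole_nonneg ε φ s (x - t • vec w + s • vec w)
      have := (h.T_pos (x - t • vec w + s • vec w) w).le
      have := h.eps_pos
      positivity)
  rw [sub_zero, sub_nonneg, sub_add_cancel, hopfCole_le_exp_mul_iff h.eps_pos] at hd
  have h1 := h.init_sub_le (x - t • vec w) x w
  have h2 : ‖x - t • vec w - x‖ ≤ U * t := by
    have := norm_char_sub (x - t • vec w) w ht
    simpa using this
  have h3 : (K₀ : ℝ) * ‖x - t • vec w - x‖ ≤ K₀ * (U * t) := mul_le_mul_of_nonneg_left h2 K₀.2
  have h4 := mul_nonneg h.gainConst_nonneg ht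
  unfold timeLip
  nlinarith

/-- Supplies the two-sided local bounds that the comparison principle asks of a majorant. -/
theorem bound_below_init (h : Setup ε Tmin LM K₀ C₀ T φ) (S R : ℝ) :
    ∃ c, 0 < c ∧ ∃ M, ∀ t ∈ Icc 0 S, ∀ x : Space d, ‖x‖ ≤ R → ∀ w,
      c ≤ hopfCole ε φ t x w ∧ hopfCole ε φ t x w ≤ M := by
  obtain ⟨M, hM⟩ := h.init_bound R
  obtain ⟨M', hM'⟩ := h.sol.locallyBounded (max S R)
  refine ⟨Real.exp (-(M + timeLip d U LM K₀ C₀ * S) / ε), Real.exp_pos _, M',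
    fun t ht x hx w => ⟨?_, ?_⟩⟩
  · have h1 := h.init_le_add ht.1 x w
    have h2 := (abs_le.1 (hM x hx w)).2
    have h3 := mul_le_mul_of_nonneg_left ht.2 h.timeLip_nonneg
    have := h.eps_pos
    unfold hopfCole
    gcongr
    linarith
  · exact (le_abs_self _).trans (hM' t ⟨ht.1, ht.2.trans (le_max_left _ _)⟩ x
      (hx.trans (le_max_right _ _)) w)

/-- The function `exp (C t/ε) f(0,x)` is a supersolution, because at time zero the gain is at most
`gainConst` times `f`. -/
theorem init_sub_le_phase (h : Setup ε Tmin LM K₀ C₀ T φ) {t : ℝ} (ht : 0 ≤ t) (x : Space d)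
    (w : Vel d U) : φ 0 x w - φ t x w ≤ timeLip d U LM K₀ C₀ * t := by
  set C := timeLip d U LM K₀ C₀ with hC
  have hC0 : 0 ≤ C := h.timeLip_nonneg
  have hε := h.eps_pos
  have hU := h.speed_pos
  rw [← hopfCole_le_exp_mul_iff h.eps_pos]
  refine h.sol.le_of_supersolution hU hε (fun x w => (h.T_pos x w).le)
    (F := fun t x w => Real.exp (C * t / ε) * hopfCole ε φ 0 x w) ht ?_ ?_ ?_ ?_ t
    (right_mem_Icc.2 ht) x w
  · intro t _ x
    exact (h.sol.measurable_section le_rfl x).const_mul _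
  · intro R
    obtain ⟨c, hc, M, hM⟩ := h.bound_below_init t R
    refine ⟨c, hc, Real.exp (C * t / ε) * M, fun s hs x hx w => ⟨?_, ?_⟩⟩
    · have h1 := (hM 0 ⟨le_rfl, ht⟩ x hx w).1
      have : 1 ≤ Real.exp (C * s / ε) := Real.one_le_exp (by have := hs.1; positivity)
      nlinarith
    · have h1 := (hM 0 ⟨le_rfl, ht⟩ x hx w)
      have h2 := hs.2
      have : 0 ≤ hopfCole ε φ 0 x w := (hopfCole_pos _ _ _ _ _).le
      gcongr
      exact h1.2
  · intro x w
    simp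
  · intro t ht y w
    set z := y + t • vec w with hz
    set f₀ := hopfCole ε φ 0 z w with hf₀
    have hf₀p : 0 < f₀ := hopfCole_pos _ _ _ _ _
    -- The initial phase is only Lipschitz along a characteristic. It is therefore replaced by its
    -- Lipschitz majorant anchored at the endpoint `z`; the result is differentiable and agrees with
    -- the supersolution at `s = t`.
    set g : ℝ → ℝ := fun s => (K₀ * U * (t - s) + (C + 1) * s) / ε with hg
    have hgd : ∀ s, HasDerivAt g ((K₀ * U * (-1) + (C + 1)) / ε) s := fun s => by
      have h1 : HasDerivAt (fun s : ℝ => t - s) (-1) s := by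
        simpa using (hasDerivAt_id s).const_sub t
      have h2 : HasDerivAt (fun s : ℝ => (C + 1) * s) (C + 1) s := by
        simpa using (hasDerivAt_id s).const_mul (C + 1)
      exact ((h1.const_mul _).add h2).div_const ε
    have hcmp : ∀ s ∈ Icc 0 t, hopfCole ε φ 0 (y + s • vec w) w
        ≤ Real.exp (K₀ * U * (t - s) / ε) * f₀ := by
      intro s hs
      rw [hf₀, hopfCole_le_exp_mul_iff hε]
      refine (h.init_sub_le z _ w).trans ?_
      rw [norm_sub_rev, mul_assoc]
      exact mul_le_mul_of_nonneg_left (norm_char_sub y w hs.2) K₀.2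
    refine ⟨fun s => Real.exp (g s) * f₀,
      fun s => Real.exp (g s) * ((K₀ * U * (-1) + (C + 1)) / ε) * f₀,
      fun s _ => ((hgd s).exp.mul_const f₀).hasDerivWithinAt, fun s hs => ?_, ?_, ?_⟩
    · have e1 : density (fun t x w => Real.exp (C * t / ε) * hopfCole ε φ 0 x w) s (y + s • vec w)
          = Real.exp (C * s / ε) * density (hopfCole ε φ) 0 (y + s • vec w) := by
        unfold density; rw [integral_const_mul]
      rw [e1]
      have h1 := h.init_gain_le (y + s • vec w) w
      have h2 := hcmp s hs
      have h3 := h.gainConst_nonneg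
      have e2 : Real.exp (g s)
          = Real.exp (s / ε) * Real.exp (C * s / ε) * Real.exp (K₀ * U * (t - s) / ε) := by
        rw [← Real.exp_add, ← Real.exp_add]; congr 1; simp only [hg]; ring
      calc _ = Real.exp (s / ε) * Real.exp (C * s / ε)
            * (density (hopfCole ε φ) 0 (y + s • vec w) * T (y + s • vec w) w) / ε := by ring
        _ ≤ Real.exp (s / ε) * Real.exp (C * s / ε)
            * (gainConst d U LM C₀ * (Real.exp (K₀ * U * (t - s) / ε) * f₀)) / ε := by
            refine div_le_div_of_nonneg_right (mul_le_mul_of_nonneg_left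
              (h1.trans (mul_le_mul_of_nonneg_left h2 h3)) (by positivity)) hε.le
        _ = Real.exp (g s) * (gainConst d U LM C₀ / ε) * f₀ := by rw [e2]; ring
        _ ≤ _ := by
            refine mul_le_mul_of_nonneg_right (mul_le_mul_of_nonneg_left
              (div_le_div_of_nonneg_right ?_ hε.le) (Real.exp_pos _).le) hf₀p.le
            rw [hC]; unfold timeLip; linarith
    · have := hcmp 0 ⟨le_rfl, ht.1⟩
      simpa [hg] using this
    · refine le_of_eq ?_
      rw [← mul_assoc, ← Real.exp_add]
      simp only [hg]
      congr 2
      ring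

theorem abs_phase_sub_init_le (h : Setup ε Tmin LM K₀ C₀ T φ) {t : ℝ} (ht : 0 ≤ t) (x : Space d)
    (w : Vel d U) : |φ t x w - φ 0 x w| ≤ timeLip d U LM K₀ C₀ * t := by
  rw [abs_le]
  constructor <;> linarith [h.init_sub_le_phase ht x w, h.init_le_add ht x w]

/-- By linearity a multiple of a locally positive solution is again a solution, hence an admissible
majorant. -/
theorem le_of_le_init (h : Setup ε Tmin LM K₀ C₀ T φ) {f g : ℝ → Space d → Vel d U → ℝ}
    (hf : IsKineticSolution ε T f) (hg : IsKineticSolution ε T g) {S : ℝ} (hS : 0 ≤ S)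
    (hgb : ∀ R, ∃ c, 0 < c ∧ ∃ M, ∀ t ∈ Icc 0 S, ∀ x, ‖x‖ ≤ R → ∀ w, c ≤ g t x w ∧ g t x w ≤ M)
    {A : ℝ} (hA : 0 < A) (h0 : ∀ x w, f 0 x w ≤ A * g 0 x w) (x : Space d) (w : Vel d U) :
    f S x w ≤ A * g S x w := by
  refine hf.le_of_supersolution h.speed_pos h.eps_pos (fun x w => (h.T_pos x w).le)
    (F := fun t x w => A * g t x w) hS ?_ ?_ h0 ?_ S (right_mem_Icc.2 hS) x w
  · intro t ht x
    exact (hg.measurable_section ht.1 x).const_mul _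
  · intro R
    obtain ⟨c, hc, M, hM⟩ := hgb R
    refine ⟨A * c, by positivity, A * M, fun s hs x hx w => ⟨?_, ?_⟩⟩
    · exact mul_le_mul_of_nonneg_left (hM s hs x hx w).1 hA.le
    · exact mul_le_mul_of_nonneg_left (hM s hs x hx w).2 hA.le
  · intro t ht y w
    refine ⟨fun s => A * (Real.exp (s / ε) * g s (y + s • vec w) w), _, fun s hs =>
      (hg.hasDerivWithinAt_exp_char h.eps_pos y w hs.1).const_mul A, fun s hs => ?_, ?_, ?_⟩
    · have e1 : density (fun t x w => A * g t x w) s (y + s • vec w)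
          = A * density g s (y + s • vec w) := by
        unfold density; rw [integral_const_mul]
      rw [e1]
      refine le_of_eq ?_
      ring
    · simp
    · refine le_of_eq ?_
      ring

/-- The kernel does not depend on time, so time translates are solutions. They differ initially by a
factor `exp (C |r - t|/ε)`, which comparison propagates. -/
theorem abs_phase_sub_time_le (h : Setup ε Tmin LM K₀ C₀ T φ) {r t : ℝ} (hr : 0 ≤ r) (ht : 0 ≤ t)
    (x : Space d) (w : Vel d U) :
    |φ r x w - φ t x w| ≤ timeLip d U LM K₀ C₀ * |r - t| := by
  wlog hrt : r ≤ t generalizing r t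
  · rw [abs_sub_comm, abs_sub_comm r]
    exact this ht hr (by linarith)
  set C := timeLip d U LM K₀ C₀ with hC
  have hδ : 0 ≤ t - r := by linarith
  have hb1 : ∀ R, ∃ c, 0 < c ∧ ∃ M, ∀ s ∈ Icc 0 r, ∀ x : Space d, ‖x‖ ≤ R → ∀ w,
      c ≤ hopfCole ε φ s x w ∧ hopfCole ε φ s x w ≤ M := h.bound_below_init r
  have hb2 : ∀ R, ∃ c, 0 < c ∧ ∃ M, ∀ s ∈ Icc 0 r, ∀ x : Space d, ‖x‖ ≤ R → ∀ w,
      c ≤ hopfCole ε φ (s + (t - r)) x w ∧ hopfCole ε φ (s + (t - r)) x w ≤ M := by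
    intro R
    obtain ⟨c, hc, M, hM⟩ := h.bound_below_init t R
    exact ⟨c, hc, M, fun s hs => hM _ ⟨by linarith [hs.1], by linarith [hs.2]⟩⟩
  have hinit := fun x w => abs_le.1 (h.abs_phase_sub_init_le hδ x w)
  have h1 := h.le_of_le_init (h.sol.shift_time hδ) h.sol hr hb1
    (Real.exp_pos (C * (t - r) / ε)) (fun x w => by
      simp only [zero_add]
      rw [hopfCole_le_exp_mul_iff h.eps_pos]
      linarith [(hinit x w).1]) x w
  have h2 := h.le_of_le_init h.sol (h.sol.shift_time hδ) hr hb2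
    (Real.exp_pos (C * (t - r) / ε)) (fun x w => by
      simp only [zero_add]
      rw [hopfCole_le_exp_mul_iff h.eps_pos]
      linarith [(hinit x w).2]) x w
  simp only [add_sub_cancel] at h1 h2
  rw [hopfCole_le_exp_mul_iff h.eps_pos] at h1 h2
  rw [abs_sub_comm r, abs_of_nonneg hδ, abs_le]
  constructor <;> linarith

/-- Along a forward characteristic the phase decreases at rate at most `C + U K`, so `f` stays below
an exponential that touches it at time `t`. Comparing right derivatives there bounds `ρ T - f` by
`(C + U K) f`. -/
theorem gain_le (h : Setup ε Tmin LM K₀ C₀ T φ) {t K : ℝ} (ht : 0 ≤ t) (hK : 0 ≤ K)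
    (hlip : ∀ x y w, |φ t x w - φ t y w| ≤ K * ‖x - y‖) (x : Space d) (w : Vel d U) :
    density (hopfCole ε φ) t x * T x w
      ≤ (1 + timeLip d U LM K₀ C₀ + U * K) * hopfCole ε φ t x w := by
  set C := timeLip d U LM K₀ C₀ with hC
  have hε := h.eps_pos
  have hder := (h.sol.equation t ht x w).mono (Ici_subset_Ici.2 ht)
  have hB : HasDerivWithinAt (fun s => Real.exp ((C + U * K) * (s - t) / ε) * hopfCole ε φ t x w)
      (Real.exp ((C + U * K) * (t - t) / ε) * ((C + U * K) * 1 / ε) * hopfCole ε φ t x w)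
      (Ici t) t :=
    (((((hasDerivAt_id t).sub_const t).const_mul (C + U * K)).div_const ε).exp.mul_const
      _).hasDerivWithinAt
  have hle : ∀ s ∈ Ioi t, slope (fun s => hopfCole ε φ s (x + (s - t) • vec w) w) t s
      ≤ slope (fun s => Real.exp ((C + U * K) * (s - t) / ε) * hopfCole ε φ t x w) t s := by
    intro s hs
    have hs' : t < s := hs
    simp only [slope_def_field, sub_self, zero_smul, add_zero, mul_zero, zero_div, Real.exp_zero,
      one_mul]
    have : 0 < s - t := by linarith
    gcongr
    rw [hopfCole_le_exp_mul_iff hε]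
    have h1 := abs_le.1 (h.abs_phase_sub_time_le (ht.trans hs'.le) ht (x + (s - t) • vec w) w)
    have h2 := abs_le.1 (hlip (x + (s - t) • vec w) x w)
    rw [abs_of_pos this] at h1
    have h3 : ‖x + (s - t) • vec w - x‖ ≤ (s - t) * U := by
      rw [add_sub_cancel_left, norm_smul, Real.norm_of_nonneg this.le]
      exact mul_le_mul_of_nonneg_left (norm_vec_le w) this.le
    have h4 := mul_le_mul_of_nonneg_left h3 hK
    nlinarith [h1.1, h2.1]
  have key := le_of_tendsto_of_tendsto
    ((hasDerivWithinAt_iff_tendsto_slope' self_notMem_Ioi).1 (hder.mono Ioi_subset_Ici_self))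
    ((hasDerivWithinAt_iff_tendsto_slope' self_notMem_Ioi).1 (hB.mono Ioi_subset_Ici_self))
    (eventually_mem_nhdsWithin.mono hle)
  rw [sub_self, mul_zero, zero_div, Real.exp_zero, one_mul, mul_one, div_mul_eq_mul_div,
    div_le_div_iff_of_pos_right hε] at key
  linarith

/-- The translate by `k` is compared with `exp (κ ‖k‖/ε) f`. Translating the kernel enlarges the
gain by at most the fraction `‖k‖ LM/Tmin`, and the growth of `κ` pays for it. -/
theorem abs_phase_sub_space_le_of_gain_le (h : Setup ε Tmin LM K₀ C₀ T φ) {S Kmax : ℝ} (hS : 0 ≤ S)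
    {κ κ' : ℝ → ℝ} (hκ : ∀ s ∈ Icc 0 S, HasDerivAt κ (κ' s) s)
    (hκb : ∀ s ∈ Icc 0 S, 0 ≤ κ s ∧ κ s ≤ Kmax) (hκ0 : K₀ ≤ κ 0)
    (hgain : ∀ s ∈ Icc 0 S, ∀ x w,
      LM / Tmin * (density (hopfCole ε φ) s x * T x w) ≤ κ' s * hopfCole ε φ s x w) :
    ∀ t ∈ Icc 0 S, ∀ x y w, |φ t x w - φ t y w| ≤ κ t * ‖x - y‖ := by
  have hε := h.eps_pos
  have hU := h.speed_pos
  have hLM := h.LM_pos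
  have hTm := h.min_pos
  suffices H : ∀ t ∈ Icc 0 S, ∀ (x k : Space d) w, φ t x w - φ t (x + k) w ≤ κ t * ‖k‖ by
    intro t ht x y w
    have h1 := H t ht x (y - x) w
    have h2 := H t ht y (x - y) w
    rw [add_sub_cancel] at h1 h2
    rw [norm_sub_rev y x] at h1
    rw [abs_le]
    constructor <;> linarith
  intro t ht x k w
  rw [← hopfCole_le_exp_mul_iff hε]
  refine (h.sol.shift_space k).le_of_supersolution hU hε (fun x w => (h.T_pos _ w).le)
    (F := fun t x w => Real.exp (κ t * ‖k‖ / ε) * hopfCole ε φ t x w) hS ?_ ?_ ?_ ?_ t ht x w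
  · intro s hs x
    exact (h.sol.measurable_section hs.1 x).const_mul _
  · intro R
    obtain ⟨c, hc, M, hM⟩ := h.bound_below_init S R
    refine ⟨c, hc, Real.exp (Kmax * ‖k‖ / ε) * M, fun s hs x hx w => ⟨?_, ?_⟩⟩
    · have h1 := (hM s hs x hx w).1
      have : 1 ≤ Real.exp (κ s * ‖k‖ / ε) := Real.one_le_exp (by have := (hκb s hs).1; positivity)
      nlinarith
    · have h1 := hM s hs x hx w
      have h2 := (hκb s hs).2
      have : 0 ≤ hopfCole ε φ s x w := (hopfCole_pos _ _ _ _ _).le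
      gcongr
      exact h1.2
  · intro x w
    rw [hopfCole_le_exp_mul_iff hε]
    refine (h.init_sub_le x (x + k) w).trans ?_
    rw [sub_add_cancel_left, norm_neg]
    gcongr
  · intro t ht y w
    refine ⟨fun s => Real.exp (κ s * ‖k‖ / ε)
        * (Real.exp (s / ε) * hopfCole ε φ s (y + s • vec w) w), _,
      fun s hs => ((((hκ s ⟨hs.1, hs.2.trans ht.2⟩).mul_const ‖k‖).div_const
        ε).exp.hasDerivWithinAt).mul (h.sol.hasDerivWithinAt_exp_char hε y w hs.1),
      fun s hs => ?_, ?_, ?_⟩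
    · have hsS : s ∈ Icc 0 S := ⟨hs.1, hs.2.trans ht.2⟩
      set z := y + s • vec w with hz
      have e1 : density (fun t x w => Real.exp (κ t * ‖k‖ / ε) * hopfCole ε φ t x w) s z
          = Real.exp (κ s * ‖k‖ / ε) * density (hopfCole ε φ) s z := by
        unfold density; rw [integral_const_mul]
      rw [e1]
      have hρ := density_hopfCole_nonneg ε φ s z
      -- The lower bound on the kernel turns its additive Lipschitz bound into a multiplicative one.
      have hTk : T (z + k) w ≤ T z w + ‖k‖ * (LM / Tmin * T z w) := by
        have h1 := abs_le.1 (h.lip_x (z + k) z w)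
        rw [add_sub_cancel_left] at h1
        have h2 : LM ≤ LM / Tmin * T z w := by
          rw [div_mul_eq_mul_div, le_div_iff₀ hTm]
          exact mul_le_mul_of_nonneg_left (h.lower z w) hLM.le
        nlinarith [h1.2, mul_le_mul_of_nonneg_left h2 (norm_nonneg k)]
      have hg := mul_le_mul_of_nonneg_left (hgain s hsS z w) (norm_nonneg k)
      have hfin : density (hopfCole ε φ) s z * T (z + k) w
          ≤ ‖k‖ * (κ' s * hopfCole ε φ s z w) + density (hopfCole ε φ) s z * T z w := by
        nlinarith [mul_le_mul_of_nonneg_left hTk hρ]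
      calc _ = Real.exp (κ s * ‖k‖ / ε) * Real.exp (s / ε) / ε
            * (density (hopfCole ε φ) s z * T (z + k) w) := by ring
        _ ≤ Real.exp (κ s * ‖k‖ / ε) * Real.exp (s / ε) / ε
            * (‖k‖ * (κ' s * hopfCole ε φ s z w) + density (hopfCole ε φ) s z * T z w) :=
            mul_le_mul_of_nonneg_left hfin (by positivity)
        _ = _ := by ring
    · simp
    · refine le_of_eq ?_
      ring

end Setup


/-! ### Lipschitz estimates in space and velocity, uniform in `ε` -/

namespace Setup

variable {ε Tmin LM : ℝ} {K₀ : ℝ≥0} {C₀ : ℝ} {T : Space d → Vel d U → ℝ}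
  {φ : ℝ → Space d → Vel d U → ℝ}

/-- A first Lipschitz estimate, whose constant depends on `ε`. -/
theorem exists_space_lip (h : Setup ε Tmin LM K₀ C₀ T φ) {S : ℝ} (hS : 0 ≤ S) :
    ∃ A, 0 ≤ A ∧ ∀ t ∈ Icc 0 S, ∀ x y w, |φ t x w - φ t y w| ≤ A * ‖x - y‖ := by
  have hε := h.eps_pos
  have hLM := h.LM_pos
  have hTm := h.min_pos
  set C := timeLip d U LM K₀ C₀ with hC
  have hC0 : 0 ≤ C := h.timeLip_nonneg
  set E := Real.exp (C * S / ε) with hE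
  set B := LM / Tmin * (E * (gainConst d U LM C₀ * E)) with hB
  have hg0 := h.gainConst_nonneg
  have hB0 : 0 ≤ B := by positivity
  have hin := fun (s : ℝ) (hs : s ∈ Icc 0 S) x w => abs_le.1 (h.abs_phase_sub_init_le hs.1 x w)
  -- The gain at time `s` is compared with the gain at time zero in both directions, each costing a
  -- factor `E`. The huge `B` is harmless: the bound only starts the iteration below.
  have key := h.abs_phase_sub_space_le_of_gain_le hS (κ := fun s => K₀ + B * s) (κ' := fun _ => B)
    (Kmax := K₀ + B * S)
    (fun s _ => by simpa using ((hasDerivAt_id s).const_mul B).const_add (K₀ : ℝ))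
    (fun s hs => ⟨by have := hs.1; positivity, by have := hs.2; gcongr⟩) (by simp)
    (fun s hs x w => by
      have hCs : C * s ≤ C * S := mul_le_mul_of_nonneg_left hs.2 hC0
      have h1 : density (hopfCole ε φ) s x ≤ E * density (hopfCole ε φ) 0 x := by
        unfold density
        rw [← integral_const_mul]
        refine integral_mono (h.sol.integrable_section hs.1 x)
          ((h.sol.integrable_section le_rfl x).const_mul _) fun w' => ?_
        change hopfCole ε φ s x w' ≤ E * hopfCole ε φ 0 x w'
        rw [hE, hopfCole_le_exp_mul_iff hε]
        linarith [(hin s hs x w').1]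
      have h2 : hopfCole ε φ 0 x w ≤ E * hopfCole ε φ s x w := by
        rw [hE, hopfCole_le_exp_mul_iff hε]
        linarith [(hin s hs x w).2]
      have h3 := h.init_gain_le x w
      have h4 := (h.T_pos x w).le
      have hE0 : 0 ≤ E := (Real.exp_pos _).le
      have ha : 0 ≤ LM / Tmin := by positivity
      calc LM / Tmin * (density (hopfCole ε φ) s x * T x w)
          ≤ LM / Tmin * ((E * density (hopfCole ε φ) 0 x) * T x w) := by gcongr
        _ = LM / Tmin * (E * (density (hopfCole ε φ) 0 x * T x w)) := by ring
        _ ≤ LM / Tmin * (E * (gainConst d U LM C₀ * (E * hopfCole ε φ s x w))) := by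
            exact mul_le_mul_of_nonneg_left (mul_le_mul_of_nonneg_left
              (h3.trans (mul_le_mul_of_nonneg_left h2 hg0)) hE0) ha
        _ = B * hopfCole ε φ s x w := by rw [hB]; ring)
  refine ⟨K₀ + B * S, by positivity, fun t ht x y w => (key t ht x y w).trans ?_⟩
  have := ht.2
  gcongr

/-- Inserting a Lipschitz bound into `gain_le` and integrating in time gives a new one. The rate `2
a U` in the exponential weight is twice the rate of the feedback, so the contribution of `A` is
halved. -/
theorem abs_phase_sub_space_le_improve (h : Setup ε Tmin LM K₀ C₀ T φ) {S A : ℝ} (hS : 0 ≤ S)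
    (hA : 0 ≤ A)
    (hlip : ∀ t ∈ Icc 0 S, ∀ x y w,
      |φ t x w - φ t y w| ≤ A * Real.exp (2 * (LM / Tmin) * U * t) * ‖x - y‖) :
    ∀ t ∈ Icc 0 S, ∀ x y w, |φ t x w - φ t y w|
      ≤ (K₀ + LM / Tmin * (1 + timeLip d U LM K₀ C₀) * t
        + A / 2 * (Real.exp (2 * (LM / Tmin) * U * t) - 1)) * ‖x - y‖ := by
  have hε := h.eps_pos
  have hLM := h.LM_pos
  have hTm := h.min_pos
  have hU := h.speed_pos
  set C := timeLip d U LM K₀ C₀ with hC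
  have hC0 : 0 ≤ C := h.timeLip_nonneg
  set a := LM / Tmin with ha
  have ha0 : 0 < a := by positivity
  have hexp : ∀ s ∈ Icc 0 S, 1 ≤ Real.exp (2 * a * U * s) ∧
      Real.exp (2 * a * U * s) ≤ Real.exp (2 * a * U * S) := fun s hs =>
    ⟨Real.one_le_exp (by have := hs.1; positivity), by have := hs.2; gcongr⟩
  refine h.abs_phase_sub_space_le_of_gain_le hS
    (κ := fun t => K₀ + a * (1 + C) * t + A / 2 * (Real.exp (2 * a * U * t) - 1))
    (κ' := fun t => a * (1 + C + U * (A * Real.exp (2 * a * U * t))))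
    (Kmax := K₀ + a * (1 + C) * S + A / 2 * (Real.exp (2 * a * U * S) - 1)) ?_ ?_ ?_ ?_
  · intro s _
    have h1 : HasDerivAt (fun t : ℝ => 2 * a * U * t) (2 * a * U) s := by
      simpa using (hasDerivAt_id s).const_mul (2 * a * U)
    have h2 : HasDerivAt (fun t : ℝ => (K₀ : ℝ) + a * (1 + C) * t) (a * (1 + C)) s := by
      simpa using ((hasDerivAt_id s).const_mul (a * (1 + C))).const_add (K₀ : ℝ)
    refine (h2.add ((h1.exp.sub_const 1).const_mul (A / 2))).congr_deriv ?_
    ring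
  · intro s hs
    have h1 := hexp s hs
    have h2 := hs.1
    have h3 := hs.2
    constructor
    · have : 0 ≤ Real.exp (2 * a * U * s) - 1 := by linarith
      positivity
    · gcongr
  · simp
  · intro s hs x w
    have := h.gain_le hs.1 (K := A * Real.exp (2 * a * U * s)) (by positivity) (hlip s hs) x w
    rw [mul_assoc]
    exact mul_le_mul_of_nonneg_left this ha0.le

/-- Iterating the halving removes the `ε`-dependent starting constant. One last improvement gives a
bound equal to `K₀` at time zero, which is needed for a positive horizon when `K₀ < P`. -/
theorem abs_phase_sub_space_le (h : Setup ε Tmin LM K₀ C₀ T φ) {t : ℝ} (ht : 0 ≤ t) (x y : Space d)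
    (w : Vel d U) : |φ t x w - φ t y w| ≤ spaceLip d U Tmin LM K₀ C₀ t * ‖x - y‖ := by
  have hε := h.eps_pos
  have hLM := h.LM_pos
  have hTm := h.min_pos
  have hU := h.speed_pos
  set C := timeLip d U LM K₀ C₀ with hC
  have hC0 : 0 ≤ C := h.timeLip_nonneg
  set a := LM / Tmin with ha
  have ha0 : 0 < a := by positivity
  -- In the weighted norm the improvement is dominated by `A ↦ A₁ + A / 2`, whose fixed point is `2
  -- * A₁`. The linear term is absorbed by `2 a U s ≤ exp (2 a U s)`.
  set A₁ := K₀ + (1 + C) / (2 * U) with hA₁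
  have hA₁0 : 0 ≤ A₁ := by positivity
  obtain ⟨A, hA, hlip⟩ := h.exists_space_lip ht
  have iter : ∀ n : ℕ, ∀ s ∈ Icc 0 t, ∀ x y w, |φ s x w - φ s y w|
      ≤ (2 * A₁ + A / 2 ^ n) * Real.exp (2 * a * U * s) * ‖x - y‖ := by
    intro n
    induction n with
    | zero =>
      intro s hs x y w
      refine (hlip s hs x y w).trans ?_
      have : 1 ≤ Real.exp (2 * a * U * s) := Real.one_le_exp (by have := hs.1; positivity)
      gcongr
      rw [pow_zero, div_one]
      nlinarith
    | succ n ih =>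
      intro s hs x y w
      have hpos : 0 ≤ A / 2 ^ n := by positivity
      refine (h.abs_phase_sub_space_le_improve ht (by positivity) ih s hs x y w).trans ?_
      gcongr
      set e := Real.exp (2 * a * U * s) with he
      have h1 : 2 * a * U * s ≤ e := by linarith [Real.add_one_le_exp (2 * a * U * s)]
      have h2 : 1 ≤ e := Real.one_le_exp (by have := hs.1; positivity)
      have h3 : a * (1 + C) * s ≤ (1 + C) / (2 * U) * e := by
        calc a * (1 + C) * s = (1 + C) / (2 * U) * (2 * a * U * s) := by field_simp
          _ ≤ _ := mul_le_mul_of_nonneg_left h1 (by positivity)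
      have h4 : (K₀ : ℝ) ≤ K₀ * e := le_mul_of_one_le_right K₀.2 h2
      have h5 : A / 2 ^ (n + 1) = A / 2 ^ n / 2 := by rw [pow_succ]; field_simp
      rw [h5]
      have h6 : K₀ * e + (1 + C) / (2 * U) * e = A₁ * e := by rw [hA₁]; ring
      nlinarith
  have hlim : ∀ s ∈ Icc 0 t, ∀ x y w, |φ s x w - φ s y w|
      ≤ 2 * A₁ * Real.exp (2 * a * U * s) * ‖x - y‖ := by
    intro s hs x y w
    have h1 : Tendsto (fun n : ℕ => A / 2 ^ n) atTop (𝓝 0) :=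
      tendsto_const_nhds.div_atTop (tendsto_pow_atTop_atTop_of_one_lt one_lt_two)
    have h2 := ((h1.const_add (2 * A₁)).mul_const (Real.exp (2 * a * U * s))).mul_const ‖x - y‖
    rw [add_zero] at h2
    exact ge_of_tendsto' h2 fun n => iter n s hs x y w
  refine (h.abs_phase_sub_space_le_improve ht (by positivity) hlim t (right_mem_Icc.2 ht)
    x y w).trans (le_of_eq ?_)
  unfold spaceLip
  ring

theorem spaceLip_mono (h : Setup ε Tmin LM K₀ C₀ T φ) {s t : ℝ} (hst : s ≤ t) :
    spaceLip d U Tmin LM K₀ C₀ s ≤ spaceLip d U Tmin LM K₀ C₀ t := by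
  have hLM := h.LM_pos
  have hTm := h.min_pos
  have hU := h.speed_pos
  have hC0 := h.timeLip_nonneg
  unfold spaceLip
  gcongr

theorem le_spaceLip (h : Setup ε Tmin LM K₀ C₀ T φ) {t : ℝ} (ht : 0 ≤ t) :
    K₀ ≤ spaceLip d U Tmin LM K₀ C₀ t := by
  have := h.spaceLip_mono ht
  simpa [spaceLip] using this

theorem abs_phase_sub_le (h : Setup ε Tmin LM K₀ C₀ T φ) {t : ℝ} {r s : ℝ} (hr : r ∈ Icc 0 t)
    (hs : s ∈ Icc 0 t) (x y : Space d) (w : Vel d U) :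
    |φ r x w - φ s y w| ≤
      (timeLip d U LM K₀ C₀ + spaceLip d U Tmin LM K₀ C₀ t) * (|r - s| + ‖x - y‖) := by
  have h1 := h.abs_phase_sub_time_le hr.1 hs.1 x w
  have h2 := (h.abs_phase_sub_space_le hs.1 x y w).trans
    (mul_le_mul_of_nonneg_right (h.spaceLip_mono hs.2) (norm_nonneg _))
  have h3 : |φ r x w - φ s y w| ≤ |φ r x w - φ s x w| + |φ s x w - φ s y w| :=
    abs_sub_le _ _ _
  have h4 : 0 ≤ spaceLip d U Tmin LM K₀ C₀ t := K₀.2.trans (h.le_spaceLip (hr.1.trans hr.2))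
  have := mul_nonneg h.timeLip_nonneg (norm_nonneg (x - y))
  have := mul_nonneg h4 (abs_nonneg (r - s))
  linarith

/-- Propagation of the modulus of continuity in the velocity variable. -/
theorem abs_phase_sub_vel_le (h : Setup ε Tmin LM K₀ C₀ T φ) {L q : ℝ}
    (h0 : ∀ x w w', |φ 0 x w - φ 0 x w'| ≤ L * dist w w' + q) {t : ℝ} (ht : 0 ≤ t) (x : Space d)
    (w w' : Vel d U) :
    |φ t x w - φ t x w'| ≤ (L + (1 + U) * t * spaceLip d U Tmin LM K₀ C₀ t
      + ε * (LM / Tmin * (1 + (1 + U) * t))) * dist w w' + q := by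
  have hε := h.eps_pos
  have hLM := h.LM_pos
  have hTm := h.min_pos
  have hU := h.speed_pos
  set K := spaceLip d U Tmin LM K₀ C₀ t with hK
  have hK0 : 0 ≤ K := K₀.2.trans (h.le_spaceLip ht)
  suffices H : ∀ w w', φ t x w - φ t x w' ≤ (L + (1 + U) * t * K
      + ε * (LM / Tmin * (1 + (1 + U) * t))) * dist w w' + q by
    have h1 := H w w'
    have h2 := H w' w
    rw [dist_comm w' w] at h2
    rw [abs_le]
    constructor <;> linarith
  intro w w'
  set δ := dist w w' with hδ
  have hδ0 : 0 ≤ δ := dist_nonneg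
  set A := (L + (1 + U) * t * K + ε * (LM / Tmin * (1 + (1 + U) * t))) * δ + q with hA
  rw [← hopfCole_le_exp_mul_iff hε]
  set y := x - t • vec w with hy
  set y' := x - t • vec w' with hy'
  have hdist : ∀ s ∈ Icc 0 t, ‖y + s • vec w - (y' + s • vec w')‖ ≤ (1 + U) * t * δ := by
    intro s hs
    have e : y + s • vec w - (y' + s • vec w') = (s - t) • (vec w - vec w') := by
      rw [hy, hy']; simp only [sub_smul, smul_sub]; abel
    rw [e, norm_smul, Real.norm_eq_abs, abs_sub_comm, abs_of_nonneg (by linarith [hs.2])]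
    calc (t - s) * ‖vec w - vec w'‖ ≤ t * ((1 + U) * δ) :=
          mul_le_mul (by linarith [hs.1]) (norm_vec_sub_le w w') (norm_nonneg _) ht
      _ = _ := by ring
  have hd := h.sol.exp_mul_sub_le hε y' w' ht
    (G := fun s => Real.exp (A / ε) * (Real.exp (s / ε) * hopfCole ε φ s (y + s • vec w) w))
    (fun s hs => (h.sol.hasDerivWithinAt_exp_char hε y w hs.1).const_mul _) (fun s hs => by
      set z := y + s • vec w with hz
      set z' := y' + s • vec w' with hz'
      have hzz : ‖z - z'‖ ≤ (1 + U) * t * δ := hdist s hs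
      have h1 : density (hopfCole ε φ) s z'
          ≤ Real.exp (K * ((1 + U) * t * δ) / ε) * density (hopfCole ε φ) s z := by
        unfold density
        rw [← integral_const_mul]
        refine integral_mono (h.sol.integrable_section hs.1 _)
          ((h.sol.integrable_section hs.1 _).const_mul _) fun v => ?_
        change hopfCole ε φ s z' v ≤ _ * hopfCole ε φ s z v
        rw [hopfCole_le_exp_mul_iff hε]
        refine (le_abs_self _).trans ((h.abs_phase_sub_space_le hs.1 z z' v).trans ?_)
        exact mul_le_mul (h.spaceLip_mono hs.2) hzz (norm_nonneg _) hK0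
      -- The kernel changes by a factor without `1/ε` in the exponent, hence the prefactor `ε` of
      -- this contribution to the phase.
      have h2 : T z' w' ≤ Real.exp (LM / Tmin * (1 + (1 + U) * t) * δ) * T z w := by
        have t1 := abs_le.1 (h.lip_x z' z w')
        have t2 := abs_le.1 (h.lip_v z w' w)
        rw [norm_sub_rev] at t1
        rw [dist_comm] at t2
        have t3 : LM ≤ LM / Tmin * T z w := by
          rw [div_mul_eq_mul_div, le_div_iff₀ hTm]
          exact mul_le_mul_of_nonneg_left (h.lower z w) hLM.le
        have t4 : LM * ‖z - z'‖ ≤ LM * ((1 + U) * t * δ) := mul_le_mul_of_nonneg_left hzz hLM.le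
        have t5 : T z' w' ≤ T z w + LM * ((1 + (1 + U) * t) * δ) := by
          linarith [t1.2, t2.2]
        have t6 := mul_le_mul_of_nonneg_right t3 (show 0 ≤ (1 + (1 + U) * t) * δ by positivity)
        have t7 := mul_le_mul_of_nonneg_right
          (Real.add_one_le_exp (LM / Tmin * (1 + (1 + U) * t) * δ)) (h.T_pos z w).le
        linarith
      have hAe : Real.exp (K * ((1 + U) * t * δ) / ε)
          * Real.exp (LM / Tmin * (1 + (1 + U) * t) * δ) ≤ Real.exp (A / ε) := by
        rw [← Real.exp_add]
        refine Real.exp_le_exp.2 ?_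
        rw [le_div_iff₀ hε, add_mul, div_mul_cancel₀ _ hε.ne', hA]
        have hq : 0 ≤ L * δ + q := (abs_nonneg _).trans (h0 x w w')
        linarith
      have hρ := density_hopfCole_nonneg ε φ s z
      have hmul : density (hopfCole ε φ) s z' * T z' w'
          ≤ Real.exp (A / ε) * (density (hopfCole ε φ) s z * T z w) := by
        calc density (hopfCole ε φ) s z' * T z' w'
            ≤ (Real.exp (K * ((1 + U) * t * δ) / ε) * density (hopfCole ε φ) s z)
              * (Real.exp (LM / Tmin * (1 + (1 + U) * t) * δ) * T z w) :=
              mul_le_mul h1 h2 (h.T_pos _ _).le (by positivity)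
          _ = (Real.exp (K * ((1 + U) * t * δ) / ε)
              * Real.exp (LM / Tmin * (1 + (1 + U) * t) * δ))
              * (density (hopfCole ε φ) s z * T z w) := by ring
          _ ≤ _ := mul_le_mul_of_nonneg_right hAe (mul_nonneg hρ (h.T_pos _ _).le)
      calc _ = Real.exp (s / ε) / ε * (density (hopfCole ε φ) s z' * T z' w') := by ring
        _ ≤ Real.exp (s / ε) / ε * (Real.exp (A / ε) * (density (hopfCole ε φ) s z * T z w)) :=
            mul_le_mul_of_nonneg_left hmul (by positivity)
        _ = _ := by ring)
  have hinit : hopfCole ε φ 0 y' w' ≤ Real.exp (A / ε) * hopfCole ε φ 0 y w := by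
    rw [hopfCole_le_exp_mul_iff hε]
    have h1 := (abs_le.1 (h0 y w w')).2
    have h2 := h.init_sub_le y y' w'
    have h3 : ‖y - y'‖ ≤ (1 + U) * t * δ := by simpa using hdist 0 ⟨le_rfl, ht⟩
    have h4 : (K₀ : ℝ) * ‖y - y'‖ ≤ K * ((1 + U) * t * δ) :=
      mul_le_mul (h.le_spaceLip ht) h3 (norm_nonneg _) hK0
    have h5 : 0 ≤ ε * (LM / Tmin * (1 + (1 + U) * t)) * δ := by positivity
    rw [hA]
    linarith
  simp only [hy, hy', sub_add_cancel, zero_div, Real.exp_zero, one_mul, zero_smul, add_zero] at hd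
  rw [← hy, ← hy'] at hd
  have hE : 0 < Real.exp (t / ε) := Real.exp_pos _
  refine le_of_mul_le_mul_left (a := Real.exp (t / ε)) ?_ hE
  linarith

end Setup


/-! ### The effective Hamiltonian -/

/-- A positive, bounded, Lipschitz turning kernel. -/
structure IsTurningKernel (Tmin LM : ℝ) (T : Space d → Vel d U → ℝ) : Prop where
  dim_pos : 0 < d
  speed_pos : 0 < U
  min_pos : 0 < Tmin
  prob : ∀ x, ∫ w, T x w ∂(velMeasure d U) = 1
  lower : ∀ x w, Tmin ≤ T x w
  upper : ∀ x w, T x w ≤ LM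
  lip_x : ∀ x y w, |T x w - T y w| ≤ LM * ‖x - y‖
  lip_v : ∀ x w w', |T x w - T x w'| ≤ LM * dist w w'

theorem integrable_of_continuous {g : Vel d U → ℝ} (hg : Continuous g) :
    Integrable g (velMeasure d U) := by
  obtain ⟨C, hC⟩ := isCompact_univ.exists_bound_of_continuousOn hg.continuousOn
  exact Integrable.of_bound hg.aestronglyMeasurable C (Eventually.of_forall fun w => hC w (mem_univ w))

theorem integral_pos_of_pos (hd : 0 < d) (hU : 0 < U) {g : Vel d U → ℝ} (hg : Continuous g)
    (hpos : ∀ w, 0 < g w) : 0 < ∫ w, g w ∂(velMeasure d U) := by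
  have := isOpenPosMeasure_velMeasure (d := d) hU
  have := nonempty_vel hd hU
  rw [integral_pos_iff_support_of_nonneg (fun w => (hpos w).le) (integrable_of_continuous hg)]
  have : Function.support g = univ := eq_univ_of_forall fun w => (hpos w).ne'
  rw [this]
  exact isOpen_univ.measure_pos _ univ_nonempty

theorem continuous_denom (h : ℝ) (p : Space d) :
    Continuous fun w : Vel d U => 1 + h - inner ℝ (vec w) p :=
  continuous_const.sub (continuous_vec.inner continuous_const)

theorem abs_inner_vec_le (w : Vel d U) (p : Space d) : |inner ℝ (vec w) p| ≤ U * ‖p‖ :=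
  (abs_real_inner_le_norm _ _).trans (mul_le_mul_of_nonneg_right (norm_vec_le w) (norm_nonneg _))

theorem inner_vec_le_lowerH (w : Vel d U) (p : Space d) : inner ℝ (vec w) p ≤ 1 + lowerH U p := by
  have : BddAbove (range fun w : Vel d U => inner ℝ (vec w) p) :=
    ⟨U * ‖p‖, by rintro _ ⟨w, rfl⟩; exact (le_abs_self _).trans (abs_inner_vec_le w p)⟩
  unfold lowerH
  linarith [le_ciSup this w]

/-- The set of which the Hamiltonian is the infimum. -/
def upperSet (T : Space d → Vel d U → ℝ) (x p : Space d) : Set ℝ :=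
  {h : ℝ | (∀ w : Vel d U, 0 < 1 + h - inner ℝ (vec w) p) ∧
    ∫ w, T x w / (1 + h - inner ℝ (vec w) p) ∂(velMeasure d U) ≤ 1}

theorem hamiltonian_eq (T : Space d → Vel d U → ℝ) (x p : Space d) :
    hamiltonian T x p = sInf (upperSet T x p) := rfl

/-- Speed zero belongs to `𝒱`, and there the denominator is `1 + h`. -/
theorem neg_one_lt_of_denom_pos (hd : 0 < d) (hU : 0 < U) {h : ℝ} {p : Space d}
    (H : ∀ w : Vel d U, 0 < 1 + h - inner ℝ (vec w) p) : -1 < h := by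
  obtain ⟨w⟩ := nonempty_vel hd hU
  have := H ⟨⟨0, left_mem_Icc.2 hU.le⟩, w.2⟩
  simp only [vec, zero_smul, inner_zero_left] at this
  linarith

theorem inv_add_le {a b A B : ℝ} (ha : 0 ≤ a) (hb : 0 ≤ b) (hab : a + b = 1) (hA : 0 < A)
    (hB : 0 < B) : (a * A + b * B)⁻¹ ≤ a * A⁻¹ + b * B⁻¹ := by
  have hpos : 0 < a * A + b * B := by
    rcases ha.eq_or_lt with rfl | ha
    · simp at hab; subst hab; simpa using hB
    · positivity
  rw [inv_le_iff_one_le_mul₀' hpos]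
  have e : (a * A + b * B) * (a * A⁻¹ + b * B⁻¹) = 1 + a * b * ((A - B) ^ 2 / (A * B)) := by
    have : b = 1 - a := by linarith
    subst this
    field_simp
    ring
  rw [e]
  have : 0 ≤ a * b * ((A - B) ^ 2 / (A * B)) := by positivity
  linarith

namespace IsTurningKernel

variable {Tmin LM : ℝ} {T : Space d → Vel d U → ℝ}

theorem pos (hT : IsTurningKernel Tmin LM T) (x : Space d) (w : Vel d U) : 0 < T x w :=
  hT.min_pos.trans_le (hT.lower x w)

theorem LM_pos (hT : IsTurningKernel Tmin LM T) : 0 < LM := by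
  obtain ⟨w⟩ := nonempty_vel hT.dim_pos hT.speed_pos
  exact (hT.pos 0 w).trans_le (hT.upper 0 w)

theorem continuous_section (hT : IsTurningKernel Tmin LM T) (x : Space d) : Continuous (T x) :=
  (LipschitzWith.of_dist_le_mul (K := ⟨LM, hT.LM_pos.le⟩) fun w w' => by
    rw [Real.dist_eq]; exact hT.lip_v x w w').continuous

theorem continuous_integrand (hT : IsTurningKernel Tmin LM T) (x : Space d) {h : ℝ} {p : Space d}
    (H : ∀ w : Vel d U, 0 < 1 + h - inner ℝ (vec w) p) :
    Continuous fun w => T x w / (1 + h - inner ℝ (vec w) p) :=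
  (hT.continuous_section x).div (continuous_denom h p) fun w => (H w).ne'

/-- Reduces the estimates of the Hamiltonian in `p` and `x` to pointwise comparisons of integrands.
-/
theorem mem_upperSet_of_le (hT : IsTurningKernel Tmin LM T) {x y p q : Space d} {h k : ℝ}
    (hh : h ∈ upperSet T x p) (hk : ∀ w : Vel d U, 0 < 1 + k - inner ℝ (vec w) q)
    (hle : ∀ w : Vel d U, T y w / (1 + k - inner ℝ (vec w) q)
      ≤ T x w / (1 + h - inner ℝ (vec w) p)) : k ∈ upperSet T y q :=
  ⟨hk, (integral_mono (integrable_of_continuous (hT.continuous_integrand y hk))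
    (integrable_of_continuous (hT.continuous_integrand x hh.1)) hle).trans hh.2⟩

theorem mem_upperSet (hT : IsTurningKernel Tmin LM T) (x p : Space d) :
    U * ‖p‖ ∈ upperSet T x p := by
  have hden : ∀ w : Vel d U, 1 ≤ 1 + U * ‖p‖ - inner ℝ (vec w) p := fun w => by
    linarith [(abs_le.1 (abs_inner_vec_le w p)).2]
  have hpos : ∀ w : Vel d U, 0 < 1 + U * ‖p‖ - inner ℝ (vec w) p := fun w => by
    linarith [hden w]
  refine ⟨hpos, ?_⟩
  exact (integral_mono (integrable_of_continuous (hT.continuous_integrand x hpos))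
    (integrable_of_continuous (hT.continuous_section x))
    fun w => div_le_self (hT.pos x w).le (hden w)).trans_eq (hT.prob x)

theorem bddBelow_upperSet (hT : IsTurningKernel Tmin LM T) (x p : Space d) :
    BddBelow (upperSet T x p) :=
  ⟨-1, fun _ hh => (neg_one_lt_of_denom_pos hT.dim_pos hT.speed_pos hh.1).le⟩

theorem hamiltonian_le (hT : IsTurningKernel Tmin LM T) {x p : Space d} {h : ℝ}
    (hh : h ∈ upperSet T x p) : hamiltonian T x p ≤ h :=
  csInf_le (hT.bddBelow_upperSet x p) hh

theorem exists_mem_lt (hT : IsTurningKernel Tmin LM T) (x p : Space d) {δ : ℝ} (hδ : 0 < δ) :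
    ∃ h ∈ upperSet T x p, h < hamiltonian T x p + δ :=
  exists_lt_of_csInf_lt ⟨_, hT.mem_upperSet x p⟩ (by rw [hamiltonian_eq]; linarith)

/-- The denominators are affine in `(h,p)` and inversion is convex on positive numbers, so the pairs
`(h,p)` admissible at `x` form a convex set. The Hamiltonian is its lower boundary; near-minimizers
avoid the question whether the infimum is attained. -/
theorem convexOn_hamiltonian (hT : IsTurningKernel Tmin LM T) (x : Space d) :
    ConvexOn ℝ univ (hamiltonian T x) := by
  refine ⟨convex_univ, fun p _ q _ a b ha hb hab => le_of_forall_pos_le_add fun δ hδ => ?_⟩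
  obtain ⟨h, hh, hhl⟩ := hT.exists_mem_lt x p hδ
  obtain ⟨k, hk, hkl⟩ := hT.exists_mem_lt x q hδ
  have e : ∀ w : Vel d U, 1 + (a * h + b * k) - inner ℝ (vec w) (a • p + b • q)
      = a * (1 + h - inner ℝ (vec w) p) + b * (1 + k - inner ℝ (vec w) q) := fun w => by
    rw [inner_add_right, inner_smul_right, inner_smul_right]
    linear_combination - hab
  have hpos : ∀ w : Vel d U, 0 < 1 + (a * h + b * k) - inner ℝ (vec w) (a • p + b • q) := fun w => by
    rw [e]
    rcases ha.eq_or_lt with rfl | ha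
    · rw [zero_add] at hab; subst hab; simpa using hk.1 w
    · have := hh.1 w
      have := hk.1 w
      positivity
  have hmem : a * h + b * k ∈ upperSet T x (a • p + b • q) := by
    refine ⟨hpos, ?_⟩
    have i1 := integrable_of_continuous (hT.continuous_integrand x hh.1)
    have i2 := integrable_of_continuous (hT.continuous_integrand x hk.1)
    calc _ ≤ ∫ w, (a * (T x w / (1 + h - inner ℝ (vec w) p))
          + b * (T x w / (1 + k - inner ℝ (vec w) q))) ∂(velMeasure d U) := by
          refine integral_mono (integrable_of_continuous (hT.continuous_integrand x hpos))
            ((i1.const_mul a).add (i2.const_mul b)) fun w => ?_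
          have := mul_le_mul_of_nonneg_left (inv_add_le ha hb hab (hh.1 w) (hk.1 w)) (hT.pos x w).le
          simp only [e, div_eq_mul_inv]
          refine this.trans_eq ?_
          ring
      _ = a * _ + b * _ := by
          rw [integral_add (i1.const_mul a) (i2.const_mul b), integral_const_mul,
            integral_const_mul]
      _ ≤ a * 1 + b * 1 := by
          gcongr
          · exact hh.2
          · exact hk.2
      _ = 1 := by rw [mul_one, mul_one, hab]
  refine (hT.hamiltonian_le hmem).trans ?_
  simp only [smul_eq_mul]
  calc a * h + b * k ≤ a * (hamiltonian T x p + δ) + b * (hamiltonian T x q + δ) := by gcongr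
    _ = a * hamiltonian T x p + b * hamiltonian T x q + (a + b) * δ := by ring
    _ = _ := by rw [hab, one_mul]

/-- Raising `h` by `U ‖p - q‖` makes up for the change of every denominator. No nondegeneracy is
needed, so the bound holds for all slopes. -/
theorem hamiltonian_sub_le (hT : IsTurningKernel Tmin LM T) (x p q : Space d) :
    hamiltonian T x q - hamiltonian T x p ≤ U * ‖p - q‖ := by
  rw [sub_le_iff_le_add]
  refine le_of_forall_pos_le_add fun δ hδ => ?_
  obtain ⟨h, hh, hhl⟩ := hT.exists_mem_lt x p hδ
  have hle : ∀ w : Vel d U, 1 + h - inner ℝ (vec w) p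
      ≤ 1 + (h + U * ‖p - q‖) - inner ℝ (vec w) q := fun w => by
    have := (abs_le.1 (abs_inner_vec_le w (p - q))).1
    rw [inner_sub_right] at this
    linarith
  have hpos : ∀ w : Vel d U, 0 < 1 + (h + U * ‖p - q‖) - inner ℝ (vec w) q := fun w =>
    (hh.1 w).trans_le (hle w)
  have := hT.hamiltonian_le (hT.mem_upperSet_of_le hh hpos fun w =>
    div_le_div_of_nonneg_left (hT.pos x w).le (hh.1 w) (hle w))
  linarith

theorem hamiltonian_le_mul_norm (hT : IsTurningKernel Tmin LM T) (x p : Space d) :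
    hamiltonian T x p ≤ U * ‖p‖ := hT.hamiltonian_le (hT.mem_upperSet x p)

theorem T_le_mul (hT : IsTurningKernel Tmin LM T) (x y : Space d) (w : Vel d U) :
    T y w ≤ (1 + LM / Tmin * ‖x - y‖) * T x w := by
  have h1 := (abs_le.1 (hT.lip_x y x w)).2
  have h2 : LM ≤ LM / Tmin * T x w := by
    rw [div_mul_eq_mul_div, le_div_iff₀ hT.min_pos]
    exact mul_le_mul_of_nonneg_left (hT.lower x w) hT.LM_pos.le
  rw [norm_sub_rev] at h1
  nlinarith [mul_le_mul_of_nonneg_right h2 (norm_nonneg (x - y))]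

theorem hamiltonian_sub_le_space (hT : IsTurningKernel Tmin LM T) (x y p : Space d) :
    hamiltonian T y p - hamiltonian T x p ≤ LM / Tmin * ‖x - y‖ * (1 + 2 * U * ‖p‖) := by
  have hLM := hT.LM_pos
  have hTm := hT.min_pos
  set c := LM / Tmin * ‖x - y‖ with hc
  have hc0 : 0 ≤ c := by positivity
  have key : ∀ δ > 0, hamiltonian T y p ≤ (hamiltonian T x p + δ)
      + c * (1 + (hamiltonian T x p + δ) + U * ‖p‖) := by
    intro δ hδ
    obtain ⟨h, hh, hhl⟩ := hT.exists_mem_lt x p hδ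
    -- Moving from `x` to `y` enlarges the kernel by at most the factor `1 + c`; this shift of `h`
    -- enlarges each denominator by at least the same factor.
    have hle : ∀ w : Vel d U, (1 + c) * (1 + h - inner ℝ (vec w) p)
        ≤ 1 + (h + c * (1 + h + U * ‖p‖)) - inner ℝ (vec w) p := fun w => by
      have := (abs_le.1 (abs_inner_vec_le w p)).1
      nlinarith [mul_le_mul_of_nonneg_left this hc0]
    have hpos1 : ∀ w : Vel d U, 0 < (1 + c) * (1 + h - inner ℝ (vec w) p) := fun w => by
      have := hh.1 w
      positivity
    have hpos : ∀ w : Vel d U, 0 < 1 + (h + c * (1 + h + U * ‖p‖)) - inner ℝ (vec w) p :=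
      fun w => (hpos1 w).trans_le (hle w)
    have := hT.hamiltonian_le (hT.mem_upperSet_of_le (y := y) hh hpos fun w => by
      have h1 := hh.1 w
      calc T y w / (1 + (h + c * (1 + h + U * ‖p‖)) - inner ℝ (vec w) p)
          ≤ ((1 + c) * T x w) / ((1 + c) * (1 + h - inner ℝ (vec w) p)) :=
            div_le_div₀ (mul_nonneg (by linarith) (hT.pos x w).le) (hT.T_le_mul x y w) (hpos1 w)
              (hle w)
        _ = _ := mul_div_mul_left _ _ (by positivity))
    nlinarith [mul_le_mul_of_nonneg_left hhl.le hc0]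
  have hlim : Tendsto (fun δ : ℝ => (hamiltonian T x p + δ)
      + c * (1 + (hamiltonian T x p + δ) + U * ‖p‖)) (𝓝[>] 0)
      (𝓝 ((hamiltonian T x p + 0) + c * (1 + (hamiltonian T x p + 0) + U * ‖p‖))) :=
    (Continuous.tendsto (by fun_prop) 0).mono_left nhdsWithin_le_nhds
  have h1 := ge_of_tendsto hlim (eventually_mem_nhdsWithin.mono fun δ hδ => key δ hδ)
  have h2 := hT.hamiltonian_le_mul_norm x p
  nlinarith [mul_le_mul_of_nonneg_left h2 hc0]

theorem integral_strictAnti (hT : IsTurningKernel Tmin LM T) (x : Space d) {p : Space d} {h k : ℝ}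
    (hh : ∀ w : Vel d U, 0 < 1 + h - inner ℝ (vec w) p) (hk : h < k) :
    ∫ w, T x w / (1 + k - inner ℝ (vec w) p) ∂(velMeasure d U)
      < ∫ w, T x w / (1 + h - inner ℝ (vec w) p) ∂(velMeasure d U) := by
  have hk' : ∀ w : Vel d U, 0 < 1 + k - inner ℝ (vec w) p := fun w => by linarith [hh w]
  have c1 := hT.continuous_integrand x hh
  have c2 := hT.continuous_integrand x hk'
  rw [← sub_pos, ← integral_sub (integrable_of_continuous c1) (integrable_of_continuous c2)]
  refine integral_pos_of_pos hT.dim_pos hT.speed_pos (c1.sub c2) fun w => ?_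
  rw [sub_pos]
  exact div_lt_div_of_pos_left (hT.pos x w) (hh w) (by linarith)

/-- If all integrals above `lowerH` were at most one, Fatou's lemma along `h ↓ lowerH` would bound
the integral at `lowerH` by one, against nondegeneracy. That integral may be infinite, hence the
extended nonnegative reals. -/
theorem exists_one_lt_integral (hT : IsTurningKernel Tmin LM T) {x p : Space d}
    (hN : Nondegenerate T p) : ∃ h, (∀ w : Vel d U, 0 < 1 + h - inner ℝ (vec w) p) ∧
      1 < ∫ w, T x w / (1 + h - inner ℝ (vec w) p) ∂(velMeasure d U) := by
  by_contra! hcon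
  have hN' := hN.trans_le (iInf_le _ x)
  refine absurd hN' (not_lt.2 ?_)
  set hn : ℕ → ℝ := fun n => lowerH U p + 1 / ((n : ℝ) + 1) with hhn
  have hpos : ∀ n, ∀ w : Vel d U, 0 < 1 + hn n - inner ℝ (vec w) p := fun n w => by
    have h1 := inner_vec_le_lowerH w p
    have h2 : 0 < 1 / ((n : ℝ) + 1) := Nat.one_div_pos_of_nat
    simp only [hhn]; linarith
  set F : ℕ → Vel d U → ℝ≥0∞ := fun n w =>
    ENNReal.ofReal (T x w) / ENNReal.ofReal (1 + hn n - inner ℝ (vec w) p) with hF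
  have hFm : ∀ n, Measurable (F n) := fun n =>
    ((hT.continuous_section x).measurable.ennreal_ofReal).div
      (continuous_denom (hn n) p).measurable.ennreal_ofReal
  have hFle : ∀ n, ∫⁻ w, F n w ∂(velMeasure d U) ≤ 1 := by
    intro n
    have e : ∀ w, F n w = ENNReal.ofReal (T x w / (1 + hn n - inner ℝ (vec w) p)) := fun w =>
      (ENNReal.ofReal_div_of_pos (hpos n w)).symm
    simp_rw [e]
    rw [← ofReal_integral_eq_lintegral_ofReal
      (integrable_of_continuous (hT.continuous_integrand x (hpos n)))
      (Eventually.of_forall fun w => div_nonneg (hT.pos x w).le (hpos n w).le)]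
    exact ENNReal.ofReal_le_one.2 (hcon (hn n) (hpos n))
  have hlim : ∀ w, Tendsto (fun n => F n w) atTop
      (𝓝 (ENNReal.ofReal (T x w) / ENNReal.ofReal (1 + lowerH U p - inner ℝ (vec w) p))) := by
    intro w
    refine ENNReal.Tendsto.div tendsto_const_nhds ?_ ?_ ?_
    · exact Or.inl (ENNReal.ofReal_pos.2 (hT.pos x w)).ne'
    · refine ENNReal.tendsto_ofReal ?_
      have : Tendsto hn atTop (𝓝 (lowerH U p + 0)) :=
        tendsto_one_div_add_atTop_nhds_zero_nat.const_add _
      rw [add_zero] at this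
      exact (this.const_add 1).sub_const _
    · exact Or.inr ENNReal.ofReal_ne_top
  calc _ = ∫⁻ w, liminf (fun n => F n w) atTop ∂(velMeasure d U) :=
        lintegral_congr fun w => (hlim w).liminf_eq.symm
    _ ≤ liminf (fun n => ∫⁻ w, F n w ∂(velMeasure d U)) atTop := lintegral_liminf_le hFm
    _ ≤ 1 := by
        refine (liminf_le_liminf (Eventually.of_forall hFle)).trans ?_
        simp

/-- The integral exceeds one at some `h` and is at most one at `U ‖p‖`, so a root exists by the
intermediate value theorem. Strict monotonicity makes any root the least element of `upperSet`,
hence equal to its infimum. -/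
theorem isRoot_hamiltonian (hT : IsTurningKernel Tmin LM T) {x p : Space d}
    (hN : Nondegenerate T p) : IsRoot T x p (hamiltonian T x p) ∧
      ∀ h, IsRoot T x p h → h = hamiltonian T x p := by
  have hleast : ∀ h, IsRoot T x p h → h = hamiltonian T x p := by
    intro h hh
    have hmin : IsLeast (upperSet T x p) h := by
      refine ⟨⟨hh.1, hh.2.le⟩, fun k hk => ?_⟩
      by_contra! hlt
      have := hT.integral_strictAnti x hk.1 hlt
      rw [hh.2] at this
      linarith [hk.2]
    exact hmin.csInf_eq.symm
  refine ⟨?_, hleast⟩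
  obtain ⟨h, hpos, hh⟩ := hT.exists_one_lt_integral (x := x) hN
  have hk := hT.mem_upperSet x p
  have hhk : h ≤ U * ‖p‖ := by
    by_contra! hlt
    linarith [hT.integral_strictAnti x hk.1 hlt, hk.2]
  have hposI : ∀ s ∈ Icc h (U * ‖p‖), ∀ w : Vel d U, 0 < 1 + s - inner ℝ (vec w) p :=
    fun s hs w => by linarith [hpos w, hs.1]
  have hcont : ContinuousOn (fun s => ∫ w, T x w / (1 + s - inner ℝ (vec w) p) ∂(velMeasure d U))
      (Icc h (U * ‖p‖)) := by
    refine continuousOn_of_dominated (bound := fun w => T x w / (1 + h - inner ℝ (vec w) p)) ?_ ?_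
      (integrable_of_continuous (hT.continuous_integrand x hpos)) ?_
    · exact fun s hs => (hT.continuous_integrand x (hposI s hs)).aestronglyMeasurable
    · intro s hs
      refine Eventually.of_forall fun w => ?_
      rw [Real.norm_of_nonneg (div_nonneg (hT.pos x w).le (hposI s hs w).le)]
      exact div_le_div_of_nonneg_left (hT.pos x w).le (hpos w) (by linarith [hs.1])
    · refine Eventually.of_forall fun w => ?_
      refine continuousOn_const.div (by fun_prop) fun s hs => (hposI s hs w).ne'
  have hsub := intermediate_value_Icc' hhk hcont
  obtain ⟨r, hr, hr1⟩ := hsub ⟨hk.2, hh.le⟩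
  have hroot : IsRoot T x p r := ⟨hposI r hr, hr1⟩
  rwa [← hleast r hroot]

end IsTurningKernel


/-! ### Compactness -/

/-- By compactness finitely many balls of radius `r / 2` cover `𝒱`, and each ball of radius `r`
contains one of them. -/
theorem exists_le_measure_ball (hd : 0 < d) (hU : 0 < U) {r : ℝ} (hr : 0 < r) :
    ∃ b, 0 < b ∧ ∀ w : Vel d U, b ≤ (velMeasure d U).real (Metric.ball w r) := by
  have := isOpenPosMeasure_velMeasure (d := d) hU
  obtain ⟨w₀⟩ := nonempty_vel hd hU
  obtain ⟨t, -, htf, ht⟩ := (isCompact_univ (X := Vel d U)).finite_cover_balls (half_pos hr)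
  have hne : t.Nonempty := by
    obtain ⟨z, hz, -⟩ := mem_iUnion₂.1 (ht (mem_univ w₀))
    exact ⟨z, hz⟩
  obtain ⟨z₀, -, hz₀⟩ := exists_min_image t
    (fun z => (velMeasure d U).real (Metric.ball z (r / 2))) htf hne
  refine ⟨(velMeasure d U).real (Metric.ball z₀ (r / 2)), ?_, fun w => ?_⟩
  · exact ENNReal.toReal_pos (Metric.measure_ball_pos _ _ (half_pos hr)).ne' (measure_ne_top _ _)
  · obtain ⟨z, hz, hw⟩ := mem_iUnion₂.1 (ht (mem_univ w))
    refine (hz₀ z hz).trans (measureReal_mono ?_)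
    refine Metric.ball_subset_ball' ?_
    rw [dist_comm]
    linarith [Metric.mem_ball.1 hw]

namespace Setup

variable {ε Tmin LM : ℝ} {K₀ : ℝ≥0} {C₀ : ℝ} {T : Space d → Vel d U → ℝ}
  {φ : ℝ → Space d → Vel d U → ℝ}

/-- At `w'` the gain bound gives `Tmin ρ ≤ m f`. At `w`, continuity over a ball of mass at least `b`
bounds `f` by a multiple of `ρ`. The constants enter the phase only through `ε` times a logarithm.
-/
theorem phase_sub_le_of_measure_ball (h : Setup ε Tmin LM K₀ C₀ T φ) {t r b L q : ℝ} (ht : 0 ≤ t)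
    (hL : 0 ≤ L) (hb : 0 < b) (hball : ∀ w : Vel d U, b ≤ (velMeasure d U).real (Metric.ball w r))
    (x : Space d) (hosc : ∀ w w', |φ t x w - φ t x w'| ≤ L * dist w w' + q) (w w' : Vel d U) :
    φ t x w' - φ t x w ≤ L * r + q + ε * Real.log
      ((1 + timeLip d U LM K₀ C₀ + U * spaceLip d U Tmin LM K₀ C₀ t) / (Tmin * b)) := by
  have hε := h.eps_pos
  have hTm := h.min_pos
  have hU := h.speed_pos
  set m := 1 + timeLip d U LM K₀ C₀ + U * spaceLip d U Tmin LM K₀ C₀ t with hm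
  have hK0 : 0 ≤ spaceLip d U Tmin LM K₀ C₀ t := K₀.2.trans (h.le_spaceLip ht)
  have hm0 : 0 < m := by have := h.timeLip_nonneg; positivity
  rw [← hopfCole_le_exp_mul_iff hε, add_div, mul_div_cancel_left₀ _ hε.ne', Real.exp_add,
    Real.exp_log (by positivity)]
  have h1 : density (hopfCole ε φ) t x * Tmin ≤ m * hopfCole ε φ t x w' :=
    (mul_le_mul_of_nonneg_left (h.lower x w') (density_hopfCole_nonneg ε φ t x)).trans
      (h.gain_le ht hK0 (fun x y w => h.abs_phase_sub_space_le ht x y w) x w')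
  have h2 : b * hopfCole ε φ t x w
      ≤ Real.exp ((L * r + q) / ε) * density (hopfCole ε φ) t x := by
    have hi := h.sol.integrable_section ht x
    calc b * hopfCole ε φ t x w
        ≤ (velMeasure d U).real (Metric.ball w r) * hopfCole ε φ t x w :=
          mul_le_mul_of_nonneg_right (hball w) (hopfCole_pos _ _ _ _ _).le
      _ = ∫ _v in Metric.ball w r, hopfCole ε φ t x w ∂(velMeasure d U) := by
          rw [setIntegral_const, smul_eq_mul]
      _ ≤ ∫ v in Metric.ball w r, Real.exp ((L * r + q) / ε) * hopfCole ε φ t x v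
            ∂(velMeasure d U) := by
          refine setIntegral_mono_on (integrable_const _) (hi.const_mul _).integrableOn
            Metric.isOpen_ball.measurableSet fun v hv => ?_
          rw [hopfCole_le_exp_mul_iff hε]
          refine (le_abs_self _).trans ((hosc v w).trans ?_)
          have := (Metric.mem_ball.1 hv).le
          gcongr
      _ ≤ ∫ v, Real.exp ((L * r + q) / ε) * hopfCole ε φ t x v ∂(velMeasure d U) :=
          setIntegral_le_integral (hi.const_mul _) (Eventually.of_forall fun v =>
            mul_nonneg (Real.exp_pos _).le (hopfCole_pos _ _ _ _ _).le)
      _ = _ := by rw [integral_const_mul]; rfl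
  have hE := Real.exp_pos ((L * r + q) / ε)
  have hTb : 0 < Tmin * b := by positivity
  refine le_of_mul_le_mul_left (a := Tmin * b) ?_ hTb
  calc Tmin * b * hopfCole ε φ t x w = Tmin * (b * hopfCole ε φ t x w) := by ring
    _ ≤ Tmin * (Real.exp ((L * r + q) / ε) * density (hopfCole ε φ) t x) :=
        mul_le_mul_of_nonneg_left h2 hTm.le
    _ = Real.exp ((L * r + q) / ε) * (density (hopfCole ε φ) t x * Tmin) := by ring
    _ ≤ Real.exp ((L * r + q) / ε) * (m * hopfCole ε φ t x w') :=
        mul_le_mul_of_nonneg_left h1 hE.le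
    _ = _ := by field_simp

end Setup

section Family

variable {ε₀ Tmin LM : ℝ} {K₀ : ℝ≥0} {C₀ : ℝ} {T : ℝ → Space d → Vel d U → ℝ}
  {φ : ℝ → ℝ → Space d → Vel d U → ℝ}

/-- The dependence of the phases on the velocity disappears as `ε → 0`. -/
theorem eventually_osc_le (hF : ∀ ε ∈ Ioc 0 ε₀, Setup ε Tmin LM K₀ C₀ (T ε) (φ ε)) {t : ℝ}
    (ht : 0 ≤ t) {δ : ℝ} (hδ : 0 < δ) :
    ∃ ε₁, 0 < ε₁ ∧ ∀ ε ∈ Ioc 0 ε₀, ε < ε₁ → ∀ s ∈ Icc 0 t, ∀ x w w',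
      |φ ε s x w - φ ε s x w'| ≤ δ := by
  by_cases hε₀ : 0 < ε₀
  swap
  · exact ⟨1, one_pos, fun ε hε => absurd (hε.1.trans_le hε.2) hε₀⟩
  have h₀ := hF ε₀ ⟨hε₀, le_rfl⟩
  have hU := h₀.speed_pos
  have hTm := h₀.min_pos
  have hLM := h₀.LM_pos
  set K := spaceLip d U Tmin LM K₀ C₀ t with hK
  have hK0 : 0 ≤ K := K₀.2.trans (h₀.le_spaceLip ht)
  have hC := h₀.timeLip_nonneg
  set L := (1 + U) * t * K + ε₀ * (LM / Tmin * (1 + (1 + U) * t)) with hL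
  have hL0 : 0 ≤ L := by positivity
  -- The radius is fixed before `ε`: it makes `L r` small and determines `b`. The remaining terms
  -- are of order `ε`.
  set r := δ / 2 / (L + 1) with hr
  have hr0 : 0 < r := by positivity
  obtain ⟨b, hb, hball⟩ := exists_le_measure_ball (U := U) h₀.dim_pos hU hr0
  set m := 1 + timeLip d U LM K₀ C₀ + U * K with hm
  have hm0 : 0 < m := by positivity
  set Q := 2 * C₀ + |Real.log (m / (Tmin * b))| with hQ
  have hQ0 : 0 ≤ Q := by have := h₀.C₀_nonneg; positivity
  refine ⟨δ / 2 / (Q + 1), by positivity, fun ε hε hεlt s hs x => ?_⟩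
  have h := hF ε hε
  have hosc : ∀ w w', |φ ε s x w - φ ε s x w'| ≤ L * dist w w' + 2 * C₀ * ε := by
    intro w w'
    -- The initial phase need not be continuous in velocity; its oscillation is carried as the
    -- additive error `q` of order `ε`.
    refine (h.abs_phase_sub_vel_le (L := 0) (q := 2 * C₀ * ε)
      (fun x w w' => by simpa using h.init_osc x w w') hs.1 x w w').trans ?_
    rw [zero_add]
    have h1 := h.spaceLip_mono hs.2
    have h2 := hs.1
    have h3 := hs.2
    have h4 := hε.1
    have h5 := hε.2
    have h6 : 0 ≤ spaceLip d U Tmin LM K₀ C₀ s := K₀.2.trans (h.le_spaceLip hs.1)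
    rw [hL]
    gcongr
  suffices H : ∀ w w', φ ε s x w' - φ ε s x w ≤ δ by
    intro w w'
    rw [abs_le]
    constructor <;> linarith [H w w', H w' w]
  intro w w'
  refine (h.phase_sub_le_of_measure_ball hs.1 hL0 hb hball x hosc w w').trans ?_
  have e1 : L * r ≤ δ / 2 := by
    rw [hr, mul_div_assoc', div_le_iff₀ (by positivity)]
    nlinarith
  have e2 : (Q + 1) * ε ≤ δ / 2 := by
    have := (lt_div_iff₀ (by positivity)).1 hεlt
    linarith
  have hm' : 0 < 1 + timeLip d U LM K₀ C₀ + U * spaceLip d U Tmin LM K₀ C₀ s := by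
    have h6 : 0 ≤ spaceLip d U Tmin LM K₀ C₀ s := K₀.2.trans (h.le_spaceLip hs.1)
    positivity
  have e3 : Real.log ((1 + timeLip d U LM K₀ C₀ + U * spaceLip d U Tmin LM K₀ C₀ s) / (Tmin * b))
      ≤ |Real.log (m / (Tmin * b))| := by
    refine le_trans (Real.log_le_log (by positivity) ?_) (le_abs_self _)
    have := h.spaceLip_mono hs.2
    rw [hm]
    gcongr
  have e4 := mul_le_mul_of_nonneg_left e3 hε.1.le
  nlinarith [hε.1]

/-- Uniform bound on bounded sets. -/
theorem exists_phase_bound {φ₀ : Space d → ℝ} (hε₀ : 0 < ε₀)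
    (hF : ∀ ε ∈ Ioc 0 ε₀, Setup ε Tmin LM K₀ C₀ (T ε) (φ ε))
    (hinit : ∀ ε ∈ Ioc 0 ε₀, ∀ x w, |φ ε 0 x w - φ₀ x| ≤ C₀ * ε) (t R : ℝ) :
    ∃ M : ℝ, ∀ ε ∈ Ioc 0 ε₀, ∀ s ∈ Icc 0 t, ∀ x : Space d, ‖x‖ ≤ R → ∀ w, |φ ε s x w| ≤ M := by
  have h₀ := hF ε₀ ⟨hε₀, le_rfl⟩
  obtain ⟨M, hM⟩ := h₀.init_bound R
  refine ⟨M + 2 * C₀ * ε₀ + timeLip d U LM K₀ C₀ * t, fun ε hε s hs x hx w => ?_⟩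
  have h := hF ε hε
  have h1 := abs_le.1 (hM x hx w)
  have h2 := abs_le.1 (hinit ε hε x w)
  have h3 := abs_le.1 (hinit ε₀ ⟨hε₀, le_rfl⟩ x w)
  have h4 := abs_le.1 (h.abs_phase_sub_init_le hs.1 x w)
  have h5 := mul_le_mul_of_nonneg_left hs.2 h₀.timeLip_nonneg
  have h6 := mul_le_mul_of_nonneg_left hε.2 h₀.C₀_nonneg
  rw [abs_le]
  constructor <;> linarith [h1.1, h1.2, h2.1, h2.2, h3.1, h3.2, h4.1, h4.2]

theorem abs_phase_sub_init_le_of_family (hε₀ : 0 < ε₀)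
    (hF : ∀ ε ∈ Ioc 0 ε₀, Setup ε Tmin LM K₀ C₀ (T ε) (φ ε)) (t : ℝ) :
    ∀ ε ∈ Ioc 0 ε₀, ∀ s ∈ Icc 0 t, ∀ x w,
      |φ ε s x w - φ ε 0 x w| ≤ timeLip d U LM K₀ C₀ * t := fun ε hε _ hs x w =>
  ((hF ε hε).abs_phase_sub_init_le hs.1 x w).trans
    (mul_le_mul_of_nonneg_left hs.2 (hF ε₀ ⟨hε₀, le_rfl⟩).timeLip_nonneg)

end Family

/-- Arzelà–Ascoli. Compactness of a countable product of intervals replaces the diagonal argument on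
a dense sequence; equicontinuity extends the convergence to all points and makes it locally uniform.
-/
theorem exists_subseq_tendstoLocallyUniformly {X : Type*} [TopologicalSpace X]
    [TopologicalSpace.SeparableSpace X] [Nonempty X] {g : ℕ → X → ℝ}
    (hb : ∀ x, ∃ M, ∀ k, |g k x| ≤ M) (hg : Equicontinuous g) :
    ∃ (θ : ℕ → ℕ) (G : X → ℝ), StrictMono θ ∧
      TendstoLocallyUniformly (fun k => g (θ k)) G atTop := by
  set D := TopologicalSpace.denseSeq X with hD
  choose M hM using hb
  have hcpt : IsCompact (Set.pi univ fun n => Icc (-M (D n)) (M (D n))) :=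
    isCompact_univ_pi fun n => isCompact_Icc
  obtain ⟨a, -, θ, hθ, hlim⟩ := hcpt.tendsto_subseq (x := fun k n => g k (D n))
    fun k n _ => abs_le.1 (hM (D n) k)
  have hdense : ∀ n, Tendsto (fun k => g (θ k) (D n)) atTop (𝓝 (a n)) := fun n =>
    (tendsto_pi_nhds.1 hlim) n
  have hcauchy : ∀ x, CauchySeq fun k => g (θ k) x := by
    intro x
    rw [Metric.cauchySeq_iff]
    intro δ hδ
    have hV := Metric.equicontinuousAt_iff_right.1 (hg x) (δ / 3) (by positivity)
    obtain ⟨_, ⟨n, rfl⟩, hn⟩ := (TopologicalSpace.denseRange_denseSeq X).exists_mem_open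
      isOpen_interior ⟨x, mem_interior_iff_mem_nhds.2 hV⟩ |>.imp fun n hn =>
        (⟨⟨n, rfl⟩, hn⟩ : (∃ m, m = n) ∧ _)
    have hn' := interior_subset hn
    obtain ⟨N, hN⟩ := Metric.cauchySeq_iff.1 (hdense n).cauchySeq (δ / 3) (by positivity)
    refine ⟨N, fun k hk l hl => ?_⟩
    have h1 := hn' (θ k)
    have h2 := hn' (θ l)
    have h3 := hN k hk l hl
    calc dist (g (θ k) x) (g (θ l) x) ≤ dist (g (θ k) x) (g (θ k) (D n))
          + dist (g (θ k) (D n)) (g (θ l) (D n)) + dist (g (θ l) (D n)) (g (θ l) x) :=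
          dist_triangle4 _ _ _ _
      _ < δ / 3 + δ / 3 + δ / 3 := by
          rw [dist_comm (g (θ l) (D n))]
          gcongr
      _ = δ := by ring
  choose G hG using fun x => cauchySeq_tendsto_of_complete (hcauchy x)
  refine ⟨θ, G, hθ, Metric.tendstoLocallyUniformly_iff.2 fun δ hδ x => ?_⟩
  have hV := Metric.equicontinuousAt_iff_right.1 (hg x) (δ / 4) (by positivity)
  refine ⟨_, hV, ?_⟩
  filter_upwards [Metric.tendsto_nhds.1 (hG x) (δ / 4) (by positivity)] with k hk y hy
  have h1 : dist (G x) (G y) ≤ δ / 4 :=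
    le_of_tendsto ((hG x).dist (hG y)) (Eventually.of_forall fun l => (hy (θ l)).le)
  have h2 := hy (θ k)
  calc dist (G y) (g (θ k) y) ≤ dist (G y) (G x) + dist (G x) (g (θ k) x)
        + dist (g (θ k) x) (g (θ k) y) := dist_triangle4 _ _ _ _
    _ < δ := by
        rw [dist_comm (G y), dist_comm (G x) (g (θ k) x)]
        linarith

/-- Convergence of functions of `(t,x,w)` to a function of `(t,x)`, uniform for bounded `t ≥ 0`
and bounded `x`. -/
def ConvergesOnBounded (ψ : ℕ → ℝ → Space d → Vel d U → ℝ) (u : ℝ → Space d → ℝ) : Prop :=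
  ∀ t R δ : ℝ, 0 < δ → ∀ᶠ k in atTop, ∀ s ∈ Icc 0 t, ∀ x : Space d, ‖x‖ ≤ R →
    ∀ w, |ψ k s x w - u s x| ≤ δ

namespace ConvergesOnBounded

variable {ψ : ℕ → ℝ → Space d → Vel d U → ℝ} {u : ℝ → Space d → ℝ}

theorem comp (h : ConvergesOnBounded ψ u) {θ : ℕ → ℕ} (hθ : StrictMono θ) :
    ConvergesOnBounded (fun k => ψ (θ k)) u := fun t R δ hδ =>
  hθ.tendsto_atTop.eventually (h t R δ hδ)

theorem tendsto (h : ConvergesOnBounded ψ u) {t : ℝ} (ht : 0 ≤ t) (x : Space d) (w : Vel d U) :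
    Tendsto (fun k => ψ k t x w) atTop (𝓝 (u t x)) := by
  rw [Metric.tendsto_nhds]
  intro δ hδ
  filter_upwards [h t ‖x‖ (δ / 2) (by positivity)] with k hk
  rw [Real.dist_eq]
  linarith [hk t ⟨ht, le_rfl⟩ x le_rfl w]

theorem tendstoLocallyUniformlyOn (h : ConvergesOnBounded ψ u) (s : Set (ℝ × Space d × Vel d U))
    (hs : ∀ z ∈ s, 0 ≤ z.1) :
    TendstoLocallyUniformlyOn (fun k (z : ℝ × Space d × Vel d U) => ψ k z.1 z.2.1 z.2.2)
      (fun z => u z.1 z.2.1) atTop s := by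
  rw [Metric.tendstoLocallyUniformlyOn_iff]
  intro δ hδ z hz
  refine ⟨s ∩ {y | y.1 < z.1 + 1 ∧ ‖y.2.1‖ < ‖z.2.1‖ + 1}, ?_, ?_⟩
  · refine inter_mem_nhdsWithin s (IsOpen.mem_nhds ?_ ⟨by simp, by simp⟩)
    exact (isOpen_lt continuous_fst continuous_const).and
      (isOpen_lt continuous_snd.fst.norm continuous_const)
  · filter_upwards [h (z.1 + 1) (‖z.2.1‖ + 1) (δ / 2) (by positivity)] with k hk y hy
    rw [dist_comm, Real.dist_eq]
    linarith [hk y.1 ⟨hs y hy.1, hy.2.1.le⟩ y.2.1 hy.2.2.le y.2.2]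

end ConvergesOnBounded

section Family

variable {ε₀ Tmin LM : ℝ} {K₀ : ℝ≥0} {C₀ : ℝ} {T : ℝ → Space d → Vel d U → ℝ}
  {φ : ℝ → ℝ → Space d → Vel d U → ℝ}

theorem exists_subseq_convergesOnBounded {φ₀ : Space d → ℝ} (hε₀ : 0 < ε₀)
    (hF : ∀ ε ∈ Ioc 0 ε₀, Setup ε Tmin LM K₀ C₀ (T ε) (φ ε))
    (hinit : ∀ ε ∈ Ioc 0 ε₀, ∀ x w, |φ ε 0 x w - φ₀ x| ≤ C₀ * ε)
    {e : ℕ → ℝ} (he : ∀ k, e k ∈ Ioc 0 ε₀) (he0 : Tendsto e atTop (𝓝 0)) :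
    ∃ (θ : ℕ → ℕ) (u : ℝ → Space d → ℝ), StrictMono θ ∧
      ConvergesOnBounded (fun k => φ (e (θ k))) u := by
  have h₀ := hF ε₀ ⟨hε₀, le_rfl⟩
  obtain ⟨w₀⟩ := nonempty_vel h₀.dim_pos h₀.speed_pos
  -- One velocity suffices because the oscillation in velocity vanishes in the limit. The truncation
  -- `max z.1 0` puts the functions on all of `ℝ × Space d`, as nothing is known at negative times.
  set g : ℕ → ℝ × Space d → ℝ := fun k z => φ (e k) (max z.1 0) z.2 w₀ with hg
  have hb : ∀ z, ∃ M, ∀ k, |g k z| ≤ M := by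
    intro z
    obtain ⟨M, hM⟩ := exists_phase_bound hε₀ hF hinit (max z.1 0) ‖z.2‖
    exact ⟨M, fun k => hM _ (he k) _ ⟨le_max_right _ _, le_rfl⟩ z.2 le_rfl w₀⟩
  have hequi : Equicontinuous g := by
    intro z
    set t := max z.1 0 + 1 with ht
    have ht0 : 0 ≤ t := by positivity
    set L := timeLip d U LM K₀ C₀ + spaceLip d U Tmin LM K₀ C₀ t with hL
    have hmax : ∀ y : ℝ × Space d, |max y.1 0 - max z.1 0| ≤ dist y z := fun y =>
      (abs_max_sub_max_le_abs _ _ _).trans (by rw [← Real.dist_eq]; exact le_max_left _ _)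
    refine Metric.equicontinuousAt_iff.2 fun δ hδ => ?_
    have hL0 : 0 ≤ L := add_nonneg h₀.timeLip_nonneg (K₀.2.trans (h₀.le_spaceLip ht0))
    refine ⟨min 1 (δ / (2 * L + 1)), by positivity, fun y hy k => ?_⟩
    have hy1 := hy.trans_le (min_le_left _ _)
    have hy2 := hy.trans_le (min_le_right _ _)
    have hm := hmax y
    have hyt : max y.1 0 ∈ Icc 0 t := ⟨le_max_right _ _, by linarith [(abs_le.1 hm).2]⟩
    have hzt : max z.1 0 ∈ Icc 0 t := ⟨le_max_right _ _, by linarith⟩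
    have h1 := (hF _ (he k)).abs_phase_sub_le hyt hzt y.2 z.2 w₀
    have h2 : ‖y.2 - z.2‖ ≤ dist y z := by rw [← dist_eq_norm]; exact le_max_right _ _
    rw [dist_comm, Real.dist_eq]
    refine h1.trans_lt ?_
    rw [lt_div_iff₀ (by positivity)] at hy2
    calc L * (|max y.1 0 - max z.1 0| + ‖y.2 - z.2‖) ≤ L * (dist y z + dist y z) := by gcongr
      _ ≤ dist y z * (2 * L + 1) := by nlinarith [dist_nonneg (x := y) (y := z)]
      _ < δ := hy2
  obtain ⟨θ, G, hθ, hlim⟩ := exists_subseq_tendstoLocallyUniformly hb hequi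
  refine ⟨θ, fun t x => G (t, x), hθ, fun t R δ hδ => ?_⟩
  by_cases ht : 0 ≤ t
  swap
  · exact Eventually.of_forall fun k s hs => absurd (hs.1.trans hs.2) ht
  have hunif := (tendstoLocallyUniformly_iff_forall_isCompact.1 hlim)
    (Icc 0 t ×ˢ Metric.closedBall 0 R) (isCompact_Icc.prod (isCompact_closedBall 0 R))
  obtain ⟨ε₁, hε₁, hosc⟩ := eventually_osc_le hF ht (half_pos hδ)
  filter_upwards [Metric.tendstoUniformlyOn_iff.1 hunif (δ / 2) (by positivity),
    (he0.comp hθ.tendsto_atTop).eventually (gt_mem_nhds hε₁)] with k hk hk' s hs x hx w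
  have h1 := hk (s, x) ⟨hs, by simpa using hx⟩
  rw [dist_comm, Real.dist_eq] at h1
  simp only [hg, max_eq_left hs.1] at h1
  have h2 := hosc _ (he (θ k)) hk' s hs x w w₀
  calc |φ (e (θ k)) s x w - G (s, x)|
      ≤ |φ (e (θ k)) s x w - φ (e (θ k)) s x w₀| + |φ (e (θ k)) s x w₀ - G (s, x)| :=
        abs_sub_le _ _ _
    _ ≤ δ := by linarith

end Family


/-! ### The limit is a viscosity solution -/

namespace Setup

variable {ε Tmin LM : ℝ} {K₀ : ℝ≥0} {C₀ : ℝ} {T : Space d → Vel d U → ℝ}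
  {φ : ℝ → Space d → Vel d U → ℝ}

/-- The phase need not be differentiable in `(t,x)`, but it is along the characteristic through the
extremum. There its derivative must equal that of the test function, and this is all that the
kinetic equation involves. -/
theorem gain_eq_of_isLocalExtr (h : Setup ε Tmin LM K₀ C₀ T φ) {ψ : ℝ × Space d → ℝ} {t : ℝ}
    {x : Space d} {w : Vel d U} (ht : 0 < t) (hψ : DifferentiableAt ℝ ψ (t, x))
    (hext : IsLocalExtr (fun z : ℝ × Space d => φ z.1 z.2 w - ψ z) (t, x)) :
    density (hopfCole ε φ) t x * T x w
      = (1 - fderiv ℝ ψ (t, x) (1, vec w)) * hopfCole ε φ t x w := by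
  have hε := h.eps_pos
  set γ : ℝ → ℝ × Space d := fun s => (s, x + (s - t) • vec w) with hγ
  have hγt : γ t = (t, x) := by simp [hγ]
  have hγd : HasDerivAt γ (1, vec w) t := by
    refine (hasDerivAt_id t).prodMk ?_
    simpa using (((hasDerivAt_id t).sub_const t).smul_const (vec w)).const_add x
  have hf := (h.sol.equation t ht.le x w).hasDerivAt (Ici_mem_nhds ht)
  have hfpos := hopfCole_pos ε φ t x w
  have hval : hopfCole ε φ t (x + (t - t) • vec w) w = hopfCole ε φ t x w := by simp
  have hlog := (hf.log (by rw [hval]; exact hfpos.ne')).const_mul (-ε)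
  have hφ : (fun s => -ε * Real.log (hopfCole ε φ s (x + (s - t) • vec w) w))
      = fun s => φ s (x + (s - t) • vec w) w := by
    funext s
    rw [hopfCole, Real.log_exp]
    field_simp
  rw [hφ] at hlog
  have hψd : HasDerivAt (ψ ∘ γ) (fderiv ℝ ψ (t, x) (1, vec w)) t := by
    have : HasFDerivAt ψ (fderiv ℝ ψ (t, x)) (γ t) := by rw [hγt]; exact hψ.hasFDerivAt
    exact this.comp_hasDerivAt t hγd
  have hext' : IsLocalExtr ((fun z : ℝ × Space d => φ z.1 z.2 w - ψ z) ∘ γ) t :=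
    IsLocalExtr.comp_continuous (by rwa [hγt]) hγd.continuousAt
  have hzero := hext'.hasDerivAt_eq_zero (hlog.sub hψd)
  rw [hval] at hzero
  field_simp at hzero
  linarith

theorem continuousOn_phase (h : Setup ε Tmin LM K₀ C₀ T φ) (w : Vel d U) :
    ContinuousOn (fun z : ℝ × Space d => φ z.1 z.2 w) {z | 0 ≤ z.1} := by
  intro z hz
  have hz' : 0 ≤ z.1 := hz
  set t := z.1 + 1 with ht
  set L := timeLip d U LM K₀ C₀ + spaceLip d U Tmin LM K₀ C₀ t with hL
  have hsq : Tendsto (fun y : ℝ × Space d => L * (|y.1 - z.1| + ‖y.2 - z.2‖))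
      (𝓝[{z | 0 ≤ z.1}] z) (𝓝 0) := by
    have : Continuous fun y : ℝ × Space d => L * (|y.1 - z.1| + ‖y.2 - z.2‖) := by fun_prop
    have h1 := this.tendsto z
    simp only [sub_self, abs_zero, norm_zero, add_zero, mul_zero] at h1
    exact h1.mono_left nhdsWithin_le_nhds
  refine tendsto_iff_dist_tendsto_zero.2 (squeeze_zero' (Eventually.of_forall fun _ => dist_nonneg)
    ?_ hsq)
  have hnear : ∀ᶠ y : ℝ × Space d in 𝓝[{z | 0 ≤ z.1}] z, y.1 < t :=
    (continuous_fst.tendsto z).mono_left nhdsWithin_le_nhds |>.eventually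
      (gt_mem_nhds (by linarith))
  filter_upwards [self_mem_nhdsWithin, hnear] with y hy hyt
  rw [Real.dist_eq]
  exact h.abs_phase_sub_le ⟨hy, hyt.le⟩ ⟨hz', by linarith⟩ y.2 z.2 w

end Setup

/-- Maximization over a compact set in the first variable, up to `δ` in the second one. -/
theorem exists_isMaxOn_almost {Z W : Type*} [TopologicalSpace Z] {Ψ : Z → W → ℝ} {K : Set Z}
    (hK : IsCompact K) (hc : ∀ w, ContinuousOn (fun z => Ψ z w) K) {M : ℝ}
    (hM : ∀ z ∈ K, ∀ w, Ψ z w ≤ M) {c : ℝ} (hbd : ∀ z ∈ K, z ∉ interior K → ∀ w, Ψ z w ≤ c) {z₀ : Z}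
    (hz₀ : z₀ ∈ K) {w₀ : W} (hcz : c < Ψ z₀ w₀) {δ : ℝ} (hδ : 0 < δ) :
    ∃ z ∈ interior K, ∃ w, IsMaxOn (fun z => Ψ z w) K z ∧ ∀ w', Ψ z w' ≤ Ψ z w + δ := by
  -- A supremum over `w` need not be attained, as no continuity in `w` is assumed. A near-optimal
  -- `w` is fixed and the maximum over `K` is then exact; a value above `c` keeps it off the
  -- boundary.
  set S : Set ℝ := {a | ∃ z ∈ K, ∃ w, a = Ψ z w} with hS
  have hSne : S.Nonempty := ⟨_, z₀, hz₀, w₀, rfl⟩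
  have hSb : BddAbove S := ⟨M, by rintro _ ⟨z, hz, w, rfl⟩; exact hM z hz w⟩
  have h0 : Ψ z₀ w₀ ≤ sSup S := le_csSup hSb ⟨z₀, hz₀, w₀, rfl⟩
  obtain ⟨_, ⟨z₁, hz₁, w, rfl⟩, hlt⟩ := exists_lt_of_lt_csSup hSne
    (show max c (sSup S - δ) < sSup S from max_lt (by linarith) (by linarith))
  obtain ⟨z, hz, hzmax⟩ := hK.exists_isMaxOn ⟨z₁, hz₁⟩ (hc w)
  have hz1 : Ψ z₁ w ≤ Ψ z w := hzmax hz₁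
  have hl := (le_max_left c (sSup S - δ)).trans_lt hlt
  have hr := (le_max_right c (sSup S - δ)).trans_lt hlt
  refine ⟨z, ?_, w, hzmax, fun w' => ?_⟩
  · by_contra hzi
    linarith [hbd z hz hzi w]
  · have : Ψ z w' ≤ sSup S := le_csSup hSb ⟨z, hz, w', rfl⟩
    linarith

/-- The squared distance to `z₀`. -/
noncomputable def sqDist (z₀ z : ℝ × Space d) : ℝ := (z.1 - z₀.1) ^ 2 + ‖z.2 - z₀.2‖ ^ 2

theorem contDiff_sqDist (z₀ : ℝ × Space d) : ContDiff ℝ 1 (sqDist z₀) :=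
  ((contDiff_fst.sub contDiff_const).pow 2).add ((contDiff_snd.sub contDiff_const).norm_sq ℝ)

theorem fderiv_sqDist_self (z₀ : ℝ × Space d) : fderiv ℝ (sqDist z₀) z₀ = 0 := by
  refine IsLocalMin.fderiv_eq_zero (Eventually.of_forall fun z => ?_)
  show sqDist z₀ z₀ ≤ sqDist z₀ z
  have : sqDist z₀ z₀ = 0 := by simp [sqDist]
  rw [this, sqDist]
  positivity

theorem sq_dist_le_sqDist (z₀ z : ℝ × Space d) : dist z z₀ ^ 2 ≤ sqDist z₀ z := by
  rw [Prod.dist_eq, Real.dist_eq, dist_eq_norm, sqDist]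
  rcases max_choice |z.1 - z₀.1| ‖z.2 - z₀.2‖ with h | h <;> rw [h]
  · rw [sq_abs]; nlinarith [sq_nonneg ‖z.2 - z₀.2‖]
  · nlinarith [sq_nonneg (z.1 - z₀.1)]

section Family

variable {ε₀ Tmin LM : ℝ} {K₀ : ℝ≥0} {C₀ : ℝ} {T : ℝ → Space d → Vel d U → ℝ}
  {φ : ℝ → ℝ → Space d → Vel d U → ℝ}

/-- Perturbed test functions: if `ψ` touches the limit `u` from above (`s = 1`) or below
(`s = -1`), then nearby there is a point at which the kinetic equation can be evaluated and
`φ_ε - ε η` is almost maximal or minimal in the velocity variable. -/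
theorem eventually_exists_test_point (hF : ∀ ε ∈ Ioc 0 ε₀, Setup ε Tmin LM K₀ C₀ (T ε) (φ ε))
    {e : ℕ → ℝ} (he : ∀ k, e k ∈ Ioc 0 ε₀) (he0 : Tendsto e atTop (𝓝 0)) {u : ℝ → Space d → ℝ}
    (hu : ConvergesOnBounded (fun k => φ (e k)) u) {ψ : ℝ × Space d → ℝ} (hψ : ContDiff ℝ 1 ψ)
    {t : ℝ} {x : Space d} (ht : 0 < t) {s : ℝ} (hs : s = 1 ∨ s = -1)
    (hmax : IsLocalMax (fun z : ℝ × Space d => s * (u z.1 z.2 - ψ z)) (t, x)) {η : Vel d U → ℝ}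
    {B : ℝ} (hη : ∀ w, |η w| ≤ B) {σ : ℝ} (hσ : 0 < σ) :
    ∀ᶠ k in atTop, ∃ (r : ℝ) (y : Space d) (w : Vel d U) (b : ℝ), 0 < r ∧ ‖y - x‖ ≤ σ ∧
      |b - fderiv ℝ ψ (t, x) (1, vec w)| ≤ σ ∧
      density (hopfCole (e k) (φ (e k))) r y * T (e k) y w
        = (1 - b) * hopfCole (e k) (φ (e k)) r y w ∧
      ∀ w', s * (φ (e k) r y w' - φ (e k) r y w) ≤ e k * (s * (η w' - η w) + σ) := by
  have hss : s * s = 1 := by rcases hs with rfl | rfl <;> norm_num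
  have hsabs : |s| = 1 := by rcases hs with rfl | rfl <;> norm_num
  have h₀ := hF _ (he 0)
  have hU := h₀.speed_pos
  obtain ⟨w₀⟩ := nonempty_vel h₀.dim_pos hU
  have hB : 0 ≤ B := (abs_nonneg _).trans (hη w₀)
  set z₀ : ℝ × Space d := (t, x) with hz₀
  -- The quadratic term makes the extremum strict without changing the derivative at `z₀`. On the
  -- boundary of the ball of radius `R` it costs `R ^ 2`, while `φ - u` and `ε η` contribute at most
  -- `R ^ 2 / 8` each; this is the source of the threshold `c` below.
  set ψ' : ℝ × Space d → ℝ := fun z => ψ z + s * sqDist z₀ z with hψ'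
  have hψ'c : ContDiff ℝ 1 ψ' := hψ.add (contDiff_const.mul (contDiff_sqDist z₀))
  have hψ'd : Differentiable ℝ ψ' := hψ'c.differentiable one_ne_zero
  have hfd : fderiv ℝ ψ' z₀ = fderiv ℝ ψ z₀ := by
    have h1 : DifferentiableAt ℝ ψ z₀ := hψ.differentiable one_ne_zero z₀
    have h2 : DifferentiableAt ℝ (sqDist z₀) z₀ :=
      (contDiff_sqDist z₀).differentiable one_ne_zero z₀
    have h3 : HasFDerivAt ψ' (fderiv ℝ ψ z₀ + s • fderiv ℝ (sqDist z₀) z₀) z₀ :=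
      h1.hasFDerivAt.add (h2.hasFDerivAt.const_mul s)
    rw [h3.fderiv, fderiv_sqDist_self, smul_zero, add_zero]
  have hcont : ∀ᶠ z in 𝓝 z₀, dist (fderiv ℝ ψ' z) (fderiv ℝ ψ' z₀) < σ / (1 + U) :=
    Metric.tendsto_nhds.1 ((hψ'c.continuous_fderiv one_ne_zero).tendsto z₀) _ (by positivity)
  obtain ⟨ρ, hρ, hρball⟩ := Metric.eventually_nhds_iff.1 (hcont.and hmax)
  set R := min (ρ / 2) (min (t / 2) σ) with hR
  have hR0 : 0 < R := by positivity
  have hRρ : R < ρ := (min_le_left _ _).trans_lt (by linarith)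
  have hRt : R < t := (min_le_right _ _).trans_lt ((min_le_left _ _).trans_lt (by linarith))
  have hRσ : R ≤ σ := (min_le_right _ _).trans (min_le_right _ _)
  set K := Metric.closedBall z₀ R with hK
  have hKt : ∀ z ∈ K, 0 < z.1 ∧ z.1 ≤ t + R ∧ ‖z.2 - x‖ ≤ R ∧ ‖z.2‖ ≤ ‖x‖ + R := by
    intro z hz
    have h1 : |z.1 - t| ≤ R := by
      rw [← Real.dist_eq]; exact (le_max_left _ _).trans hz
    have h2 : ‖z.2 - x‖ ≤ R := by
      rw [← dist_eq_norm]; exact (le_max_right _ _).trans hz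
    rw [abs_le] at h1
    refine ⟨by linarith, by linarith, h2, ?_⟩
    have := norm_le_norm_add_norm_sub' z.2 x
    linarith
  have hz₀K : z₀ ∈ K := Metric.mem_closedBall_self hR0.le
  have heB : ∀ᶠ k in atTop, e k * B < R ^ 2 / 8 := by
    have := he0.mul_const B
    rw [zero_mul] at this
    exact this.eventually (gt_mem_nhds (by positivity))
  filter_upwards [hu (t + R) (‖x‖ + R) (R ^ 2 / 8) (by positivity), heB] with k hk hkB
  have h := hF _ (he k)
  have hε := h.eps_pos
  set ε := e k with hεdef
  set Ψ : ℝ × Space d → Vel d U → ℝ := fun z w => s * (φ ε z.1 z.2 w - ψ' z) - s * (ε * η w) with hΨ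
  have hnear : ∀ z ∈ K, ∀ w, |s * (φ ε z.1 z.2 w - u z.1 z.2)| ≤ R ^ 2 / 8 := by
    intro z hz w
    rw [abs_mul, hsabs, one_mul]
    obtain ⟨a1, a2, -, a4⟩ := hKt z hz
    exact hk z.1 ⟨a1.le, a2⟩ z.2 a4 w
  have hηb : ∀ w, |s * (ε * η w)| ≤ e k * B := by
    intro w
    rw [abs_mul, hsabs, one_mul, abs_mul, abs_of_pos hε]
    exact mul_le_mul_of_nonneg_left (hη w) hε.le
  have hΨeq : ∀ z w, Ψ z w = s * (u z.1 z.2 - ψ z) + s * (φ ε z.1 z.2 w - u z.1 z.2)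
      - sqDist z₀ z - s * (ε * η w) := by
    intro z w
    simp only [hΨ, hψ']
    linear_combination (-sqDist z₀ z) * hss
  have hle : ∀ z ∈ K, s * (u z.1 z.2 - ψ z) ≤ s * (u z₀.1 z₀.2 - ψ z₀) := fun z hz =>
    (hρball (lt_of_le_of_lt hz hRρ)).2
  have hsq0 : ∀ z : ℝ × Space d, 0 ≤ sqDist z₀ z := fun z => by unfold sqDist; positivity
  -- The tolerance is `ε * σ`, so that after division by `ε` in the exponent only `σ` is left.
  obtain ⟨z, hz, w, hzmax, hw⟩ := exists_isMaxOn_almost (Ψ := Ψ) (K := K)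
    (isCompact_closedBall z₀ R) (M := s * (u z₀.1 z₀.2 - ψ z₀) + R ^ 2 / 4)
    (c := s * (u z₀.1 z₀.2 - ψ z₀) - 3 / 4 * R ^ 2) (z₀ := z₀) (w₀ := w₀) (δ := ε * σ)
    (by
      intro w
      have h1 : ContinuousOn (fun z : ℝ × Space d => φ ε z.1 z.2 w) K :=
        (h.continuousOn_phase w).mono fun z hz => (hKt z hz).1.le
      exact ((h1.sub hψ'd.continuous.continuousOn).const_smul s).sub continuousOn_const)
    (by
      intro z hz w
      rw [hΨeq]
      have h1 := abs_le.1 (hnear z hz w)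
      have h2 := abs_le.1 (hηb w)
      linarith [h1.2, h2.1, hle z hz, hsq0 z])
    (by
      intro z hz hzi w
      rw [hK, interior_closedBall _ hR0.ne', Metric.mem_ball, not_lt] at hzi
      rw [hΨeq]
      have h1 := abs_le.1 (hnear z hz w)
      have h2 := abs_le.1 (hηb w)
      have h3 := sq_dist_le_sqDist z₀ z
      have h4 : R ^ 2 ≤ dist z z₀ ^ 2 := by gcongr
      linarith [h1.2, h2.1, hle z hz])
    hz₀K
    (by
      rw [hΨeq]
      have h1 := abs_le.1 (hnear z₀ hz₀K w₀)
      have h2 := abs_le.1 (hηb w₀)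
      have h3 : sqDist z₀ z₀ = 0 := by simp [sqDist]
      have : 0 < R ^ 2 := by positivity
      rw [h3]
      linarith [h1.1, h2.2])
    (by positivity)
  have hzK := interior_subset hz
  obtain ⟨hz1, hz2, hz3, hz4⟩ := hKt z hzK
  have hloc : IsLocalMax (fun z : ℝ × Space d => s * (φ ε z.1 z.2 w - ψ' z)) (z.1, z.2) := by
    have h1 : IsLocalMax (fun z => Ψ z w) z := hzmax.isLocalMax (mem_interior_iff_mem_nhds.1 hz)
    filter_upwards [h1] with y hy
    simp only [hΨ] at hy
    linarith
  have hext : IsLocalExtr (fun z : ℝ × Space d => φ ε z.1 z.2 w - ψ' z) (z.1, z.2) := by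
    rcases hs with rfl | rfl
    · right
      filter_upwards [hloc] with y hy
      linarith
    · left
      filter_upwards [hloc] with y hy
      linarith
  refine ⟨z.1, z.2, w, fderiv ℝ ψ' z (1, vec w), hz1, hz3.trans hRσ, ?_,
    h.gain_eq_of_isLocalExtr hz1 (hψ'd _) hext, fun w' => ?_⟩
  · have h1 := (hρball (lt_of_le_of_lt hzK hRρ)).1
    rw [hfd, dist_eq_norm] at h1
    rw [← Real.norm_eq_abs, ← sub_apply]
    refine (ContinuousLinearMap.le_opNorm _ _).trans ?_
    have h2 : ‖((1 : ℝ), vec w)‖ ≤ 1 + U := by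
      rw [Prod.norm_mk, norm_one]
      exact max_le (by linarith) ((norm_vec_le w).trans (by linarith))
    calc _ ≤ σ / (1 + U) * (1 + U) :=
          mul_le_mul h1.le h2 (norm_nonneg _) (by positivity)
      _ = σ := by field_simp
  · have := hw w'
    simp only [hΨ] at this
    linarith

end Family

theorem fderiv_prod_apply {ψ : ℝ × Space d → ℝ} {t : ℝ} {x : Space d}
    (hψ : DifferentiableAt ℝ ψ (t, x)) (v : Space d) :
    fderiv ℝ ψ (t, x) (1, v)
      = deriv (fun s => ψ (s, x)) t + inner ℝ v (gradient (fun y => ψ (t, y)) x) := by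
  have h1 : HasDerivAt (fun s => ψ (s, x)) (fderiv ℝ ψ (t, x) (1, 0)) t :=
    HasFDerivAt.comp_hasDerivAt t (f := fun s : ℝ => (s, x)) hψ.hasFDerivAt
      ((hasDerivAt_id t).prodMk (hasDerivAt_const t x))
  have h2 : HasFDerivAt (fun y => ψ (t, y))
      ((fderiv ℝ ψ (t, x)).comp (ContinuousLinearMap.inr ℝ ℝ (Space d))) x :=
    HasFDerivAt.comp x (f := fun y : Space d => (t, y)) hψ.hasFDerivAt (hasFDerivAt_prodMk_right t x)
  rw [h1.deriv, real_inner_comm, inner_gradient_left, h2.fderiv, ContinuousLinearMap.comp_apply,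
    ContinuousLinearMap.inr_apply, ← map_add]
  simp

/-- Moving from `x` in the direction `-s ∇ψ`, the test function changes at rate `‖∇ψ‖²` while `g`
allows at most `K ‖∇ψ‖`. This keeps the slopes of test functions in the range where nondegeneracy
holds. -/
theorem norm_gradient_le_of_isLocalMax {g ψ : Space d → ℝ} {K : ℝ≥0} (hg : LipschitzWith K g)
    {x : Space d} (hψ : DifferentiableAt ℝ ψ x) {s : ℝ} (hs : s = 1 ∨ s = -1)
    (hmax : IsLocalMax (fun y => s * (g y - ψ y)) x) : ‖gradient ψ x‖ ≤ K := by
  set p := gradient ψ x with hp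
  have hss : s * s = 1 := by rcases hs with rfl | rfl <;> norm_num
  have hsabs : |s| = 1 := by rcases hs with rfl | rfl <;> norm_num
  set γ : ℝ → Space d := fun r => x + r • (-(s • p)) with hγ
  have hγ0 : γ 0 = x := by simp [hγ]
  have hγd : HasDerivAt γ (-(s • p)) 0 := by
    exact (((hasDerivAt_id (0 : ℝ)).smul_const (-(s • p))).const_add x).congr_deriv (one_smul _ _)
  have hd : HasDerivAt (fun r => s * ψ (γ r)) (-‖p‖ ^ 2) 0 := by
    have h1 : HasFDerivAt ψ (fderiv ℝ ψ x) (γ 0) := by rw [hγ0]; exact hψ.hasFDerivAt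
    refine ((h1.comp_hasDerivAt 0 hγd).const_mul s).congr_deriv ?_
    rw [← inner_gradient_left, ← hp, inner_neg_right, inner_smul_right,
      real_inner_self_eq_norm_sq]
    linear_combination (-‖p‖ ^ 2) * hss
  have hev : ∀ᶠ r in 𝓝[>] (0 : ℝ), -(K * ‖p‖) ≤ slope (fun r => s * ψ (γ r)) 0 r := by
    have h1 : ∀ᶠ r in 𝓝 (0 : ℝ), s * (g (γ r) - ψ (γ r)) ≤ s * (g x - ψ x) := by
      have : Tendsto γ (𝓝 0) (𝓝 x) := by
        have := hγd.continuousAt.tendsto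
        rwa [hγ0] at this
      exact this.eventually hmax
    filter_upwards [h1.filter_mono nhdsWithin_le_nhds, self_mem_nhdsWithin] with r hr hr0
    have hr0' : 0 < r := hr0
    rw [slope_def_field, hγ0, sub_zero, le_div_iff₀ hr0']
    have h2 := hg.dist_le_mul (γ r) x
    have h3 : dist (γ r) x = r * ‖p‖ := by
      rw [dist_eq_norm, hγ]
      simp only [add_sub_cancel_left]
      rw [norm_smul, norm_neg, norm_smul, Real.norm_eq_abs, Real.norm_eq_abs, hsabs, one_mul,
        abs_of_pos hr0']
    rw [h3, Real.dist_eq] at h2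
    have h4 : |s * (g (γ r) - g x)| ≤ K * (r * ‖p‖) := by rwa [abs_mul, hsabs, one_mul]
    linarith [(abs_le.1 h4).1]
  have hlim := (hasDerivWithinAt_iff_tendsto_slope' self_notMem_Ioi).1
    (hd.hasDerivWithinAt (s := Ioi 0))
  have := ge_of_tendsto hlim hev
  by_contra! hcon
  have : (K : ℝ) * ‖p‖ < ‖p‖ * ‖p‖ := mul_lt_mul_of_pos_right hcon (K.2.trans_lt hcon)
  nlinarith


section Family

variable {ε₀ Tmin LM : ℝ} {K₀ : ℝ≥0} {C₀ : ℝ} {T : ℝ → Space d → Vel d U → ℝ}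
  {φ : ℝ → ℝ → Space d → Vel d U → ℝ}

theorem limit_abs_sub_le (hF : ∀ ε ∈ Ioc 0 ε₀, Setup ε Tmin LM K₀ C₀ (T ε) (φ ε))
    {e : ℕ → ℝ} (he : ∀ k, e k ∈ Ioc 0 ε₀) {u : ℝ → Space d → ℝ}
    (hu : ConvergesOnBounded (fun k => φ (e k)) u) {t r s : ℝ} (hr : r ∈ Icc 0 t)
    (hs : s ∈ Icc 0 t) (x y : Space d) :
    |u r x - u s y| ≤
      (timeLip d U LM K₀ C₀ + spaceLip d U Tmin LM K₀ C₀ t) * (|r - s| + ‖x - y‖) := by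
  have h₀ := hF _ (he 0)
  obtain ⟨w₀⟩ := nonempty_vel h₀.dim_pos h₀.speed_pos
  exact le_of_tendsto ((hu.tendsto hr.1 x w₀).sub (hu.tendsto hs.1 y w₀)).abs
    (Eventually.of_forall fun k => (hF _ (he k)).abs_phase_sub_le hr hs x y w₀)

theorem limit_continuousOn (hF : ∀ ε ∈ Ioc 0 ε₀, Setup ε Tmin LM K₀ C₀ (T ε) (φ ε))
    {e : ℕ → ℝ} (he : ∀ k, e k ∈ Ioc 0 ε₀) {u : ℝ → Space d → ℝ}
    (hu : ConvergesOnBounded (fun k => φ (e k)) u) :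
    ContinuousOn (fun z : ℝ × Space d => u z.1 z.2) {z | 0 ≤ z.1} := by
  intro z hz
  have hz' : 0 ≤ z.1 := hz
  have hsq : Tendsto (fun y : ℝ × Space d => (timeLip d U LM K₀ C₀
      + spaceLip d U Tmin LM K₀ C₀ (z.1 + 1)) * (|y.1 - z.1| + ‖y.2 - z.2‖))
      (𝓝[{z | 0 ≤ z.1}] z) (𝓝 0) := by
    have : Continuous fun y : ℝ × Space d => (timeLip d U LM K₀ C₀
      + spaceLip d U Tmin LM K₀ C₀ (z.1 + 1)) * (|y.1 - z.1| + ‖y.2 - z.2‖) := by fun_prop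
    have h1 := this.tendsto z
    simp only [sub_self, abs_zero, norm_zero, add_zero, mul_zero] at h1
    exact h1.mono_left nhdsWithin_le_nhds
  refine tendsto_iff_dist_tendsto_zero.2 (squeeze_zero' (Eventually.of_forall fun _ => dist_nonneg)
    ?_ hsq)
  have hnear : ∀ᶠ y : ℝ × Space d in 𝓝[{z | 0 ≤ z.1}] z, y.1 < z.1 + 1 :=
    (continuous_fst.tendsto z).mono_left nhdsWithin_le_nhds |>.eventually
      (gt_mem_nhds (by linarith))
  filter_upwards [self_mem_nhdsWithin, hnear] with y hy hyt
  rw [Real.dist_eq]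
  exact limit_abs_sub_le hF he hu ⟨hy, hyt.le⟩ ⟨hz', by linarith⟩ y.2 z.2

theorem limit_isViscositySolution (hF : ∀ ε ∈ Ioc 0 ε₀, Setup ε Tmin LM K₀ C₀ (T ε) (φ ε))
    {T₀ : Space d → Vel d U → ℝ} (hT₀ : IsTurningKernel Tmin LM T₀)
    (hlim : ∀ δ > 0, ∀ᶠ ε in 𝓝[>] 0, ∀ x w, |T ε x w - T₀ x w| ≤ δ)
    {P τ : ℝ≥0∞} (hN : ∀ p : Space d, ENNReal.ofReal ‖p‖ < P → Nondegenerate T₀ p)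
    (hslope : SlopesBelow ε₀ φ P τ) {φ₀ : Space d → ℝ}
    (hinit : ∀ ε ∈ Ioc 0 ε₀, ∀ x w, |φ ε 0 x w - φ₀ x| ≤ C₀ * ε)
    {e : ℕ → ℝ} (he : ∀ k, e k ∈ Ioc 0 ε₀) (he0 : Tendsto e atTop (𝓝 0)) {u : ℝ → Space d → ℝ}
    (hu : ConvergesOnBounded (fun k => φ (e k)) u) :
    IsViscositySolution (hamiltonian T₀) τ φ₀ u := by
  have h₀ := hF _ (he 0)
  have hU := h₀.speed_pos
  have hTm := h₀.min_pos
  have hLM := h₀.LM_pos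
  obtain ⟨w₀⟩ := nonempty_vel h₀.dim_pos hU
  have he0' : Tendsto e atTop (𝓝[>] 0) :=
    tendsto_nhdsWithin_iff.2 ⟨he0, Eventually.of_forall fun k => (he k).1⟩
  have hlip : ∀ t, 0 ≤ t → ENNReal.ofReal t < τ →
      ∃ K : ℝ≥0, (K : ℝ≥0∞) < P ∧ LipschitzWith K (u t) := by
    intro t ht htτ
    obtain ⟨K, hK, hKl⟩ := hslope t ht htτ
    refine ⟨K, hK, LipschitzWith.of_dist_le_mul fun x y => ?_⟩
    exact le_of_tendsto ((hu.tendsto ht x w₀).dist (hu.tendsto ht y w₀))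
      (Eventually.of_forall fun k => (hKl _ (he k) t ⟨ht, le_rfl⟩ w₀).dist_le_mul x y)
  -- Converts the total error `(LM + 1) σ` of the kernel, from `T ε → T₀` and from moving `y` to
  -- `x`, into a relative error `c σ`.
  set c := (LM + 1) / Tmin with hc
  have hc0 : 0 ≤ c := by positivity
  -- evaluation of the kinetic equation at the test points
  have core : ∀ (s : ℝ), (s = 1 ∨ s = -1) → ∀ ψ : ℝ × Space d → ℝ, ContDiff ℝ 1 ψ →
      ∀ (t : ℝ) (x : Space d), 0 < t → ENNReal.ofReal t < τ →
      IsLocalMax (fun z : ℝ × Space d => s * (u z.1 z.2 - ψ z)) (t, x) →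
      ∀ σ > 0, ∃ D r, 0 ≤ D ∧
        D ≤ 1 + hamiltonian T₀ x (gradient (fun y => ψ (t, y)) x)
          + U * ‖gradient (fun y => ψ (t, y)) x‖ ∧
        |deriv (fun s => ψ (s, x)) t + hamiltonian T₀ x (gradient (fun y => ψ (t, y)) x)
          - (D - r)| ≤ σ ∧
        (s = 1 → Real.exp (-σ) * (1 - c * σ) * D ≤ r) ∧
        (s = -1 → r ≤ Real.exp σ * (1 + c * σ) * D) := by
    intro s hs ψ hψ t x ht htτ hmax σ hσ
    set p := gradient (fun y => ψ (t, y)) x with hp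
    set a := deriv (fun s => ψ (s, x)) t with ha
    set h := hamiltonian T₀ x p with hh
    have hψd : DifferentiableAt ℝ ψ (t, x) := hψ.differentiable one_ne_zero _
    obtain ⟨K, hKP, hKlip⟩ := hlip t ht.le htτ
    have hpK : ‖p‖ ≤ K := by
      have hd : DifferentiableAt ℝ (fun y => ψ (t, y)) x :=
        DifferentiableAt.comp x (f := fun y : Space d => (t, y)) hψd
          (by fun_prop)
      refine norm_gradient_le_of_isLocalMax hKlip hd hs ?_
      exact IsLocalMax.comp_continuous (g := fun y : Space d => (t, y)) hmax
        (by fun_prop : Continuous fun y : Space d => (t, y)).continuousAt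
    have hpP : ENNReal.ofReal ‖p‖ < P := by
      refine lt_of_le_of_lt ?_ hKP
      rw [← ENNReal.ofReal_coe_nnreal]
      exact ENNReal.ofReal_le_ofReal hpK
    obtain ⟨hroot, -⟩ := hT₀.isRoot_hamiltonian (x := x) (hN p hpP)
    rw [← hh] at hroot
    -- Because `h` is a root, `Q` is a positive continuous density of integral one. Its negative
    -- logarithm is the corrector for both signs of `s`.
    set Q : Vel d U → ℝ := fun w => T₀ x w / (1 + h - inner ℝ (vec w) p) with hQ
    have hQpos : ∀ w, 0 < Q w := fun w => div_pos (hT₀.pos x w) (hroot.1 w)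
    have hQc : Continuous Q := hT₀.continuous_integrand x hroot.1
    have hQint : Integrable Q (velMeasure d U) := integrable_of_continuous hQc
    have hQ1 : ∫ w, Q w ∂(velMeasure d U) = 1 := hroot.2
    obtain ⟨B, hB⟩ := isCompact_univ.exists_bound_of_continuousOn
      (hQc.log fun w => (hQpos w).ne').neg.continuousOn
    have htest := eventually_exists_test_point hF he he0 hu hψ ht hs hmax
      (η := fun w => -Real.log (Q w)) (B := B) (fun w => hB w (mem_univ w)) hσ
    obtain ⟨k, ⟨r, y, w, b, hr, hyx, hb, hgain, hmaxw⟩, hTk⟩ :=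
      (htest.and (he0'.eventually (hlim σ hσ))).exists
    have hk := hF _ (he k)
    have hε := hk.eps_pos
    set ε := e k with hεd
    have hi := hk.sol.integrable_section hr.le y
    rw [fderiv_prod_apply hψd, ← ha, ← hp] at hb
    have hDpos := hroot.1 w
    set D := 1 + h - inner ℝ (vec w) p with hD
    have hfw := hopfCole_pos ε (φ ε) r y w
    have hTQ : T₀ x w = Q w * D := (div_mul_cancel₀ _ hDpos.ne').symm
    have hTdiff : |T ε y w - T₀ x w| ≤ (LM + 1) * σ := by
      have h1 := hTk y w
      have h2 := hT₀.lip_x y x w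
      have h3 : LM * ‖y - x‖ ≤ LM * σ := mul_le_mul_of_nonneg_left hyx hLM.le
      calc |T ε y w - T₀ x w| ≤ |T ε y w - T₀ y w| + |T₀ y w - T₀ x w| := abs_sub_le _ _ _
        _ ≤ (LM + 1) * σ := by linarith
    have hcT : (LM + 1) * σ ≤ c * σ * T₀ x w := by
      have : LM + 1 ≤ c * T₀ x w := by
        rw [hc, div_mul_eq_mul_div, le_div_iff₀ hTm]
        exact mul_le_mul_of_nonneg_left (hT₀.lower x w) (by linarith)
      nlinarith
    have hTd := abs_le.1 hTdiff
    refine ⟨D, 1 - b, hDpos.le, ?_, ?_, ?_, ?_⟩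
    · have := (abs_le.1 (abs_inner_vec_le w p)).1
      rw [hD]; linarith
    · have : a + h - (D - (1 - b)) = -(b - (a + inner ℝ (vec w) p)) := by rw [hD]; ring
      rw [this, abs_neg]
      exact hb
    · intro hs1
      subst hs1
      -- Near-maximality of `φ - ε η`, exponentiated. Integrating in `w'` uses `∫ Q = 1` and gives
      -- `f ≤ Q exp σ ρ`; since `T₀ = Q D`, the kinetic identity then yields `1 - b ≥ D` up to
      -- errors.
      have hpt : ∀ w', Q w' * hopfCole ε (φ ε) r y w
          ≤ Q w * Real.exp σ * hopfCole ε (φ ε) r y w' := by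
        intro w'
        have h1 := hmaxw w'
        rw [one_mul, one_mul, ← hopfCole_le_exp_mul_iff hε, mul_div_cancel_left₀ _ hε.ne',
          Real.exp_add, neg_sub_neg, Real.exp_sub, Real.exp_log (hQpos _),
          Real.exp_log (hQpos _)] at h1
        have := mul_le_mul_of_nonneg_left h1 (hQpos w').le
        refine this.trans_eq ?_
        have := (hQpos w').ne'
        field_simp
      have hint : hopfCole ε (φ ε) r y w
          ≤ Q w * Real.exp σ * density (hopfCole ε (φ ε)) r y := by
        have := integral_mono (hQint.mul_const _) (hi.const_mul _) hpt
        rwa [integral_mul_const, integral_const_mul, hQ1, one_mul] at this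
      have hT1 : Q w * ((1 - c * σ) * D) ≤ T ε y w := by
        have : Q w * ((1 - c * σ) * D) = T₀ x w - c * σ * T₀ x w := by rw [hTQ]; ring
        rw [this]; linarith [hTd.1]
      have hρ := density_hopfCole_nonneg ε (φ ε) r y
      -- For large `σ` the claimed lower bound is nonpositive, and `1 - b` is nonnegative because
      -- the gain is.
      by_cases hneg : 1 - c * σ ≤ 0
      · have h1 : Real.exp (-σ) * (1 - c * σ) * D ≤ 0 :=
          mul_nonpos_of_nonpos_of_nonneg
            (mul_nonpos_of_nonneg_of_nonpos (Real.exp_pos _).le hneg) hDpos.le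
        have h2 : 0 ≤ (1 - b) * hopfCole ε (φ ε) r y w := by
          rw [← hgain]; exact mul_nonneg hρ (hk.T_pos _ _).le
        linarith [nonneg_of_mul_nonneg_left h2 hfw]
      · push Not at hneg
        refine le_of_mul_le_mul_right ?_ hfw
        rw [← hgain]
        have hE : Real.exp (-σ) * Real.exp σ = 1 := by rw [← Real.exp_add]; simp
        calc Real.exp (-σ) * (1 - c * σ) * D * hopfCole ε (φ ε) r y w
            ≤ Real.exp (-σ) * (1 - c * σ) * D
              * (Q w * Real.exp σ * density (hopfCole ε (φ ε)) r y) :=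
              mul_le_mul_of_nonneg_left hint (by positivity)
          _ = density (hopfCole ε (φ ε)) r y * (Q w * ((1 - c * σ) * D)) := by
              linear_combination ((1 - c * σ) * D * Q w * density (hopfCole ε (φ ε)) r y) * hE
          _ ≤ _ := mul_le_mul_of_nonneg_left hT1 hρ
    · intro hs1
      subst hs1
      have hpt : ∀ w', Q w * hopfCole ε (φ ε) r y w'
          ≤ Q w' * (Real.exp σ * hopfCole ε (φ ε) r y w) := by
        intro w'
        have h1 := hmaxw w'
        rw [neg_one_mul, neg_sub, neg_one_mul, neg_sub, ← hopfCole_le_exp_mul_iff hε,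
          mul_div_cancel_left₀ _ hε.ne', Real.exp_add, neg_sub_neg, Real.exp_sub,
          Real.exp_log (hQpos _), Real.exp_log (hQpos _)] at h1
        have := mul_le_mul_of_nonneg_left h1 (hQpos w).le
        refine this.trans_eq ?_
        have := (hQpos w).ne'
        field_simp
      have hint : Q w * density (hopfCole ε (φ ε)) r y
          ≤ Real.exp σ * hopfCole ε (φ ε) r y w := by
        have := integral_mono (hi.const_mul _) (hQint.mul_const _) hpt
        rwa [integral_mul_const, integral_const_mul, hQ1, one_mul] at this
      have hT1 : T ε y w ≤ Q w * ((1 + c * σ) * D) := by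
        have : Q w * ((1 + c * σ) * D) = T₀ x w + c * σ * T₀ x w := by rw [hTQ]; ring
        rw [this]; linarith [hTd.2]
      have hρ := density_hopfCole_nonneg ε (φ ε) r y
      refine le_of_mul_le_mul_right ?_ hfw
      rw [← hgain]
      calc density (hopfCole ε (φ ε)) r y * T ε y w
          ≤ density (hopfCole ε (φ ε)) r y * (Q w * ((1 + c * σ) * D)) :=
            mul_le_mul_of_nonneg_left hT1 hρ
        _ = (1 + c * σ) * D * (Q w * density (hopfCole ε (φ ε)) r y) := by ring
        _ ≤ (1 + c * σ) * D * (Real.exp σ * hopfCole ε (φ ε) r y w) :=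
            mul_le_mul_of_nonneg_left hint (by positivity)
        _ = _ := by ring
  refine ⟨?_, ?_, ?_, ?_⟩
  · exact (limit_continuousOn hF he hu).mono fun z hz => hz.1
  · intro x
    refine tendsto_nhds_unique (hu.tendsto le_rfl x w₀) (tendsto_iff_dist_tendsto_zero.2 ?_)
    refine squeeze_zero (fun _ => dist_nonneg) (fun k => ?_)
      (by simpa using he0.const_mul C₀)
    rw [Real.dist_eq]
    exact hinit _ (he k) x w₀
  · intro ψ hψ t x ht htτ hmax
    have hcore := core 1 (Or.inl rfl) ψ hψ t x ht htτ (by simpa using hmax)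
    set p := gradient (fun y => ψ (t, y)) x
    set M := 1 + hamiltonian T₀ x p + U * ‖p‖
    -- The velocity at the test point varies with `σ`, but `D ≤ M` always, so the error vanishes as
    -- `σ → 0`.
    have hl : Tendsto (fun σ : ℝ => σ + M * (1 - Real.exp (-σ) * (1 - c * σ))) (𝓝[>] 0)
        (𝓝 (0 + M * (1 - Real.exp (-0) * (1 - c * 0)))) :=
      (Continuous.tendsto (by fun_prop) 0).mono_left nhdsWithin_le_nhds
    simp only [neg_zero, Real.exp_zero, mul_zero, sub_zero, mul_one, sub_self, add_zero] at hl
    refine ge_of_tendsto hl (eventually_mem_nhdsWithin.mono fun σ hσ => ?_)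
    have hσ' : 0 < σ := hσ
    obtain ⟨D, r, hD0, hDM, hab, h1, -⟩ := hcore σ hσ'
    have h1 := h1 rfl
    have h2 := (abs_le.1 hab).2
    have h3 : Real.exp (-σ) * (1 - c * σ) ≤ 1 := by
      have e1 : Real.exp (-σ) ≤ 1 := Real.exp_le_one_iff.2 (by linarith)
      have e2 : 1 - c * σ ≤ 1 := by nlinarith
      calc Real.exp (-σ) * (1 - c * σ) ≤ Real.exp (-σ) * 1 :=
            mul_le_mul_of_nonneg_left e2 (Real.exp_pos _).le
        _ ≤ 1 := by linarith
    have h4 := mul_le_mul_of_nonneg_right hDM (sub_nonneg.2 h3)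
    linarith
  · intro ψ hψ t x ht htτ hmin
    have hcore := core (-1) (Or.inr rfl) ψ hψ t x ht htτ (by
      filter_upwards [hmin] with z hz
      linarith)
    set p := gradient (fun y => ψ (t, y)) x
    set M := 1 + hamiltonian T₀ x p + U * ‖p‖
    have hl : Tendsto (fun σ : ℝ => -σ - M * (Real.exp σ * (1 + c * σ) - 1)) (𝓝[>] 0)
        (𝓝 (-0 - M * (Real.exp 0 * (1 + c * 0) - 1))) :=
      (Continuous.tendsto (by fun_prop) 0).mono_left nhdsWithin_le_nhds
    simp only [neg_zero, Real.exp_zero, mul_zero, mul_one, sub_self, add_zero] at hl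
    refine le_of_tendsto hl (eventually_mem_nhdsWithin.mono fun σ hσ => ?_)
    have hσ' : 0 < σ := hσ
    obtain ⟨D, r, hD0, hDM, hab, -, h1⟩ := hcore σ hσ'
    have h1 := h1 rfl
    have h2 := (abs_le.1 hab).1
    have h3 : 1 ≤ Real.exp σ * (1 + c * σ) := by
      have e1 : 1 ≤ Real.exp σ := Real.one_le_exp hσ'.le
      have e2 : 1 ≤ 1 + c * σ := by nlinarith
      exact one_le_mul_of_one_le_of_one_le e1 e2
    have h4 := mul_le_mul_of_nonneg_right hDM (sub_nonneg.2 h3)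
    linarith

end Family


/-! ### Comparison of viscosity solutions -/

theorem hasGradientAt_norm_sub_sq (a x : Space d) :
    HasGradientAt (fun y => ‖y - a‖ ^ 2) ((2 : ℝ) • (x - a)) x := by
  rw [hasGradientAt_iff_hasFDerivAt]
  refine ((hasFDerivAt_id x).sub_const a).norm_sq.congr_fderiv ?_
  ext v
  simp

theorem hasGradientAt_comp {h : ℝ → ℝ} {g : Space d → ℝ} {h' : ℝ} {g' x : Space d}
    (hh : HasDerivAt h h' (g x)) (hg : HasGradientAt g g' x) :
    HasGradientAt (fun y => h (g y)) (h' • g') x := by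
  rw [hasGradientAt_iff_hasFDerivAt, map_smul]
  exact hh.comp_hasFDerivAt x hg.hasFDerivAt

theorem hasGradientAt_add {f g : Space d → ℝ} {f' g' x : Space d}
    (hf : HasGradientAt f f' x) (hg : HasGradientAt g g' x) :
    HasGradientAt (fun y => f y + g y) (f' + g') x := by
  rw [hasGradientAt_iff_hasFDerivAt, map_add]
  exact hf.hasFDerivAt.add hg.hasFDerivAt

theorem hasGradientAt_add_const {f : Space d → ℝ} {f' x : Space d}
    (hf : HasGradientAt f f' x) (c : ℝ) : HasGradientAt (fun y => f y + c) f' x := by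
  rw [hasGradientAt_iff_hasFDerivAt]
  exact hf.hasFDerivAt.add_const c

theorem isCompact_cylinder (T R : ℝ) (x₁ : Space d) :
    IsCompact (Icc 0 T ×ˢ Metric.closedBall x₁ R : Set (ℝ × Space d)) :=
  isCompact_Icc.prod (isCompact_closedBall _ _)

theorem cylinder_subset_slab {τ : ℝ≥0∞} {T R : ℝ} (hT : ENNReal.ofReal T < τ) (x₁ : Space d) :
    (Icc 0 T ×ˢ Metric.closedBall x₁ R : Set (ℝ × Space d)) ⊆ slab d τ := fun _ hz =>
  ⟨hz.1.1, (ENNReal.ofReal_le_ofReal hz.1.2).trans_lt hT⟩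

/-- A barrier that is small inside a backward cone and large outside. -/
noncomputable def barrier (B κ Λ b : ℝ) (x₁ : Space d) (z : ℝ × Space d) : ℝ :=
  B * Real.exp (κ * (‖z.2 - x₁‖ ^ 2 + (Λ * z.1 - b)))

theorem contDiff_barrier (B κ Λ b : ℝ) (x₁ : Space d) : ContDiff ℝ 1 (barrier B κ Λ b x₁) := by
  have h1 : ContDiff ℝ 1 fun z : ℝ × Space d => ‖z.2 - x₁‖ ^ 2 :=
    (contDiff_snd.sub contDiff_const).norm_sq ℝ
  have h2 : ContDiff ℝ 1 fun z : ℝ × Space d => Λ * z.1 - b :=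
    (contDiff_const.mul contDiff_fst).sub contDiff_const
  exact contDiff_const.mul (contDiff_const.mul (h1.add h2)).exp

theorem IsViscositySolution.subsolution_barrier {H : Space d → Space d → ℝ} {τ : ℝ≥0∞}
    {u₀ : Space d → ℝ} {u : ℝ → Space d → ℝ} (hu : IsViscositySolution H τ u₀ u) {t s : ℝ}
    {x y x₁ : Space d} (ht : 0 < t) (htτ : ENNReal.ofReal t < τ) {N B κ Λ b γ : ℝ}
    (hloc : IsLocalMax (fun z : ℝ × Space d => u z.1 z.2
      - (N * sqDist (s, y) z + (barrier B κ Λ b x₁ z + γ * z.1))) (t, x)) :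
    (N * (2 * (t - s)) + barrier B κ Λ b x₁ (t, x) * κ * Λ + γ)
      + H x ((N * 2) • (x - y) + (barrier B κ Λ b x₁ (t, x) * κ * 2) • (x - x₁)) ≤ 0 := by
  set ψ : ℝ × Space d → ℝ := fun z =>
    N * sqDist (s, y) z + (barrier B κ Λ b x₁ z + γ * z.1) with hψ
  have hψc : ContDiff ℝ 1 ψ := (contDiff_const.mul (contDiff_sqDist _)).add
    ((contDiff_barrier _ _ _ _ _).add (contDiff_const.mul contDiff_fst))
  have hineq := hu.subsolution ψ hψc t x ht htτ hloc
  set E := barrier B κ Λ b x₁ (t, x) * κ with hE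
  have hderiv : HasDerivAt (fun a => ψ (a, x)) (N * (2 * (t - s)) + E * Λ + γ) t := by
    have h1 : HasDerivAt (fun a : ℝ => (a - s) ^ 2) (2 * (t - s)) t := by
      exact (((hasDerivAt_id t).sub_const s).pow 2).congr_deriv (by simp)
    have h2 : HasDerivAt (fun a : ℝ => κ * (‖x - x₁‖ ^ 2 + (Λ * a - b))) (κ * Λ) t := by
      simpa using ((((hasDerivAt_id t).const_mul Λ).sub_const b).const_add
        (‖x - x₁‖ ^ 2)).const_mul κ
    have h3 : HasDerivAt (fun a : ℝ => γ * a) γ t := by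
      simpa using (hasDerivAt_id t).const_mul γ
    have := ((h1.add_const (‖x - y‖ ^ 2)).const_mul N).add ((h2.exp.const_mul B).add h3)
    refine this.congr_deriv ?_
    rw [hE, barrier]; ring
  have hgrad : HasGradientAt (fun a => ψ (t, a)) ((N * 2) • (x - y) + (E * 2) • (x - x₁)) x := by
    have h1 := hasGradientAt_comp (h := fun a : ℝ => N * ((t - s) ^ 2 + a)) (h' := N)
      (by simpa using ((hasDerivAt_id (‖x - y‖ ^ 2)).const_add ((t - s) ^ 2)).const_mul N)
      (hasGradientAt_norm_sub_sq y x)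
    have h2 := hasGradientAt_comp
      (h := fun a : ℝ => B * Real.exp (κ * (a + (Λ * t - b)))) (h' := E)
      (by
        have := ((((hasDerivAt_id (‖x - x₁‖ ^ 2)).add_const
          (Λ * t - b)).const_mul κ).exp).const_mul B
        refine this.congr_deriv ?_
        simp only [hE, barrier, id]; ring)
      (hasGradientAt_norm_sub_sq x₁ x)
    have h3 := hasGradientAt_add h1 (hasGradientAt_add_const h2 (γ * t))
    rw [mul_smul, mul_smul]
    exact h3
  rwa [hderiv.deriv, hgrad.gradient] at hineq

theorem IsViscositySolution.supersolution_sqDist {H : Space d → Space d → ℝ} {τ : ℝ≥0∞}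
    {u₀ : Space d → ℝ} {v : ℝ → Space d → ℝ} (hv : IsViscositySolution H τ u₀ v) {t s : ℝ}
    {x y : Space d} (hs : 0 < s) (hsτ : ENNReal.ofReal s < τ) {N : ℝ}
    (hloc : IsLocalMin (fun z : ℝ × Space d => v z.1 z.2 - -(N * sqDist (t, x) z)) (s, y)) :
    0 ≤ N * (2 * (t - s)) + H y ((N * 2) • (x - y)) := by
  set ψ : ℝ × Space d → ℝ := fun z => -(N * sqDist (t, x) z) with hψ
  have hψc : ContDiff ℝ 1 ψ := (contDiff_const.mul (contDiff_sqDist _)).neg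
  have hineq := hv.supersolution ψ hψc s y hs hsτ hloc
  have hderiv : HasDerivAt (fun a => ψ (a, y)) (N * (2 * (t - s))) s := by
    have h1 : HasDerivAt (fun a : ℝ => (a - t) ^ 2) (2 * (s - t)) s := by
      exact (((hasDerivAt_id s).sub_const t).pow 2).congr_deriv (by simp)
    have := ((h1.add_const (‖y - x‖ ^ 2)).const_mul N).neg
    refine this.congr_deriv ?_
    ring
  have hgrad : HasGradientAt (fun a => ψ (s, a)) ((N * 2) • (x - y)) y := by
    have h0 : HasDerivAt (fun a : ℝ => -(N * ((s - t) ^ 2 + a))) (-N) (‖y - x‖ ^ 2) :=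
      (((hasDerivAt_id _).const_add ((s - t) ^ 2)).const_mul N).neg.congr_deriv (by rw [mul_one])
    have h1 := hasGradientAt_comp h0 (hasGradientAt_norm_sub_sq x y)
    have e : (N * 2) • (x - y) = -N • (2 : ℝ) • (y - x) := by
      rw [smul_smul, neg_mul, neg_smul, ← smul_neg, neg_sub]
    rw [e]
    exact h1
  rwa [hderiv.deriv, hgrad.gradient] at hineq

theorem sqDist_comm (z z' : ℝ × Space d) : sqDist z z' = sqDist z' z := by
  unfold sqDist; rw [norm_sub_rev]; ring

set_option maxHeartbeats 400000 in
/-- Comparison principle on `[0,τ) × ℝ^d`, without growth conditions: the Hamiltonian is Lipschitz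
in `p`, so the speed of propagation is finite. -/
theorem viscosity_le {H : Space d → Space d → ℝ} (hU : 0 < U) {c : ℝ} (hc : 0 ≤ c)
    (hHp : ∀ x p q, H x q - H x p ≤ U * ‖p - q‖)
    (hHx : ∀ x y p, H y p - H x p ≤ c * ‖x - y‖ * (1 + 2 * U * ‖p‖)) {τ : ℝ≥0∞}
    {u₀ : Space d → ℝ} {u v : ℝ → Space d → ℝ} (hu : IsViscositySolution H τ u₀ u)
    (hv : IsViscositySolution H τ u₀ v) {t₁ : ℝ} (x₁ : Space d) (ht₁ : 0 ≤ t₁)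
    (ht₁τ : ENNReal.ofReal t₁ < τ) : u t₁ x₁ ≤ v t₁ x₁ := by
  by_contra! hlt
  set σ := u t₁ x₁ - v t₁ x₁ with hσ
  have hσ0 : 0 < σ := sub_pos.2 hlt
  -- Room beyond `t₁`: the barrier keeps the maximizing time `t` below `T₁`, the penalty keeps `s`
  -- near `t`, so both are below `T₂` and the maximum is interior in time.
  obtain ⟨T₂, hT₂1, hT₂τ⟩ : ∃ T₂ : ℝ, t₁ < T₂ ∧ ENNReal.ofReal T₂ < τ := by
    obtain ⟨r, hr1, hr2⟩ := ENNReal.lt_iff_exists_nnreal_btwn.1 ht₁τ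
    refine ⟨r, ?_, by rwa [ENNReal.ofReal_coe_nnreal]⟩
    rw [← ENNReal.ofReal_coe_nnreal] at hr1
    exact (ENNReal.ofReal_lt_ofReal_iff_of_nonneg ht₁).1 hr1
  set T₁ := (t₁ + T₂) / 2 with hT₁
  have hT₁0 : 0 < T₁ := by rw [hT₁]; linarith
  have ht₁T₁ : t₁ < T₁ := by rw [hT₁]; linarith
  have hT₁T₂ : T₁ < T₂ := by rw [hT₁]; linarith
  set R := 2 * U * T₁ with hR
  have hR0 : 0 < R := by positivity
  set Λ := 2 * U * R with hΛ
  have hΛ0 : 0 < Λ := by positivity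
  have hΛR : Λ * T₁ = R ^ 2 := by rw [hΛ, hR]; ring
  set Q : Set (ℝ × Space d) := Icc 0 T₂ ×ˢ Metric.closedBall x₁ (R + 1) with hQ
  have hQc : IsCompact Q := isCompact_cylinder _ _ _
  have huQ : ContinuousOn (fun z : ℝ × Space d => u z.1 z.2) Q :=
    hu.continuousOn.mono (cylinder_subset_slab hT₂τ x₁)
  have hvQ : ContinuousOn (fun z : ℝ × Space d => v z.1 z.2) Q :=
    hv.continuousOn.mono (cylinder_subset_slab hT₂τ x₁)
  obtain ⟨Mu, hMu⟩ := hQc.exists_bound_of_continuousOn huQ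
  obtain ⟨Mv, hMv⟩ := hQc.exists_bound_of_continuousOn hvQ
  have hz₁ : (t₁, x₁) ∈ Q := ⟨⟨ht₁, hT₂1.le⟩, Metric.mem_closedBall_self (by positivity)⟩
  have hMu0 : 0 ≤ Mu := (norm_nonneg _).trans (hMu _ hz₁)
  have hMv0 : 0 ≤ Mv := (norm_nonneg _).trans (hMv _ hz₁)
  -- More than `u - v` can reach on `Q`. The barrier is at least `B` outside the region `‖x - x₁‖² <
  -- Λ (T₁ - t)`, which lies within radius `R` since `Λ T₁ = R²`.
  set B := Mu + Mv + 1 with hB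
  have hB0 : 0 < B := by positivity
  -- the penalty for leaving the backward cone
  obtain ⟨κ, hκ0, hκ⟩ : ∃ κ : ℝ, 0 < κ ∧ B * Real.exp (κ * (Λ * t₁ - Λ * T₁)) ≤ σ / 4 := by
    have h1 : Tendsto (fun κ : ℝ => κ * (Λ * t₁ - Λ * T₁)) atTop atBot :=
      tendsto_id.atTop_mul_const_of_neg (sub_neg.2 (mul_lt_mul_of_pos_left ht₁T₁ hΛ0))
    have h2 := (Real.tendsto_exp_atBot.comp h1).const_mul B
    rw [mul_zero] at h2
    obtain ⟨κ, hκ1, hκ2⟩ := ((h2.eventually (gt_mem_nhds (show (0 : ℝ) < σ / 4 by positivity))).and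
      (eventually_gt_atTop 0)).exists
    exact ⟨κ, hκ2, hκ1.le⟩
  set χ : ℝ × Space d → ℝ := barrier B κ Λ (Λ * T₁) x₁ with hχ
  have hχc : ContDiff ℝ 1 χ := contDiff_barrier _ _ _ _ _
  have hχ0 : ∀ z, 0 < χ z := fun z => by rw [hχ, barrier]; positivity
  -- The term `γ t` makes the subsolution inequality strict while using only a quarter of the gap
  -- `σ`.
  set γ := σ / (4 * T₂) with hγ
  have hT₂0 : 0 < T₂ := by linarith
  have hγ0 : 0 < γ := by positivity
  have hγt : γ * t₁ ≤ σ / 4 := by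
    rw [hγ, div_mul_eq_mul_div, div_le_iff₀ (by positivity)]
    have := mul_le_mul_of_nonneg_left hT₂1.le hσ0.le
    linarith
  -- The bound `σ / 4` excludes time zero; the other one controls the variation of `H` in `x`, which
  -- involves `‖x - y‖ ‖p‖ = 2 N ‖x - y‖²`.
  set ω := min (σ / 4) (γ / (8 * U * c + 1) / 2) with hω
  have hω0 : 0 < ω := by positivity
  have huU := (hQc.uniformContinuousOn_of_continuous huQ)
  have hvU := (hQc.uniformContinuousOn_of_continuous hvQ)
  obtain ⟨ru, hru, hruU⟩ := Metric.uniformContinuousOn_iff.1 huU ω hω0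
  obtain ⟨rv, hrv, hrvU⟩ := Metric.uniformContinuousOn_iff.1 hvU ω hω0
  set r := min (min ru rv) (min (min 1 (T₂ - T₁)) (γ / (4 * c + 1))) with hr
  have hr0 : 0 < r := by
    have : 0 < T₂ - T₁ := by linarith
    positivity
  have hrru : r ≤ ru := (min_le_left _ _).trans (min_le_left _ _)
  have hrrv : r ≤ rv := (min_le_left _ _).trans (min_le_right _ _)
  have hr1 : r ≤ 1 := (min_le_right _ _).trans ((min_le_left _ _).trans (min_le_left _ _))
  have hrT : r ≤ T₂ - T₁ := (min_le_right _ _).trans ((min_le_left _ _).trans (min_le_right _ _))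
  have hrγ : r ≤ γ / (4 * c + 1) := (min_le_right _ _).trans (min_le_right _ _)
  -- Large enough that separation by `r` costs more than the oscillation of `v`; a fixed penalty
  -- replaces the limit `N → ∞`.
  set N := (2 * Mv + 1) / r ^ 2 with hN
  have hN0 : 0 < N := by positivity
  set Φ : (ℝ × Space d) × (ℝ × Space d) → ℝ := fun z =>
    u z.1.1 z.1.2 - v z.2.1 z.2.2 - N * sqDist z.2 z.1 - χ z.1 - γ * z.1.1 with hΦ
  have hsqc : Continuous fun z : (ℝ × Space d) × (ℝ × Space d) => sqDist z.2 z.1 := by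
    unfold sqDist; fun_prop
  have hΦc : ContinuousOn Φ (Q ×ˢ Q) := by
    have h1 : ContinuousOn (fun z : (ℝ × Space d) × (ℝ × Space d) => u z.1.1 z.1.2) (Q ×ˢ Q) :=
      huQ.comp continuousOn_fst fun z hz => hz.1
    have h2 : ContinuousOn (fun z : (ℝ × Space d) × (ℝ × Space d) => v z.2.1 z.2.2) (Q ×ˢ Q) :=
      hvQ.comp continuousOn_snd fun z hz => hz.2
    have h3 : Continuous fun z : (ℝ × Space d) × (ℝ × Space d) => χ z.1 :=
      hχc.continuous.comp continuous_fst
    exact (((h1.sub h2).sub (continuous_const.mul hsqc).continuousOn).sub h3.continuousOn).sub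
      (by fun_prop)
  obtain ⟨⟨⟨t, x⟩, ⟨s, y⟩⟩, ⟨hzQ, hyQ⟩, hmax⟩ :=
    (hQc.prod hQc).exists_isMaxOn ⟨((t₁, x₁), (t₁, x₁)), hz₁, hz₁⟩ hΦc
  simp only at hzQ hyQ
  have hsq0 : 0 ≤ sqDist (s, y) (t, x) := by unfold sqDist; positivity
  have hself : ∀ z : ℝ × Space d, sqDist z z = 0 := fun z => by simp [sqDist]
  have ht0 : 0 ≤ t := hzQ.1.1
  have hs0 : 0 ≤ s := hyQ.1.1
  have hval : σ / 2 ≤ Φ ((t, x), (s, y)) := by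
    have h1 : Φ ((t₁, x₁), (t₁, x₁)) ≤ Φ ((t, x), (s, y)) := hmax (mk_mem_prod hz₁ hz₁)
    refine le_trans ?_ h1
    have h2 : χ (t₁, x₁) ≤ σ / 4 := by simpa [hχ, barrier] using hκ
    simp only [hΦ, hself]
    linarith
  have hγt0 : 0 ≤ γ * t := mul_nonneg hγ0.le ht0
  have hdiff : σ / 2 ≤ u t x - v s y := by
    have h1 := hχ0 (t, x)
    have h2 := mul_nonneg hN0.le hsq0
    simp only [hΦ] at hval
    linarith
  -- Moving the second point onto the first removes the penalty and changes only `v`, so the modulus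
  -- of continuity of `v` bounds the penalty.
  have hpen : N * sqDist (s, y) (t, x) ≤ v t x - v s y := by
    have h1 : Φ ((t, x), (t, x)) ≤ Φ ((t, x), (s, y)) := hmax (mk_mem_prod hzQ hzQ)
    simp only [hΦ, hself] at h1
    linarith
  have hdist : dist (t, x) (s, y) < r := by
    have h1 := sq_dist_le_sqDist (s, y) (t, x)
    have h2 := abs_le.1 (hMv _ hzQ)
    have h3 := abs_le.1 (hMv _ hyQ)
    simp only at h2 h3
    have h4 : N * dist (t, x) (s, y) ^ 2 ≤ 2 * Mv :=
      (mul_le_mul_of_nonneg_left h1 hN0.le).trans (by linarith [h2.2, h3.1])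
    have h5 : N * r ^ 2 = 2 * Mv + 1 := by rw [hN]; field_simp
    refine lt_of_pow_lt_pow_left₀ 2 hr0.le ?_
    by_contra! hcon
    have := mul_le_mul_of_nonneg_left hcon hN0.le
    linarith
  have hωv : |v t x - v s y| < ω := by
    have := hrvU _ hzQ _ hyQ (hdist.trans_le hrrv)
    rwa [Real.dist_eq] at this
  have hωu : |u t x - u s y| < ω := by
    have := hruU _ hzQ _ hyQ (hdist.trans_le hrru)
    rwa [Real.dist_eq] at this
  have hωσ : ω ≤ σ / 4 := min_le_left _ _
  -- At time zero `u` and `v` agree, so `u t x - v s y` would be below `ω`, against its lower bound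
  -- `σ / 2`.
  have ht : 0 < t := by
    refine ht0.lt_of_ne fun h0 => ?_
    have h1 : u t x = v t x := by rw [← h0, hu.initial, hv.initial]
    linarith [(abs_lt.1 hωv).2]
  have hs : 0 < s := by
    refine hs0.lt_of_ne fun h0 => ?_
    have h1 : u s y = v s y := by rw [← h0, hu.initial, hv.initial]
    linarith [(abs_lt.1 hωu).2]
  have hcone : ‖x - x₁‖ ^ 2 + (Λ * t - Λ * T₁) < 0 := by
    by_contra! hcon
    have h1 : B ≤ χ (t, x) := by
      have : 1 ≤ Real.exp (κ * (‖x - x₁‖ ^ 2 + (Λ * t - Λ * T₁))) :=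
        Real.one_le_exp (mul_nonneg hκ0.le hcon)
      exact le_mul_of_one_le_right hB0.le this
    have h2 := abs_le.1 (hMu _ hzQ)
    have h3 := abs_le.1 (hMv _ hyQ)
    simp only at h2 h3
    have h4 := mul_nonneg hN0.le hsq0
    simp only [hΦ] at hval
    linarith [h2.2, h3.1]
  have htT₁ : t < T₁ := by
    have : Λ * t < Λ * T₁ := by linarith [sq_nonneg ‖x - x₁‖]
    exact lt_of_mul_lt_mul_left this hΛ0.le
  have hxR : ‖x - x₁‖ < R := by
    refine lt_of_pow_lt_pow_left₀ 2 hR0.le ?_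
    have := mul_nonneg hΛ0.le ht0
    linarith
  have hts : |t - s| < r := by
    rw [← Real.dist_eq]; exact (le_max_left _ _).trans_lt hdist
  have hxy : ‖x - y‖ < r := by
    rw [← dist_eq_norm]; exact (le_max_right _ _).trans_lt hdist
  have hsT₂ : s < T₂ := by linarith [(abs_lt.1 hts).1]
  have hyR : ‖y - x₁‖ < R + 1 := by
    have : ‖y - x₁‖ ≤ ‖x - y‖ + ‖x - x₁‖ := by
      have := norm_sub_le_norm_sub_add_norm_sub y x x₁
      rwa [norm_sub_rev y x] at this
    linarith
  have hQnhds : ∀ (t' : ℝ) (x' : Space d), 0 < t' → t' < T₂ → ‖x' - x₁‖ < R + 1 →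
      Q ∈ 𝓝 (t', x') := fun t' x' h1 h2 h3 =>
    prod_mem_nhds (Icc_mem_nhds h1 h2) (Metric.closedBall_mem_nhds_of_mem (by
      rwa [Metric.mem_ball, dist_eq_norm]))
  set E := χ (t, x) * κ with hE
  have hE0 : 0 ≤ E := mul_nonneg (hχ0 _).le hκ0.le
  set p := (N * 2) • (x - y) with hp
  have hsub : (N * (2 * (t - s)) + E * Λ + γ) + H x (p + (E * 2) • (x - x₁)) ≤ 0 := by
    refine hu.subsolution_barrier ht ((ENNReal.ofReal_le_ofReal (by linarith)).trans_lt hT₂τ) ?_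
    filter_upwards [hQnhds t x ht (by linarith) (by linarith)] with z hz
    have : Φ (z, (s, y)) ≤ Φ ((t, x), (s, y)) := hmax (mk_mem_prod hz hyQ)
    simp only [hΦ] at this
    linarith
  have hsup : 0 ≤ N * (2 * (t - s)) + H y p := by
    refine hv.supersolution_sqDist hs ((ENNReal.ofReal_le_ofReal hsT₂.le).trans_lt hT₂τ) ?_
    filter_upwards [hQnhds s y hs hsT₂ hyR] with z hz
    have : Φ ((t, x), z) ≤ Φ ((t, x), (s, y)) := hmax (mk_mem_prod hzQ hz)
    simp only [hΦ] at this
    rw [sqDist_comm _ z, sqDist_comm _ (s, y)]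
    linarith
  have h1 := hHp x (p + (E * 2) • (x - x₁)) p
  have h2 := hHx x y p
  -- Inside the cone the time derivative of the barrier dominates `U` times its gradient; this is
  -- why `Λ = 2 U R`. The barrier drops out and `γ` remains to be contradicted.
  have hnχ : U * ‖(p + (E * 2) • (x - x₁)) - p‖ ≤ E * Λ := by
    rw [add_sub_cancel_left, norm_smul, Real.norm_of_nonneg (by positivity)]
    calc U * (E * 2 * ‖x - x₁‖) ≤ U * (E * 2 * R) := by gcongr
      _ = E * Λ := by rw [hΛ]; ring
  have hfin : γ ≤ c * ‖x - y‖ * (1 + 2 * U * ‖p‖) := by linarith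
  have hpn : ‖p‖ = N * 2 * ‖x - y‖ := by
    rw [hp, norm_smul, Real.norm_of_nonneg (by positivity)]
  have hN2 : N * ‖x - y‖ ^ 2 ≤ ω := by
    have : ‖x - y‖ ^ 2 ≤ sqDist (s, y) (t, x) := by
      unfold sqDist; exact le_add_of_nonneg_left (sq_nonneg _)
    have := mul_le_mul_of_nonneg_left this hN0.le
    linarith [(abs_lt.1 hωv).2]
  have hω2 : (8 * U * c + 1) * ω ≤ γ / 2 := by
    have : ω ≤ γ / (8 * U * c + 1) / 2 := min_le_right _ _
    calc (8 * U * c + 1) * ω ≤ (8 * U * c + 1) * (γ / (8 * U * c + 1) / 2) := by gcongr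
      _ = γ / 2 := by field_simp
  have hrc : (4 * c + 1) * r ≤ γ := by
    rw [le_div_iff₀ (by positivity)] at hrγ
    linarith
  rw [hpn] at hfin
  have e1 : c * ‖x - y‖ * (1 + 2 * U * (N * 2 * ‖x - y‖))
      = c * ‖x - y‖ + 4 * U * c * (N * ‖x - y‖ ^ 2) := by ring
  rw [e1] at hfin
  have e2 : c * ‖x - y‖ ≤ c * r := mul_le_mul_of_nonneg_left hxy.le hc
  have e3 : 4 * U * c * (N * ‖x - y‖ ^ 2) ≤ 4 * U * c * ω :=
    mul_le_mul_of_nonneg_left hN2 (by positivity)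
  linarith


/-! ### Conservation of mass and propagation of moments -/

instance : SFinite (phaseMeasure d U) := by
  unfold phaseMeasure; infer_instance

namespace Setup

variable {ε Tmin LM : ℝ} {K₀ : ℝ≥0} {C₀ : ℝ} {T : Space d → Vel d U → ℝ}
  {φ : ℝ → Space d → Vel d U → ℝ}

/-- Joint measurability follows from continuity in `(t,x)` and measurability in `w`. Time is
truncated because nothing is assumed at negative times. -/
theorem measurable_phase (h : Setup ε Tmin LM K₀ C₀ T φ) :
    Measurable fun z : ℝ × Space d × Vel d U => hopfCole ε φ (max z.1 0) z.2.1 z.2.2 := by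
  have h1 : Measurable (Function.uncurry fun (i : ℝ × Space d) (w : Vel d U) =>
      hopfCole ε φ (max i.1 0) i.2 w) := by
    refine measurable_uncurry_of_continuous_of_measurable (fun w => ?_)
      fun i => h.sol.measurable_section (le_max_right _ _) _
    have h2 : Continuous fun i : ℝ × Space d => φ (max i.1 0) i.2 w :=
      (h.continuousOn_phase w).comp_continuous (f := fun i : ℝ × Space d => (max i.1 0, i.2))
        (by fun_prop) fun i => (le_max_right _ _ : (0 : ℝ) ≤ max i.1 0)
    exact Real.continuous_exp.comp (h2.neg.div_const ε)
  exact h1.comp (f := fun z : ℝ × Space d × Vel d U => ((z.1, z.2.1), z.2.2)) (by fun_prop)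

theorem measurable_density (h : Setup ε Tmin LM K₀ C₀ T φ) :
    Measurable fun z : ℝ × Space d => density (hopfCole ε φ) (max z.1 0) z.2 := by
  have h1 : Measurable fun z : (ℝ × Space d) × Vel d U =>
      hopfCole ε φ (max z.1.1 0) z.1.2 z.2 :=
    h.measurable_phase.comp (f := fun z : (ℝ × Space d) × Vel d U => (z.1.1, z.1.2, z.2))
      (by fun_prop)
  exact (h1.stronglyMeasurable.integral_prod_right' (ν := velMeasure d U)).measurable

theorem measurable_T (h : Setup ε Tmin LM K₀ C₀ T φ) :
    Measurable fun z : Space d × Vel d U => T z.1 z.2 := by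
  have hL : 0 ≤ LM := h.LM_pos.le
  refine measurable_uncurry_of_continuous_of_measurable (u := T) (fun w => ?_) fun x => ?_
  · exact (LipschitzWith.of_dist_le_mul (K := ⟨LM, hL⟩) fun x y => by
      rw [Real.dist_eq, dist_eq_norm]; exact h.lip_x x y w).continuous
  · exact (LipschitzWith.of_dist_le_mul (K := ⟨LM, hL⟩) fun w w' => by
      rw [Real.dist_eq]; exact h.lip_v x w w').continuous.measurable

theorem lintegral_T (h : Setup ε Tmin LM K₀ C₀ T φ) (x : Space d) :
    ∫⁻ w, ENNReal.ofReal (T x w) ∂(velMeasure d U) = 1 := by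
  rw [← ofReal_integral_eq_lintegral_ofReal, h.prob, ENNReal.ofReal_one]
  · refine Integrable.of_bound (h.measurable_T.comp (f := fun w => (x, w))
      (by fun_prop)).aestronglyMeasurable LM (Eventually.of_forall fun w => ?_)
    rw [Real.norm_of_nonneg (h.T_pos x w).le]
    exact h.upper x w
  · exact Eventually.of_forall fun w => (h.T_pos x w).le

theorem ofReal_density (h : Setup ε Tmin LM K₀ C₀ T φ) {t : ℝ} (ht : 0 ≤ t) (x : Space d) :
    ENNReal.ofReal (density (hopfCole ε φ) t x)
      = ∫⁻ w, ENNReal.ofReal (hopfCole ε φ t x w) ∂(velMeasure d U) :=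
  ofReal_integral_eq_lintegral_ofReal (h.sol.integrable_section ht x)
    (Eventually.of_forall fun w => (hopfCole_pos ε φ t x w).le)

/-- Duhamel's formula. -/
theorem ofReal_duhamel (h : Setup ε Tmin LM K₀ C₀ T φ) {t : ℝ} (ht : 0 ≤ t) (y : Space d)
    (w : Vel d U) :
    ENNReal.ofReal (Real.exp (t / ε)) * ENNReal.ofReal (hopfCole ε φ t (y + t • vec w) w)
      = ENNReal.ofReal (hopfCole ε φ 0 y w) + ∫⁻ s in Ioc 0 t, ENNReal.ofReal
        (Real.exp (s / ε) * (density (hopfCole ε φ) s (y + s • vec w) * T (y + s • vec w) w) / ε) := by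
  have hε := h.eps_pos
  set E : ℝ → ℝ := fun s => Real.exp (s / ε) * hopfCole ε φ s (y + s • vec w) w with hE
  set E' : ℝ → ℝ := fun s => Real.exp (s / ε) * (density (hopfCole ε φ) s (y + s • vec w)
    * T (y + s • vec w) w) / ε with hE'
  have hd : ∀ s, 0 ≤ s → HasDerivWithinAt E (E' s) (Ici 0) s := fun s hs =>
    h.sol.hasDerivWithinAt_exp_char hε y w hs
  have hcont : ContinuousOn E (Icc 0 t) := fun s hs =>
    (hd s hs.1).continuousWithinAt.mono Icc_subset_Ici_self
  have hd' : ∀ s ∈ Ioo 0 t, HasDerivAt E (E' s) s := fun s hs =>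
    (hd s hs.1.le).hasDerivAt (Ici_mem_nhds hs.1)
  have hpos : ∀ s, 0 ≤ E' s := fun s => by
    have := density_hopfCole_nonneg ε φ s (y + s • vec w)
    have := (h.T_pos (y + s • vec w) w).le
    simp only [hE']
    positivity
  -- A nonnegative derivative of a continuous function is integrable, so no separate bound on the
  -- gain is needed.
  have hint : IntegrableOn E' (Ioc 0 t) :=
    intervalIntegral.integrableOn_deriv_of_nonneg hcont hd' fun s _ => hpos s
  have hftc := intervalIntegral.integral_eq_sub_of_hasDerivAt_of_le ht hcont hd'
    ((intervalIntegrable_iff_integrableOn_Ioc_of_le ht).2 hint)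
  rw [intervalIntegral.integral_of_le ht] at hftc
  have hE0 : E 0 = hopfCole ε φ 0 y w := by simp [hE]
  have hEt : E t = E 0 + ∫ s in Ioc 0 t, E' s := by linarith
  rw [← ENNReal.ofReal_mul (Real.exp_pos _).le]
  change ENNReal.ofReal (E t) = _
  rw [hEt, ENNReal.ofReal_add _ (integral_nonneg hpos), hE0,
    ofReal_integral_eq_lintegral_ofReal hint (Eventually.of_forall hpos)]
  rw [hE0]
  exact (hopfCole_pos _ _ _ _ _).le

/-- By Tonelli, for fixed `s` and `w` the shift along the characteristic is a translation and
disappears. The velocity integral of the kernel is then one, leaving the density. -/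
theorem lintegral_gain (h : Setup ε Tmin LM K₀ C₀ T φ) {t : ℝ}
    {G : ℝ → Space d → ℝ≥0∞} (hG : Measurable fun z : ℝ × Space d => G z.1 z.2) :
    ∫⁻ w, (∫⁻ y, (∫⁻ s in Ioc 0 t, G s (y + s • vec w) * ENNReal.ofReal
        (Real.exp (s / ε) * (density (hopfCole ε φ) s (y + s • vec w) * T (y + s • vec w) w) / ε)))
        ∂(velMeasure d U)
      = ∫⁻ s in Ioc 0 t, ENNReal.ofReal (Real.exp (s / ε) / ε) *
          ∫⁻ z, G s z.1 * ENNReal.ofReal (hopfCole ε φ s z.1 z.2) ∂(phaseMeasure d U) := by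
  have hε := h.eps_pos
  have hvec : Measurable (vec : Vel d U → Space d) := continuous_vec.measurable
  set k : ℝ → Space d → Vel d U → ℝ≥0∞ := fun s x w => G s x * ENNReal.ofReal
    (Real.exp (s / ε) * (density (hopfCole ε φ) (max s 0) x * T x w) / ε) with hk
  have hkm : Measurable fun z : ℝ × Space d × Vel d U => k z.1 z.2.1 z.2.2 := by
    have h1 : Measurable fun z : ℝ × Space d × Vel d U => G z.1 z.2.1 :=
      hG.comp (f := fun z : ℝ × Space d × Vel d U => (z.1, z.2.1)) (by fun_prop)
    have h2 : Measurable fun z : ℝ × Space d × Vel d U =>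
        density (hopfCole ε φ) (max z.1 0) z.2.1 :=
      h.measurable_density.comp (f := fun z : ℝ × Space d × Vel d U => (z.1, z.2.1)) (by fun_prop)
    have h3 : Measurable fun z : ℝ × Space d × Vel d U => T z.2.1 z.2.2 :=
      h.measurable_T.comp measurable_snd
    have h4 : Measurable fun z : ℝ × Space d × Vel d U => Real.exp (z.1 / ε) := by fun_prop
    exact h1.mul ((h4.mul (h2.mul h3)).div_const ε).ennreal_ofReal
  have e1 : ∀ (w : Vel d U) (y : Space d), ∫⁻ s in Ioc 0 t, G s (y + s • vec w) * ENNReal.ofReal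
        (Real.exp (s / ε) * (density (hopfCole ε φ) s (y + s • vec w) * T (y + s • vec w) w) / ε)
      = ∫⁻ s in Ioc 0 t, k s (y + s • vec w) w := fun w y =>
    setLIntegral_congr_fun measurableSet_Ioc fun s hs => by
      simp only [hk, max_eq_left hs.1.le]
  simp_rw [e1]
  have e2 : ∀ w : Vel d U, ∫⁻ y, ∫⁻ s in Ioc 0 t, k s (y + s • vec w) w
      = ∫⁻ s in Ioc 0 t, ∫⁻ y, k s y w := fun w => by
    rw [lintegral_lintegral_swap]
    · refine lintegral_congr fun s => ?_
      exact lintegral_add_right_eq_self (fun y => k s y w) (s • vec w)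
    · exact (hkm.comp (f := fun p : Space d × ℝ => (p.2, p.1 + p.2 • vec w, w))
        (by fun_prop)).aemeasurable
  simp_rw [e2]
  rw [lintegral_lintegral_swap]
  swap
  · have h1 : Measurable fun p : (Vel d U × ℝ) × Space d => k p.1.2 p.2 p.1.1 :=
      hkm.comp (f := fun p : (Vel d U × ℝ) × Space d => (p.1.2, p.2, p.1.1)) (by fun_prop)
    exact (h1.lintegral_prod_right' (ν := volume)).aemeasurable
  refine setLIntegral_congr_fun measurableSet_Ioc fun s hs => ?_
  have hs0 : 0 ≤ s := hs.1.le
  have hks : ∀ x w, k s x w = ENNReal.ofReal (Real.exp (s / ε) / ε) * (G s x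
      * ENNReal.ofReal (density (hopfCole ε φ) s x)) * ENNReal.ofReal (T x w) := by
    intro x w
    have hρ := density_hopfCole_nonneg ε φ s x
    have e : Real.exp (s / ε) * (density (hopfCole ε φ) s x * T x w) / ε
      = (Real.exp (s / ε) / ε) * density (hopfCole ε φ) s x * T x w := by ring
    simp only [hk, max_eq_left hs0]
    rw [e, ENNReal.ofReal_mul (by positivity), ENNReal.ofReal_mul (by positivity)]
    ring
  have hkms : Measurable fun p : Vel d U × Space d => k s p.2 p.1 :=
    hkm.comp (f := fun p : Vel d U × Space d => (s, p.2, p.1)) (by fun_prop)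
  have hfm : Measurable fun z : Space d × Vel d U =>
      G s z.1 * ENNReal.ofReal (hopfCole ε φ s z.1 z.2) :=
    (hG.comp (f := fun z : Space d × Vel d U => (s, z.1)) (by fun_prop)).mul
      (h.sol.measurable s hs0).ennreal_ofReal
  change ∫⁻ w, (∫⁻ y, k s y w) ∂(velMeasure d U) = _
  rw [lintegral_lintegral_swap hkms.aemeasurable, phaseMeasure, lintegral_prod _ hfm.aemeasurable,
    ← lintegral_const_mul' _ _ ENNReal.ofReal_ne_top]
  refine lintegral_congr fun x => ?_
  have hTm : Measurable fun w => ENNReal.ofReal (T x w) :=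
    (h.measurable_T.comp (f := fun w => (x, w)) (by fun_prop)).ennreal_ofReal
  simp_rw [hks]
  rw [lintegral_const_mul _ hTm, h.lintegral_T, mul_one, h.ofReal_density hs0,
    lintegral_const_mul _ (h.sol.measurable_section hs0 x).ennreal_ofReal]

/-- Duhamel's formula integrated against a weight. -/
theorem exp_mul_lintegral_eq (h : Setup ε Tmin LM K₀ C₀ T φ) {t : ℝ} (ht : 0 ≤ t)
    {g : Space d → ℝ≥0∞} (hg : Measurable g) :
    ENNReal.ofReal (Real.exp (t / ε)) *
        ∫⁻ z, g z.1 * ENNReal.ofReal (hopfCole ε φ t z.1 z.2) ∂(phaseMeasure d U)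
      = ∫⁻ w, (∫⁻ y, g (y + t • vec w) * (ENNReal.ofReal (hopfCole ε φ 0 y w)
          + ∫⁻ s in Ioc 0 t, ENNReal.ofReal (Real.exp (s / ε) *
            (density (hopfCole ε φ) s (y + s • vec w) * T (y + s • vec w) w) / ε)))
          ∂(velMeasure d U) := by
  have hfm : Measurable fun z : Space d × Vel d U =>
      g z.1 * ENNReal.ofReal (hopfCole ε φ t z.1 z.2) :=
    (hg.comp measurable_fst).mul (h.sol.measurable t ht).ennreal_ofReal
  rw [phaseMeasure, lintegral_prod_symm _ hfm.aemeasurable,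
    ← lintegral_const_mul' _ _ ENNReal.ofReal_ne_top]
  refine lintegral_congr fun w => ?_
  rw [← lintegral_const_mul' _ _ ENNReal.ofReal_ne_top,
    ← lintegral_add_right_eq_self _ (t • vec w)]
  refine lintegral_congr fun y => ?_
  rw [← h.ofReal_duhamel ht]
  ring

theorem lintegral_initial_add_gain (h : Setup ε Tmin LM K₀ C₀ T φ) {t : ℝ}
    {G : ℝ → Space d → ℝ≥0∞} (hG : Measurable fun z : ℝ × Space d => G z.1 z.2) :
    ∫⁻ w, (∫⁻ y, (G 0 y * ENNReal.ofReal (hopfCole ε φ 0 y w) +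
        ∫⁻ s in Ioc 0 t, G s (y + s • vec w) * ENNReal.ofReal (Real.exp (s / ε) *
          (density (hopfCole ε φ) s (y + s • vec w) * T (y + s • vec w) w) / ε)))
        ∂(velMeasure d U)
      = (∫⁻ z, G 0 z.1 * ENNReal.ofReal (hopfCole ε φ 0 z.1 z.2) ∂(phaseMeasure d U))
        + ∫⁻ s in Ioc 0 t, ENNReal.ofReal (Real.exp (s / ε) / ε) *
          ∫⁻ z, G s z.1 * ENNReal.ofReal (hopfCole ε φ s z.1 z.2) ∂(phaseMeasure d U) := by
  have hfm : Measurable fun z : Space d × Vel d U =>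
      G 0 z.1 * ENNReal.ofReal (hopfCole ε φ 0 z.1 z.2) :=
    (hG.comp (f := fun z : Space d × Vel d U => ((0 : ℝ), z.1)) (by fun_prop)).mul
      (h.sol.measurable 0 le_rfl).ennreal_ofReal
  have h1 : ∀ w : Vel d U, Measurable fun y : Space d =>
      G 0 y * ENNReal.ofReal (hopfCole ε φ 0 y w) := fun w =>
    hfm.comp (f := fun y => (y, w)) (by fun_prop)
  have h2 : Measurable fun w : Vel d U => ∫⁻ y, G 0 y * ENNReal.ofReal (hopfCole ε φ 0 y w) :=
    hfm.lintegral_prod_left'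
  simp_rw [lintegral_add_left (h1 _)]
  rw [lintegral_add_left h2, h.lintegral_gain hG, phaseMeasure,
    lintegral_prod_symm _ hfm.aemeasurable]

/-- A weight decreasing along characteristics can be moved inside Duhamel's integral and evaluated
at the earlier time `s`. -/
theorem exp_mul_lintegral_le (h : Setup ε Tmin LM K₀ C₀ T φ) {t : ℝ} (ht : 0 ≤ t)
    {G : ℝ → Space d → ℝ≥0∞} (hG : Measurable fun z : ℝ × Space d => G z.1 z.2)
    (hmono : ∀ s ∈ Icc 0 t, ∀ (y : Space d) (w : Vel d U),
      G t (y + t • vec w) ≤ G s (y + s • vec w)) :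
    ENNReal.ofReal (Real.exp (t / ε)) *
        ∫⁻ z, G t z.1 * ENNReal.ofReal (hopfCole ε φ t z.1 z.2) ∂(phaseMeasure d U)
      ≤ (∫⁻ z, G 0 z.1 * ENNReal.ofReal (hopfCole ε φ 0 z.1 z.2) ∂(phaseMeasure d U))
        + ∫⁻ s in Ioc 0 t, ENNReal.ofReal (Real.exp (s / ε) / ε) *
          ∫⁻ z, G s z.1 * ENNReal.ofReal (hopfCole ε φ s z.1 z.2) ∂(phaseMeasure d U) := by
  have hGt : Measurable (G t) := hG.comp (f := fun y : Space d => (t, y)) (by fun_prop)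
  rw [h.exp_mul_lintegral_eq ht hGt, ← h.lintegral_initial_add_gain hG]
  refine lintegral_mono fun w => lintegral_mono fun y => ?_
  rw [mul_add]
  refine add_le_add ?_ ((lintegral_const_mul_le _ _).trans ?_)
  · have := hmono 0 (left_mem_Icc.2 ht) y w
    rw [zero_smul, add_zero] at this
    gcongr
  · refine setLIntegral_mono' measurableSet_Ioc fun s hs => ?_
    have := hmono s (Ioc_subset_Icc_self hs) y w
    gcongr

theorem exp_mul_mass_eq (h : Setup ε Tmin LM K₀ C₀ T φ) {t : ℝ} (ht : 0 ≤ t) :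
    ENNReal.ofReal (Real.exp (t / ε)) *
        ∫⁻ z, ENNReal.ofReal (hopfCole ε φ t z.1 z.2) ∂(phaseMeasure d U)
      = (∫⁻ z, ENNReal.ofReal (hopfCole ε φ 0 z.1 z.2) ∂(phaseMeasure d U))
        + ∫⁻ s in Ioc 0 t, ENNReal.ofReal (Real.exp (s / ε) / ε) *
          ∫⁻ z, ENNReal.ofReal (hopfCole ε φ s z.1 z.2) ∂(phaseMeasure d U) := by
  have h1 := h.exp_mul_lintegral_eq ht (g := fun _ => 1) measurable_const
  have h2 := h.lintegral_initial_add_gain (t := t) (G := fun _ _ => 1) measurable_const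
  simp only [one_mul] at h1 h2
  rw [h1, h2]

end Setup

theorem lintegral_exp_div {ε : ℝ} (hε : 0 < ε) {t : ℝ} (ht : 0 ≤ t) :
    ∫⁻ s in Ioc 0 t, ENNReal.ofReal (Real.exp (s / ε) / ε)
      = ENNReal.ofReal (Real.exp (t / ε) - 1) := by
  have hd : ∀ s ∈ uIcc 0 t, HasDerivAt (fun s => Real.exp (s / ε)) (Real.exp (s / ε) / ε) s :=
    fun s _ => (((hasDerivAt_id s).div_const ε).exp).congr_deriv (by simp [div_eq_mul_inv])
  have hc : Continuous fun s => Real.exp (s / ε) / ε := by fun_prop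
  have h1 := intervalIntegral.integral_eq_sub_of_hasDerivAt hd (hc.intervalIntegrable 0 t)
  rw [intervalIntegral.integral_of_le ht] at h1
  rw [← ofReal_integral_eq_lintegral_ofReal
    ((intervalIntegrable_iff_integrableOn_Ioc_of_le ht).1 (hc.intervalIntegrable 0 t))
    (Eventually.of_forall fun s => by positivity), h1]
  simp

/-- A Gronwall-type contraction. -/
theorem le_initial_of_exp_mul_le {ε : ℝ} (hε : 0 < ε) {Z : ℝ → ℝ≥0∞} {t B : ℝ} (ht : 0 ≤ t)
    (hB : ∀ s ∈ Icc 0 t, Z s ≤ ENNReal.ofReal B)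
    (hZ : ∀ s ∈ Icc 0 t, ENNReal.ofReal (Real.exp (s / ε)) * Z s
      ≤ Z 0 + ∫⁻ r in Ioc 0 s, ENNReal.ofReal (Real.exp (r / ε) / ε) * Z r) :
    Z t ≤ Z 0 := by
  have hfin : ∀ s ∈ Icc 0 t, Z s ≠ ⊤ := fun s hs =>
    ne_top_of_le_ne_top ENNReal.ofReal_ne_top (hB s hs)
  have h0 : (0 : ℝ) ∈ Icc 0 t := left_mem_Icc.2 ht
  set c := (Z 0).toReal with hc
  have hc0 : 0 ≤ c := ENNReal.toReal_nonneg
  have hcZ : Z 0 = ENNReal.ofReal c := (ENNReal.ofReal_toReal (hfin 0 h0)).symm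
  set S := (fun s => (Z s).toReal) '' Icc 0 t with hS
  have hbdd : BddAbove S := ⟨max B 0, by
    rintro _ ⟨s, hs, rfl⟩
    exact ENNReal.toReal_le_of_le_ofReal (le_max_right _ _)
      ((hB s hs).trans (ENNReal.ofReal_le_ofReal (le_max_left _ _)))⟩
  -- Every `Z s` turns out to be at most `m - exp (-(t/ε)) (m - c)`, so taking the supremum forces
  -- `m ≤ c`. Finiteness of `m` comes from `hB`.
  set m := sSup S with hm
  have hle : ∀ s ∈ Icc 0 t, Z s ≤ ENNReal.ofReal m := fun s hs => by
    rw [← ENNReal.ofReal_toReal (hfin s hs)]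
    exact ENNReal.ofReal_le_ofReal (le_csSup hbdd ⟨s, hs, rfl⟩)
  have hcm : c ≤ m := le_csSup hbdd ⟨0, h0, rfl⟩
  have hm0 : 0 ≤ m := hc0.trans hcm
  have key : ∀ s ∈ Icc 0 t, (Z s).toReal ≤ m - Real.exp (-(t / ε)) * (m - c) := by
    intro s hs
    have h1 : ENNReal.ofReal (Real.exp (s / ε)) * Z s
        ≤ ENNReal.ofReal (c + (Real.exp (s / ε) - 1) * m) := by
      have hexp : 1 ≤ Real.exp (s / ε) := Real.one_le_exp (div_nonneg hs.1 hε.le)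
      refine (hZ s hs).trans ?_
      rw [ENNReal.ofReal_add hc0 (mul_nonneg (by linarith) hm0), ← hcZ,
        ENNReal.ofReal_mul (by linarith), ← lintegral_exp_div hε hs.1,
        ← lintegral_mul_const' _ _ ENNReal.ofReal_ne_top]
      refine add_le_add le_rfl (setLIntegral_mono' measurableSet_Ioc fun r hr => ?_)
      have := hle r ⟨hr.1.le, hr.2.trans hs.2⟩
      gcongr
    have h2 := ENNReal.toReal_le_of_le_ofReal (add_nonneg hc0 (mul_nonneg (by
      linarith [Real.one_le_exp (div_nonneg hs.1 hε.le)]) hm0)) h1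
    rw [ENNReal.toReal_mul, ENNReal.toReal_ofReal (Real.exp_pos _).le] at h2
    have h3 : Real.exp (-(s / ε)) * Real.exp (s / ε) = 1 := by
      rw [← Real.exp_add, neg_add_cancel, Real.exp_zero]
    have h4 := mul_le_mul_of_nonneg_left h2 (Real.exp_pos (-(s / ε))).le
    rw [← mul_assoc, h3, one_mul] at h4
    have h5 : Real.exp (-(s / ε)) * (c + (Real.exp (s / ε) - 1) * m)
        = m - Real.exp (-(s / ε)) * (m - c) := by linear_combination m * h3
    have h6 : Real.exp (-(t / ε)) ≤ Real.exp (-(s / ε)) :=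
      Real.exp_le_exp.2 (neg_le_neg (div_le_div_of_nonneg_right hs.2 hε.le))
    have h7 := mul_le_mul_of_nonneg_right h6 (sub_nonneg.2 hcm)
    linarith
  have h8 : m ≤ m - Real.exp (-(t / ε)) * (m - c) := by
    refine csSup_le ⟨_, 0, h0, rfl⟩ ?_
    rintro _ ⟨s, hs, rfl⟩
    exact key s hs
  have h9 : m ≤ c := by
    by_contra hlt
    have := mul_pos (Real.exp_pos (-(t / ε))) (sub_pos.2 (not_le.1 hlt))
    linarith
  rw [hcZ]
  exact (hle t (right_mem_Icc.2 ht)).trans (ENNReal.ofReal_le_ofReal h9)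

namespace Setup

variable {ε Tmin LM : ℝ} {K₀ : ℝ≥0} {C₀ : ℝ} {T : Space d → Vel d U → ℝ}
  {φ : ℝ → Space d → Vel d U → ℝ}

theorem ofReal_hopfCole_le (h : Setup ε Tmin LM K₀ C₀ T φ) {s t : ℝ} (hs : s ∈ Icc 0 t)
    (x : Space d) (w : Vel d U) : ENNReal.ofReal (hopfCole ε φ s x w)
      ≤ ENNReal.ofReal (Real.exp (timeLip d U LM K₀ C₀ * t / ε)) *
        ENNReal.ofReal (hopfCole ε φ 0 x w) := by
  rw [← ENNReal.ofReal_mul (Real.exp_pos _).le]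
  refine ENNReal.ofReal_le_ofReal ((hopfCole_le_exp_mul_iff h.eps_pos φ).2 ?_)
  have h1 := (abs_le.1 (h.abs_phase_sub_init_le hs.1 x w)).1
  have h2 := mul_le_mul_of_nonneg_left hs.2 h.timeLip_nonneg
  linarith

/-- Weights decreasing along characteristics have decreasing integrals. -/
theorem lintegral_weight_le (h : Setup ε Tmin LM K₀ C₀ T φ)
    {G : ℝ → Space d → ℝ≥0∞} (hG : Measurable fun z : ℝ × Space d => G z.1 z.2)
    (hmono : ∀ s t : ℝ, 0 ≤ s → s ≤ t → ∀ (y : Space d) (w : Vel d U),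
      G t (y + t • vec w) ≤ G s (y + s • vec w))
    (hanti : ∀ t : ℝ, 0 ≤ t → ∀ y, G t y ≤ G 0 y)
    (hfin : ∫⁻ z, G 0 z.1 * ENNReal.ofReal (hopfCole ε φ 0 z.1 z.2) ∂(phaseMeasure d U) ≠ ⊤)
    {t : ℝ} (ht : 0 ≤ t) :
    ∫⁻ z, G t z.1 * ENNReal.ofReal (hopfCole ε φ t z.1 z.2) ∂(phaseMeasure d U)
      ≤ ∫⁻ z, G 0 z.1 * ENNReal.ofReal (hopfCole ε φ 0 z.1 z.2) ∂(phaseMeasure d U) := by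
  set Z : ℝ → ℝ≥0∞ := fun s =>
    ∫⁻ z, G s z.1 * ENNReal.ofReal (hopfCole ε φ s z.1 z.2) ∂(phaseMeasure d U) with hZ
  -- The bound `B` depends on `ε`, which is harmless: it only ensures a finite supremum.
  refine le_initial_of_exp_mul_le (Z := Z) h.eps_pos (B :=
    Real.exp (timeLip d U LM K₀ C₀ * t / ε) * (Z 0).toReal) ht (fun s hs => ?_) fun s hs =>
    h.exp_mul_lintegral_le hs.1 hG fun r hr => hmono r s hr.1 hr.2
  rw [ENNReal.ofReal_mul (Real.exp_pos _).le, ENNReal.ofReal_toReal hfin,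
    ← lintegral_const_mul' _ _ ENNReal.ofReal_ne_top]
  refine lintegral_mono fun z => ?_
  calc G s z.1 * ENNReal.ofReal (hopfCole ε φ s z.1 z.2)
      ≤ G 0 z.1 * (ENNReal.ofReal (Real.exp (timeLip d U LM K₀ C₀ * t / ε)) *
        ENNReal.ofReal (hopfCole ε φ 0 z.1 z.2)) :=
        mul_le_mul' (hanti s hs.1 _) (h.ofReal_hopfCole_le hs _ _)
    _ = _ := by ring

/-- Conservation of mass. -/
theorem mass_eq_one (h : Setup ε Tmin LM K₀ C₀ T φ)
    (hmass : ∫⁻ z, ENNReal.ofReal (hopfCole ε φ 0 z.1 z.2) ∂(phaseMeasure d U) = 1)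
    {t : ℝ} (ht : 0 ≤ t) :
    ∫⁻ z, ENNReal.ofReal (hopfCole ε φ t z.1 z.2) ∂(phaseMeasure d U) = 1 := by
  set m : ℝ → ℝ≥0∞ := fun s =>
    ∫⁻ z, ENNReal.ofReal (hopfCole ε φ s z.1 z.2) ∂(phaseMeasure d U) with hm
  have hle : ∀ s, 0 ≤ s → m s ≤ 1 := fun s hs => by
    have := h.lintegral_weight_le (G := fun _ _ => 1) measurable_const (fun _ _ _ _ _ _ => le_rfl)
      (fun _ _ _ => le_rfl) (by simp [hmass]) hs
    simpa [hmass] using this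
  have hmeas : Measurable fun s => m (max s 0) :=
    (Measurable.ennreal_ofReal h.measurable_phase).lintegral_prod_right'
      (ν := phaseMeasure d U)
  -- The same contraction applied to the deficit `1 - m`, which starts at zero, excludes loss of
  -- mass. Gain was excluded by the constant weight.
  have hW := le_initial_of_exp_mul_le (Z := fun s => 1 - m s) h.eps_pos (B := 1) ht
    (fun s _ => by rw [ENNReal.ofReal_one]; exact tsub_le_self) fun s hs => ?_
  · have h0 : m 0 = 1 := hmass
    simp only [h0, tsub_self] at hW
    exact le_antisymm (hle t ht) (tsub_eq_zero_iff_le.1 (le_antisymm hW zero_le))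
  · have h0 : m 0 = 1 := hmass
    have hexp : 1 ≤ Real.exp (s / ε) := Real.one_le_exp (div_nonneg hs.1 h.eps_pos.le)
    have e1 : ENNReal.ofReal (Real.exp (s / ε))
        = 1 + ∫⁻ r in Ioc 0 s, ENNReal.ofReal (Real.exp (r / ε) / ε) := by
      rw [lintegral_exp_div h.eps_pos hs.1, ← ENNReal.ofReal_one,
        ← ENNReal.ofReal_add zero_le_one (by linarith)]
      congr 1; ring
    have e2 := h.exp_mul_mass_eq hs.1
    rw [hmass] at e2
    have e3 : ∫⁻ r in Ioc 0 s, ENNReal.ofReal (Real.exp (r / ε) / ε)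
        ≤ (∫⁻ r in Ioc 0 s, ENNReal.ofReal (Real.exp (r / ε) / ε) * m r)
          + ∫⁻ r in Ioc 0 s, ENNReal.ofReal (Real.exp (r / ε) / ε) * (1 - m r) := by
      have hA : Measurable fun r : ℝ => ENNReal.ofReal (Real.exp (r / ε) / ε) := by fun_prop
      have hcongr : ∫⁻ r in Ioc 0 s, ENNReal.ofReal (Real.exp (r / ε) / ε) * m r
          = ∫⁻ r in Ioc 0 s, ENNReal.ofReal (Real.exp (r / ε) / ε) * m (max r 0) :=
        setLIntegral_congr_fun measurableSet_Ioc fun r hr => by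
          simp only [max_eq_left hr.1.le]
      rw [hcongr, ← lintegral_add_left (f := fun r => ENNReal.ofReal (Real.exp (r / ε) / ε) * m (max r 0))
        (hA.mul hmeas)]
      refine setLIntegral_mono' measurableSet_Ioc fun r hr => ?_
      rw [max_eq_left hr.1.le, ← mul_add, add_tsub_cancel_of_le (hle r hr.1.le), mul_one]
    rw [h0, tsub_self, zero_add, ENNReal.mul_sub (fun _ _ => ENNReal.ofReal_ne_top), mul_one,
      tsub_le_iff_left]
    change _ ≤ ENNReal.ofReal (Real.exp (s / ε)) * _ + _
    rw [e2, e1, add_assoc]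
    exact add_le_add_right e3 1

/-- Propagation of the first moment. -/
theorem moment_le (h : Setup ε Tmin LM K₀ C₀ T φ) {M : ℝ}
    (hmom : ∫⁻ z, ENNReal.ofReal (‖z.1‖ * hopfCole ε φ 0 z.1 z.2) ∂(phaseMeasure d U)
      ≤ ENNReal.ofReal M) {t : ℝ} (ht : 0 ≤ t) :
    ∫⁻ z, ENNReal.ofReal (‖z.1‖ - U * t) * ENNReal.ofReal (hopfCole ε φ t z.1 z.2)
      ∂(phaseMeasure d U) ≤ ENNReal.ofReal M := by
  have e0 : ∫⁻ z, ENNReal.ofReal (‖z.1‖ - U * 0) * ENNReal.ofReal (hopfCole ε φ 0 z.1 z.2)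
      ∂(phaseMeasure d U) ≤ ENNReal.ofReal M := by
    refine le_of_eq_of_le (lintegral_congr fun z => ?_) hmom
    rw [mul_zero, sub_zero, ENNReal.ofReal_mul (norm_nonneg _)]
  -- The weight `(‖x‖ - U s)₊` decreases along characteristics because speeds are at most `U`.
  refine (h.lintegral_weight_le (G := fun s x => ENNReal.ofReal (‖x‖ - U * s)) (by fun_prop)
    (fun s t hs hst y w => ENNReal.ofReal_le_ofReal ?_)
    (fun t ht y => ENNReal.ofReal_le_ofReal ?_)
    (ne_top_of_le_ne_top ENNReal.ofReal_ne_top e0) ht).trans e0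
  · have e : y + t • vec w = (y + s • vec w) + (t - s) • vec w := by rw [sub_smul]; abel
    have h1 : ‖y + t • vec w‖ ≤ ‖y + s • vec w‖ + (t - s) * U := by
      rw [e]
      refine (norm_add_le _ _).trans ?_
      rw [norm_smul, Real.norm_of_nonneg (sub_nonneg.2 hst)]
      have := mul_le_mul_of_nonneg_left (norm_vec_le w) (sub_nonneg.2 hst)
      linarith
    linarith
  · have := mul_nonneg h.speed_pos.le ht
    linarith

end Setup


/-! ### Weak convergence -/

section Weak

variable {X : Type*} [TopologicalSpace X] [MeasurableSpace X] [BorelSpace X]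
  [TopologicalSpace.MetrizableSpace X]

/-- Portmanteau for open sets. -/
theorem ConvergesWeakly.measure_eq_zero {m : ℕ → Measure X} {ν : Measure X}
    (h : ConvergesWeakly m ν) (hm : ∀ k, IsProbabilityMeasure (m k)) (hν : IsProbabilityMeasure ν)
    {W : Set X} (hW : IsOpen W) (h0 : Tendsto (fun k => m k W) atTop (𝓝 0)) : ν W = 0 := by
  set p : ℕ → ProbabilityMeasure X := fun k => ⟨m k, hm k⟩ with hp
  set q : ProbabilityMeasure X := ⟨ν, hν⟩ with hq
  have h1 : Tendsto p atTop (𝓝 q) :=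
    ProbabilityMeasure.tendsto_iff_forall_integral_tendsto.2 h
  have h2 := ProbabilityMeasure.le_liminf_measure_open_of_tendsto h1 hW
  have h3 : liminf (fun k => m k W) atTop = 0 := h0.liminf_eq
  exact le_antisymm (h2.trans h3.le) zero_le

variable [SecondCountableTopology X]

/-- Prokhorov's theorem for sequences. -/
theorem exists_subseq_convergesWeakly {m : ℕ → Measure X} (hm : ∀ k, IsProbabilityMeasure (m k))
    (htight : ∀ δ : ℝ≥0∞, 0 < δ → ∃ K, IsCompact K ∧ ∀ k, m k Kᶜ ≤ δ) :
    ∃ (θ : ℕ → ℕ) (ν : Measure X), StrictMono θ ∧ IsProbabilityMeasure ν ∧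
      ConvergesWeakly (fun k => m (θ k)) ν := by
  set p : ℕ → ProbabilityMeasure X := fun k => ⟨m k, hm k⟩ with hp
  have hc : IsCompact (closure (range p)) := by
    refine isCompact_closure_of_isTightMeasureSet
      (isTightMeasureSet_iff_exists_isCompact_measure_compl_le.2 fun δ hδ => ?_)
    obtain ⟨K, hK, hle⟩ := htight δ hδ
    refine ⟨K, hK, ?_⟩
    rintro _ ⟨_, ⟨k, rfl⟩, rfl⟩
    exact hle k
  obtain ⟨ν, -, θ, hθ, hlim⟩ := hc.tendsto_subseq fun k => subset_closure (mem_range_self k)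
  exact ⟨θ, ν, hθ, ν.2, ProbabilityMeasure.tendsto_iff_forall_integral_tendsto.1 hlim⟩

/-- Second countability passes from null neighbourhoods to a null set, without measurability of `S`.
-/
theorem ConvergesWeakly.measure_eq_zero_of_locally {m : ℕ → Measure X} {ν : Measure X}
    (h : ConvergesWeakly m ν) (hm : ∀ k, IsProbabilityMeasure (m k)) (hν : IsProbabilityMeasure ν)
    {S : Set X} (hS : ∀ z ∈ S, ∃ W, IsOpen W ∧ z ∈ W ∧ Tendsto (fun k => m k W) atTop (𝓝 0)) :
    ν S = 0 := by
  refine measure_null_of_locally_null S fun z hz => ?_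
  obtain ⟨W, hW, hzW, h0⟩ := hS z hz
  exact ⟨W, mem_nhdsWithin_of_mem_nhds (hW.mem_nhds hzW), h.measure_eq_zero hm hν hW h0⟩

end Weak

/-! ### The exponential law on the time axis -/

/-- The probability measure `e^{-s} ds` on `[0,∞)`. -/
noncomputable def expLaw : Measure ℝ :=
  ((volume : Measure ℝ).restrict (Ici 0)).withDensity fun s => ENNReal.ofReal (Real.exp (-s))

theorem lintegral_exp_neg_Ioi (t : ℝ) :
    ∫⁻ s in Ioi t, ENNReal.ofReal (Real.exp (-s)) = ENNReal.ofReal (Real.exp (-t)) := by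
  have h : IntegrableOn (fun s : ℝ => Real.exp (-s)) (Ioi t) := 
    integrableOn_exp_neg_Ioi t
  rw [← ofReal_integral_eq_lintegral_ofReal h (Eventually.of_forall fun s => (Real.exp_pos _).le),
    integral_exp_neg_Ioi]

theorem expLaw_apply {A : Set ℝ} (hA : MeasurableSet A) :
    expLaw A = ∫⁻ s in A ∩ Ici 0, ENNReal.ofReal (Real.exp (-s)) := by
  rw [expLaw, withDensity_apply _ hA, Measure.restrict_restrict hA]

instance : IsProbabilityMeasure expLaw where
  measure_univ := by
    rw [expLaw_apply MeasurableSet.univ, univ_inter, setLIntegral_congr Ioi_ae_eq_Ici.symm,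
      lintegral_exp_neg_Ioi]
    simp

theorem expLaw_compl_Icc_le (t : ℝ) :
    expLaw (Icc 0 t)ᶜ ≤ ENNReal.ofReal (Real.exp (-t)) := by
  rw [expLaw_apply measurableSet_Icc.compl, ← lintegral_exp_neg_Ioi]
  refine lintegral_mono_set ?_
  rintro s ⟨h1, h2⟩
  by_contra h3
  exact h1 ⟨h2, not_lt.1 h3⟩

theorem expLaw_le_volume {A : Set ℝ} (hA : MeasurableSet A) : expLaw A ≤ volume (A ∩ Ici 0) := by
  rw [expLaw_apply hA, ← setLIntegral_one]
  refine setLIntegral_mono' (hA.inter measurableSet_Ici) fun s hs => ?_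
  rw [← ENNReal.ofReal_one]
  exact ENNReal.ofReal_le_ofReal (Real.exp_le_one_iff.2 (neg_nonpos.2 hs.2))

theorem lintegral_exp_expLaw {t : ℝ} :
    ∫⁻ s in Icc 0 t, ENNReal.ofReal (Real.exp s) ∂expLaw = ENNReal.ofReal t := by
  rw [expLaw, restrict_withDensity measurableSet_Icc, Measure.restrict_restrict measurableSet_Icc,
    lintegral_withDensity_eq_lintegral_mul _ (by fun_prop) (by fun_prop),
    inter_eq_left.2 (Icc_subset_Ici_self : Icc 0 t ⊆ Ici 0)]
  have : ∀ s : ℝ, ((fun s : ℝ => ENNReal.ofReal (Real.exp (-s))) *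
      fun s => ENNReal.ofReal (Real.exp s)) s = 1 := fun s => by
    rw [Pi.mul_apply, ← ENNReal.ofReal_mul (Real.exp_pos _).le, ← Real.exp_add, neg_add_cancel,
      Real.exp_zero, ENNReal.ofReal_one]
  simp_rw [this]
  simp

/-! ### Space-time measures -/

/-- The measure `e^{-s} f(s,x,v,v̂) ds dx dv dv̂` on `[0,∞) × ℝ^d × 𝒱`. -/
noncomputable def discounted (f : ℝ → Space d → Vel d U → ℝ) : Measure (ℝ × Space d × Vel d U) :=
  (((volume : Measure ℝ).restrict (Ici 0)).prod (phaseMeasure d U)).withDensity fun z =>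
    ENNReal.ofReal (Real.exp (-z.1)) * ENNReal.ofReal (f (max z.1 0) z.2.1 z.2.2)

namespace Setup

variable {ε Tmin LM : ℝ} {K₀ : ℝ≥0} {C₀ : ℝ} {T : Space d → Vel d U → ℝ}
  {φ : ℝ → Space d → Vel d U → ℝ}

theorem isProbabilityMeasure_measureAt (h : Setup ε Tmin LM K₀ C₀ T φ)
    (hmass : ∫⁻ z, ENNReal.ofReal (hopfCole ε φ 0 z.1 z.2) ∂(phaseMeasure d U) = 1)
    {t : ℝ} (ht : 0 ≤ t) : IsProbabilityMeasure (measureAt (hopfCole ε φ) t) where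
  measure_univ := by
    rw [measureAt, withDensity_apply _ MeasurableSet.univ, Measure.restrict_univ,
      h.mass_eq_one hmass ht]

/-- Markov's inequality for the weight `(‖x‖ - U t)₊`, with a constant independent of `ε`. -/
theorem measureAt_tail_le (h : Setup ε Tmin LM K₀ C₀ T φ) {M : ℝ}
    (hmom : ∫⁻ z, ENNReal.ofReal (‖z.1‖ * hopfCole ε φ 0 z.1 z.2) ∂(phaseMeasure d U)
      ≤ ENNReal.ofReal M) {t r : ℝ} (ht : 0 ≤ t) (hr : 0 < r) :
    measureAt (hopfCole ε φ) t {z | U * t + r < ‖z.1‖} ≤ ENNReal.ofReal (M / r) := by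
  have hS : MeasurableSet {z : Space d × Vel d U | U * t + r < ‖z.1‖} :=
    measurableSet_lt (by fun_prop) (by fun_prop)
  rw [measureAt, withDensity_apply _ hS, ENNReal.ofReal_div_of_pos hr,
    ENNReal.le_div_iff_mul_le (Or.inl (by simpa using hr)) (Or.inl ENNReal.ofReal_ne_top),
    ← lintegral_mul_const' _ _ ENNReal.ofReal_ne_top]
  refine le_trans ?_ (h.moment_le hmom ht)
  refine (setLIntegral_mono' hS fun z hz => ?_).trans (setLIntegral_le_lintegral _ _)
  have hz' : U * t + r < ‖z.1‖ := hz
  rw [mul_comm]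
  gcongr
  linarith

theorem discounted_prod (h : Setup ε Tmin LM K₀ C₀ T φ) {A : Set ℝ} (hA : MeasurableSet A)
    {B : Set (Space d × Vel d U)} (hB : MeasurableSet B) :
    discounted (hopfCole ε φ) (A ×ˢ B) = ∫⁻ s in A ∩ Ici 0,
      ENNReal.ofReal (Real.exp (-s)) * measureAt (hopfCole ε φ) s B := by
  have hm : Measurable fun z : ℝ × Space d × Vel d U =>
      ENNReal.ofReal (Real.exp (-z.1)) * ENNReal.ofReal (hopfCole ε φ (max z.1 0) z.2.1 z.2.2) :=
    Measurable.mul (by fun_prop) h.measurable_phase.ennreal_ofReal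
  rw [discounted, withDensity_apply _ (hA.prod hB), ← Measure.prod_restrict,
    Measure.restrict_restrict hA, lintegral_prod _ hm.aemeasurable]
  refine setLIntegral_congr_fun (hA.inter measurableSet_Ici) fun s hs => ?_
  have hs0 : max s 0 = s := max_eq_left hs.2
  simp only [hs0]
  rw [lintegral_const_mul' _ _ ENNReal.ofReal_ne_top, measureAt, withDensity_apply _ hB]

theorem discounted_prod_univ (h : Setup ε Tmin LM K₀ C₀ T φ)
    (hmass : ∫⁻ z, ENNReal.ofReal (hopfCole ε φ 0 z.1 z.2) ∂(phaseMeasure d U) = 1)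
    {A : Set ℝ} (hA : MeasurableSet A) :
    discounted (hopfCole ε φ) (A ×ˢ univ) = expLaw A := by
  rw [h.discounted_prod hA MeasurableSet.univ, expLaw_apply hA]
  refine setLIntegral_congr_fun (hA.inter measurableSet_Ici) fun s hs => ?_
  have := h.isProbabilityMeasure_measureAt hmass (hs.2 : (0 : ℝ) ≤ s)
  simp only [measure_univ, mul_one]

/-- Conservation of mass makes the time marginal independent of the solution. -/
theorem map_fst_discounted (h : Setup ε Tmin LM K₀ C₀ T φ)
    (hmass : ∫⁻ z, ENNReal.ofReal (hopfCole ε φ 0 z.1 z.2) ∂(phaseMeasure d U) = 1) :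
    (discounted (hopfCole ε φ)).map Prod.fst = expLaw := by
  ext A hA
  rw [Measure.map_apply measurable_fst hA, ← prod_univ, h.discounted_prod_univ hmass hA]

theorem isProbabilityMeasure_discounted (h : Setup ε Tmin LM K₀ C₀ T φ)
    (hmass : ∫⁻ z, ENNReal.ofReal (hopfCole ε φ 0 z.1 z.2) ∂(phaseMeasure d U) = 1) :
    IsProbabilityMeasure (discounted (hopfCole ε φ)) where
  measure_univ := by
    rw [← univ_prod_univ, h.discounted_prod_univ hmass MeasurableSet.univ, measure_univ]

/-- Tightness: late times are small by the discount, and large `x` at earlier times by the first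
moment. -/
theorem discounted_compl_le (h : Setup ε Tmin LM K₀ C₀ T φ)
    (hmass : ∫⁻ z, ENNReal.ofReal (hopfCole ε φ 0 z.1 z.2) ∂(phaseMeasure d U) = 1) {M : ℝ}
    (hmom : ∫⁻ z, ENNReal.ofReal (‖z.1‖ * hopfCole ε φ 0 z.1 z.2) ∂(phaseMeasure d U)
      ≤ ENNReal.ofReal M) {t r : ℝ} (hr : 0 < r) :
    discounted (hopfCole ε φ) (Icc 0 t ×ˢ (Metric.closedBall 0 (U * t + r) ×ˢ univ))ᶜ
      ≤ ENNReal.ofReal (Real.exp (-t)) + ENNReal.ofReal (M / r) := by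
  have hS : MeasurableSet {z : Space d × Vel d U | U * t + r < ‖z.1‖} :=
    measurableSet_lt (by fun_prop) (by fun_prop)
  have hsub : (Icc 0 t ×ˢ (Metric.closedBall (0 : Space d) (U * t + r) ×ˢ (univ : Set (Vel d U))))ᶜ
      ⊆ ((Icc 0 t)ᶜ ×ˢ univ) ∪ (Icc 0 t ×ˢ {z | U * t + r < ‖z.1‖}) := by
    rintro ⟨s, x, w⟩ hz
    by_cases hs : s ∈ Icc 0 t
    · refine Or.inr ⟨hs, ?_⟩
      by_contra hx
      exact hz ⟨hs, by simpa using hx, mem_univ _⟩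
    · exact Or.inl ⟨hs, mem_univ _⟩
  refine (measure_mono hsub).trans ((measure_union_le _ _).trans (add_le_add ?_ ?_))
  · rw [h.discounted_prod_univ hmass measurableSet_Icc.compl]
    exact expLaw_compl_Icc_le t
  · rw [h.discounted_prod measurableSet_Icc hS]
    calc ∫⁻ s in Icc 0 t ∩ Ici 0, ENNReal.ofReal (Real.exp (-s)) *
          measureAt (hopfCole ε φ) s {z | U * t + r < ‖z.1‖}
        ≤ ∫⁻ s in Icc 0 t ∩ Ici 0, ENNReal.ofReal (Real.exp (-s)) * ENNReal.ofReal (M / r) := by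
          refine setLIntegral_mono' (measurableSet_Icc.inter measurableSet_Ici) fun s hs => ?_
          refine mul_le_mul' le_rfl (le_trans (measure_mono fun z hz => ?_)
            (h.measureAt_tail_le hmom hs.2 hr))
          have h1 := mul_le_mul_of_nonneg_left hs.1.2 h.speed_pos.le
          have h2 : U * t + r < ‖z.1‖ := hz
          change U * s + r < ‖z.1‖
          linarith
      _ = expLaw (Icc 0 t) * ENNReal.ofReal (M / r) := by
          rw [lintegral_mul_const' _ _ ENNReal.ofReal_ne_top, expLaw_apply measurableSet_Icc]
      _ ≤ 1 * ENNReal.ofReal (M / r) := by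
          gcongr
          exact prob_le_one
      _ = _ := one_mul _

theorem measureUpTo_eq (h : Setup ε Tmin LM K₀ C₀ T φ) (t : ℝ) :
    measureUpTo (hopfCole ε φ) t = ((discounted (hopfCole ε φ)).restrict
      (Icc 0 t ×ˢ univ)).withDensity fun z => ENNReal.ofReal (Real.exp z.1) := by
  have hm : Measurable fun z : ℝ × Space d × Vel d U =>
      ENNReal.ofReal (Real.exp (-z.1)) * ENNReal.ofReal (hopfCole ε φ (max z.1 0) z.2.1 z.2.2) :=
    Measurable.mul (by fun_prop) h.measurable_phase.ennreal_ofReal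
  have hS : MeasurableSet (Icc 0 t ×ˢ (univ : Set (Space d × Vel d U))) :=
    measurableSet_Icc.prod MeasurableSet.univ
  have e : (volume : Measure ℝ).restrict (Icc 0 t)
      = ((volume : Measure ℝ).restrict (Ici 0)).restrict (Icc 0 t) := by
    rw [Measure.restrict_restrict measurableSet_Icc, inter_eq_left.2 Icc_subset_Ici_self]
  rw [discounted, restrict_withDensity hS, ← withDensity_mul _ hm (by fun_prop), measureUpTo, e,
    Measure.restrict_prod_eq_prod_univ]
  refine withDensity_congr_ae ?_
  filter_upwards [ae_restrict_mem hS] with z hz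
  rw [Pi.mul_apply, max_eq_left hz.1.1, mul_right_comm, ← ENNReal.ofReal_mul (Real.exp_pos _).le,
    ← Real.exp_add, neg_add_cancel, Real.exp_zero, ENNReal.ofReal_one, one_mul]

end Setup


/-! ### Passing to the limit on bounded time intervals -/

section Cutoff

variable {Y : Type*} [TopologicalSpace Y] [MeasurableSpace Y]

/-- A continuous function of time that is `1` up to time `t` and `0` after time `t + δ`. -/
noncomputable def timeCutoff (t δ s : ℝ) : ℝ := max 0 (min 1 (1 - (s - t) / δ))

theorem timeCutoff_nonneg (t δ s : ℝ) : 0 ≤ timeCutoff t δ s := le_max_left _ _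

theorem timeCutoff_le_one (t δ s : ℝ) : timeCutoff t δ s ≤ 1 :=
  max_le zero_le_one (min_le_left _ _)

theorem timeCutoff_of_le {t δ s : ℝ} (hδ : 0 < δ) (hs : s ≤ t) : timeCutoff t δ s = 1 := by
  have : (s - t) / δ ≤ 0 := div_nonpos_of_nonpos_of_nonneg (by linarith) hδ.le
  rw [timeCutoff, min_eq_left (by linarith), max_eq_right zero_le_one]

theorem timeCutoff_of_ge {t δ s : ℝ} (hδ : 0 < δ) (hs : t + δ ≤ s) : timeCutoff t δ s = 0 := by
  have : 1 ≤ (s - t) / δ := (one_le_div hδ).2 (by linarith)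
  rw [timeCutoff, max_eq_left ((min_le_right _ _).trans (by linarith))]

theorem continuous_timeCutoff (t δ : ℝ) : Continuous (timeCutoff t δ) := by
  unfold timeCutoff; fun_prop

/-- Multiplication of a bounded continuous function by the time cutoff. -/
noncomputable def cutoff (t δ : ℝ) (g : ℝ × Y →ᵇ ℝ) : ℝ × Y →ᵇ ℝ :=
  BoundedContinuousFunction.ofNormedAddCommGroup (fun z => timeCutoff t δ z.1 * g z)
    (((continuous_timeCutoff t δ).comp continuous_fst).mul g.continuous) ‖g‖ fun z => by
      rw [norm_mul, Real.norm_of_nonneg (timeCutoff_nonneg _ _ _)]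
      calc timeCutoff t δ z.1 * ‖g z‖ ≤ 1 * ‖g‖ :=
            mul_le_mul (timeCutoff_le_one _ _ _) (g.norm_coe_le_norm z) (norm_nonneg _) zero_le_one
        _ = ‖g‖ := one_mul _

/-- The indicator of a time interval is no admissible test function. Replacing it by a cutoff costs
at most the mass near its end, which the time marginal bounds by `δ`. -/
theorem abs_setIntegral_sub_cutoff_le [OpensMeasurableSpace (ℝ × Y)] {m : Measure (ℝ × Y)} [IsFiniteMeasure m]
    (hm : m.map Prod.fst = expLaw) (g : ℝ × Y →ᵇ ℝ) (t : ℝ) {δ : ℝ} (hδ : 0 < δ) :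
    |∫ z in Icc 0 t ×ˢ univ, g z ∂m - ∫ z, cutoff t δ g z ∂m| ≤ δ * ‖g‖ := by
  have hS : MeasurableSet (Icc 0 t ×ˢ (univ : Set Y)) := measurableSet_Icc.prod MeasurableSet.univ
  -- At negative times the cutoff is one and the indicator zero, but `expLaw` does not charge them.
  set A : Set ℝ := Iio 0 ∪ Ioo t (t + δ) with hA
  have hAm : MeasurableSet A := measurableSet_Iio.union measurableSet_Ioo
  have hAm' : MeasurableSet (Prod.fst ⁻¹' A : Set (ℝ × Y)) := measurable_fst hAm
  have hmA : m (Prod.fst ⁻¹' A) ≤ ENNReal.ofReal δ := by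
    rw [← Measure.map_apply measurable_fst hAm, hm]
    refine (expLaw_le_volume hAm).trans ((measure_mono ?_).trans (b := volume (Ioo t (t + δ))) ?_)
    · rintro s ⟨hs | hs, hs0⟩
      · have h1 : s < 0 := hs
        have h2 : 0 ≤ s := hs0
        linarith
      · exact hs
    · rw [Real.volume_Ioo, add_sub_cancel_left]
  have hint : Integrable g m := g.integrable m
  rw [← integral_indicator hS, ← integral_sub (hint.indicator hS) ((cutoff t δ g).integrable m),
    ← Real.norm_eq_abs]
  calc ‖∫ z, ((Icc 0 t ×ˢ univ).indicator (fun z => g z) z - cutoff t δ g z) ∂m‖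
      ≤ ∫ z, (Prod.fst ⁻¹' A).indicator (fun _ => ‖g‖) z ∂m := by
        refine norm_integral_le_of_norm_le ((integrable_const _).indicator hAm')
          (Eventually.of_forall fun z => ?_)
        change ‖(Icc 0 t ×ˢ univ).indicator (fun z => g z) z - timeCutoff t δ z.1 * g z‖ ≤ _
        by_cases hz : z.1 ∈ Icc 0 t
        · rw [indicator_of_mem (show z ∈ Icc 0 t ×ˢ (univ : Set Y) from ⟨hz, mem_univ _⟩),
            timeCutoff_of_le hδ hz.2, one_mul, sub_self, norm_zero]
          exact indicator_nonneg (fun _ _ => norm_nonneg _) _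
        · rw [indicator_of_notMem fun h : z ∈ Icc 0 t ×ˢ (univ : Set Y) => hz h.1, zero_sub,
            norm_neg]
          by_cases hzA : z.1 ∈ A
          · rw [indicator_of_mem (show z ∈ Prod.fst ⁻¹' A from hzA)]
            exact (cutoff t δ g).norm_coe_le_norm z |>.trans
              (BoundedContinuousFunction.norm_ofNormedAddCommGroup_le _ (norm_nonneg _) _)
          · have h1 : ¬ z.1 < 0 := fun h => hzA (Or.inl h)
            have h2 : t < z.1 := by
              by_contra h
              exact hz ⟨not_lt.1 h1, not_lt.1 h⟩
            have h3 : t + δ ≤ z.1 := by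
              by_contra h
              exact hzA (Or.inr ⟨h2, not_le.1 h⟩)
            rw [timeCutoff_of_ge hδ h3, zero_mul, norm_zero]
            exact indicator_nonneg (fun _ _ => norm_nonneg _) _
    _ = m.real (Prod.fst ⁻¹' A) * ‖g‖ := by
        rw [integral_indicator hAm', setIntegral_const, smul_eq_mul]
    _ ≤ δ * ‖g‖ := by
        refine mul_le_mul_of_nonneg_right ?_ (norm_nonneg _)
        exact ENNReal.toReal_le_of_le_ofReal hδ.le hmA

theorem tendsto_setIntegral_of_convergesWeakly [OpensMeasurableSpace (ℝ × Y)]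
    {m : ℕ → Measure (ℝ × Y)} {ν : Measure (ℝ × Y)}
    (h : ConvergesWeakly m ν) (hm : ∀ k, IsFiniteMeasure (m k)) [IsFiniteMeasure ν]
    (hm' : ∀ k, (m k).map Prod.fst = expLaw) (hν : ν.map Prod.fst = expLaw) (g : ℝ × Y →ᵇ ℝ)
    (t : ℝ) :
    Tendsto (fun k => ∫ z in Icc 0 t ×ˢ univ, g z ∂(m k)) atTop
      (𝓝 (∫ z in Icc 0 t ×ˢ univ, g z ∂ν)) := by
  rw [Metric.tendsto_nhds]
  intro η hη
  set δ := η / (3 * (‖g‖ + 1)) with hδ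
  have hg : 0 ≤ ‖g‖ := norm_nonneg g
  have hδ0 : 0 < δ := by positivity
  have hδg : δ * ‖g‖ ≤ η / 3 := by
    have e : δ * (‖g‖ + 1) = η / 3 := by rw [hδ]; field_simp
    have := mul_le_mul_of_nonneg_left (show ‖g‖ ≤ ‖g‖ + 1 by linarith) hδ0.le
    linarith
  filter_upwards [(Metric.tendsto_nhds.1 (h (cutoff t δ g))) (η / 3) (by positivity)] with k hk
  have h1 := abs_setIntegral_sub_cutoff_le (hm' k) g t hδ0
  have h2 := abs_setIntegral_sub_cutoff_le hν g t hδ0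
  rw [Real.dist_eq] at hk ⊢
  rw [abs_le] at h1 h2
  rw [abs_lt] at hk ⊢
  constructor <;> linarith [h1.1, h1.2, h2.1, h2.2, hk.1, hk.2]

/-- The function `e^{min s t} g`. -/
noncomputable def expWeight (t : ℝ) (g : ℝ × Y →ᵇ ℝ) : ℝ × Y →ᵇ ℝ :=
  BoundedContinuousFunction.ofNormedAddCommGroup (fun z => Real.exp (min z.1 t) * g z)
    ((by fun_prop : Continuous fun z : ℝ × Y => Real.exp (min z.1 t)).mul g.continuous)
    (Real.exp t * ‖g‖) fun z => by
      rw [norm_mul, Real.norm_of_nonneg (Real.exp_pos _).le]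
      exact mul_le_mul (Real.exp_le_exp.2 (min_le_right _ _)) (g.norm_coe_le_norm z)
        (norm_nonneg _) (Real.exp_pos _).le

theorem integral_withDensity_exp (m : Measure (ℝ × Y)) (g : ℝ × Y →ᵇ ℝ) (t : ℝ) :
    ∫ z, g z ∂((m.restrict (Icc 0 t ×ˢ univ)).withDensity fun z => ENNReal.ofReal (Real.exp z.1))
      = ∫ z in Icc 0 t ×ˢ univ, expWeight t g z ∂m := by
  rw [integral_withDensity_eq_integral_toReal_smul (by fun_prop)
    (Eventually.of_forall fun _ => ENNReal.ofReal_lt_top)]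
  refine setIntegral_congr_fun (measurableSet_Icc.prod MeasurableSet.univ) fun z hz => ?_
  change (ENNReal.ofReal (Real.exp z.1)).toReal • g z = Real.exp (min z.1 t) * g z
  rw [ENNReal.toReal_ofReal (Real.exp_pos _).le, min_eq_left hz.1.2, smul_eq_mul]

end Cutoff

/-! ### Removing the time discount from the limit measure -/

section Undiscounted

variable {Y : Type*} [MeasurableSpace Y]

/-- The limit measure with the time discount removed, on the horizon `[0,τ)`. -/
noncomputable def undiscounted (τ : ℝ≥0∞) (m : Measure (ℝ × Y)) : Measure (ℝ × Y) :=
  (m.restrict {z | 0 ≤ z.1 ∧ ENNReal.ofReal z.1 < τ}).withDensity fun z =>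
    ENNReal.ofReal (Real.exp z.1)

theorem undiscounted_restrict {τ : ℝ≥0∞} {m : Measure (ℝ × Y)} {t : ℝ}
    (ht : ENNReal.ofReal t < τ) :
    (undiscounted τ m).restrict (Icc 0 t ×ˢ univ) = (m.restrict (Icc 0 t ×ˢ univ)).withDensity
      fun z => ENNReal.ofReal (Real.exp z.1) := by
  have hS : MeasurableSet (Icc 0 t ×ˢ (univ : Set Y)) := measurableSet_Icc.prod MeasurableSet.univ
  rw [undiscounted, restrict_withDensity hS, Measure.restrict_restrict hS, inter_eq_left.2]
  exact fun z hz => ⟨hz.1.1, (ENNReal.ofReal_le_ofReal hz.1.2).trans_lt ht⟩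

theorem undiscounted_prod_univ {τ : ℝ≥0∞} {m : Measure (ℝ × Y)} (hm : m.map Prod.fst = expLaw)
    {t : ℝ} (ht : ENNReal.ofReal t < τ) :
    undiscounted τ m (Icc 0 t ×ˢ univ) = ENNReal.ofReal t := by
  have e := undiscounted_restrict (m := m) ht
  have h1 : undiscounted τ m (Icc 0 t ×ˢ univ)
      = ((undiscounted τ m).restrict (Icc 0 t ×ˢ univ)) univ := by
    rw [Measure.restrict_apply_univ]
  rw [h1, e, withDensity_apply _ MeasurableSet.univ, Measure.restrict_univ,
    ← lintegral_exp_expLaw (t := t), ← hm,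
    setLIntegral_map measurableSet_Icc (by fun_prop) measurable_fst, prod_univ]

theorem undiscounted_null {τ : ℝ≥0∞} {m : Measure (ℝ × Y)} {S : Set (ℝ × Y)}
    (hS : m ({z | 0 ≤ z.1 ∧ ENNReal.ofReal z.1 < τ} ∩ S) = 0) : undiscounted τ m S = 0 := by
  refine withDensity_absolutelyContinuous _ _ ?_
  have hA : MeasurableSet {z : ℝ × Y | 0 ≤ z.1 ∧ ENNReal.ofReal z.1 < τ} :=
    (measurableSet_le measurable_const measurable_fst).inter
      (measurableSet_lt measurable_fst.ennreal_ofReal measurable_const)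
  rw [Measure.restrict_apply' hA, inter_comm]
  exact hS

end Undiscounted

/-! ### Limits of the kinetic measures -/

section Limits

variable {ε : ℕ → ℝ} {Tmin LM : ℝ} {K₀ : ℝ≥0} {C₀ : ℝ} {T : ℕ → Space d → Vel d U → ℝ}
  {ψ : ℕ → ℝ → Space d → Vel d U → ℝ}

theorem tendsto_exp_neg_add_div (M : ℝ) :
    Tendsto (fun n : ℕ => ENNReal.ofReal (Real.exp (-(n : ℝ))) + ENNReal.ofReal (M / n)) atTop
      (𝓝 0) := by
  have h1 : Tendsto (fun n : ℕ => Real.exp (-(n : ℝ))) atTop (𝓝 0) :=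
    Real.tendsto_exp_neg_atTop_nhds_zero.comp tendsto_natCast_atTop_atTop
  have h2 : Tendsto (fun n : ℕ => M / (n : ℝ)) atTop (𝓝 0) :=
    tendsto_const_nhds.div_atTop tendsto_natCast_atTop_atTop
  simpa using (ENNReal.tendsto_ofReal h1).add (ENNReal.tendsto_ofReal h2)

theorem exists_subseq_discounted (hS : ∀ k, Setup (ε k) Tmin LM K₀ C₀ (T k) (ψ k))
    (hmass : ∀ k, ∫⁻ z, ENNReal.ofReal (hopfCole (ε k) (ψ k) 0 z.1 z.2) ∂(phaseMeasure d U) = 1)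
    {M : ℝ} (hmom : ∀ k, ∫⁻ z, ENNReal.ofReal (‖z.1‖ * hopfCole (ε k) (ψ k) 0 z.1 z.2)
      ∂(phaseMeasure d U) ≤ ENNReal.ofReal M) :
    ∃ (θ : ℕ → ℕ) (m : Measure (ℝ × Space d × Vel d U)), StrictMono θ ∧ IsProbabilityMeasure m ∧
      ConvergesWeakly (fun k => discounted (hopfCole (ε (θ k)) (ψ (θ k)))) m := by
  refine exists_subseq_convergesWeakly (m := fun k => discounted (hopfCole (ε k) (ψ k)))
    (fun k => (hS k).isProbabilityMeasure_discounted (hmass k)) fun δ hδ => ?_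
  obtain ⟨n, hn, hn0⟩ := (((tendsto_exp_neg_add_div M).eventually_le_const hδ).and
    (eventually_gt_atTop 0)).exists
  exact ⟨_, isCompact_Icc.prod ((isCompact_closedBall 0 (U * n + n)).prod isCompact_univ),
    fun k => ((hS k).discounted_compl_le (hmass k) (hmom k) (Nat.cast_pos.2 hn0)).trans hn⟩

theorem exists_subseq_measureAt (hS : ∀ k, Setup (ε k) Tmin LM K₀ C₀ (T k) (ψ k))
    (hmass : ∀ k, ∫⁻ z, ENNReal.ofReal (hopfCole (ε k) (ψ k) 0 z.1 z.2) ∂(phaseMeasure d U) = 1)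
    {M : ℝ} (hmom : ∀ k, ∫⁻ z, ENNReal.ofReal (‖z.1‖ * hopfCole (ε k) (ψ k) 0 z.1 z.2)
      ∂(phaseMeasure d U) ≤ ENNReal.ofReal M) {t : ℝ} (ht : 0 ≤ t) :
    ∃ (θ : ℕ → ℕ) (m : Measure (Space d × Vel d U)), StrictMono θ ∧ IsProbabilityMeasure m ∧
      ConvergesWeakly (fun k => measureAt (hopfCole (ε (θ k)) (ψ (θ k))) t) m := by
  refine exists_subseq_convergesWeakly (m := fun k => measureAt (hopfCole (ε k) (ψ k)) t)
    (fun k => (hS k).isProbabilityMeasure_measureAt (hmass k) ht) fun δ hδ => ?_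
  obtain ⟨n, hn, hn0⟩ := (((tendsto_exp_neg_add_div M).eventually_le_const hδ).and
    (eventually_gt_atTop 0)).exists
  refine ⟨_, (isCompact_closedBall 0 (U * t + n)).prod isCompact_univ, fun k =>
    le_trans (measure_mono fun z hz => ?_)
      (((hS k).measureAt_tail_le (hmom k) ht (Nat.cast_pos.2 hn0)).trans (le_add_self.trans hn))⟩
  change U * t + n < ‖z.1‖
  by_contra h
  exact hz ⟨by simpa using h, mem_univ _⟩

/-- Test functions of time alone have constant integrals along the sequence, so the marginal passes
to the limit. It later gives the mass `t` of `[0,t]` after undoing the discount. -/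
theorem map_fst_of_convergesWeakly (hS : ∀ k, Setup (ε k) Tmin LM K₀ C₀ (T k) (ψ k))
    (hmass : ∀ k, ∫⁻ z, ENNReal.ofReal (hopfCole (ε k) (ψ k) 0 z.1 z.2) ∂(phaseMeasure d U) = 1)
    {m : Measure (ℝ × Space d × Vel d U)} [IsProbabilityMeasure m]
    (hm : ConvergesWeakly (fun k => discounted (hopfCole (ε k) (ψ k))) m) :
    m.map Prod.fst = expLaw := by
  have := Measure.isProbabilityMeasure_map (μ := m) (measurable_fst (α := ℝ)).aemeasurable
  refine ext_of_forall_integral_eq_of_IsFiniteMeasure fun g => ?_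
  have hmap : ∀ n : Measure (ℝ × Space d × Vel d U), ∫ s, g s ∂(n.map Prod.fst)
      = ∫ z, (g.compContinuous ⟨Prod.fst, continuous_fst⟩) z ∂n := fun n =>
    integral_map measurable_fst.aemeasurable g.continuous.measurable.aestronglyMeasurable
  have h1 := hm (g.compContinuous ⟨Prod.fst, continuous_fst⟩)
  simp_rw [← hmap, fun k => (hS k).map_fst_discounted (hmass k)] at h1
  exact tendsto_nhds_unique h1 tendsto_const_nhds

theorem convergesWeakly_measureUpTo (hS : ∀ k, Setup (ε k) Tmin LM K₀ C₀ (T k) (ψ k))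
    (hmass : ∀ k, ∫⁻ z, ENNReal.ofReal (hopfCole (ε k) (ψ k) 0 z.1 z.2) ∂(phaseMeasure d U) = 1)
    {m : Measure (ℝ × Space d × Vel d U)} [IsProbabilityMeasure m]
    (hm : ConvergesWeakly (fun k => discounted (hopfCole (ε k) (ψ k))) m) {τ : ℝ≥0∞} {t : ℝ}
    (ht : ENNReal.ofReal t < τ) :
    ConvergesWeakly (fun k => measureUpTo (hopfCole (ε k) (ψ k)) t)
      ((undiscounted τ m).restrict (Icc 0 t ×ˢ univ)) := by
  intro g
  simp_rw [fun k => (hS k).measureUpTo_eq t, undiscounted_restrict ht, integral_withDensity_exp]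
  refine tendsto_setIntegral_of_convergesWeakly hm (fun k => ?_)
    (fun k => (hS k).map_fst_discounted (hmass k)) (map_fst_of_convergesWeakly hS hmass hm) _ t
  have := (hS k).isProbabilityMeasure_discounted (hmass k)
  infer_instance

theorem tendsto_ofReal_exp_neg_div (hε : ∀ k, 0 < ε k) (hε0 : Tendsto ε atTop (𝓝 0)) {c : ℝ}
    (hc : 0 < c) : Tendsto (fun k => ENNReal.ofReal (Real.exp (-(c / ε k)))) atTop (𝓝 0) := by
  have h0 : Tendsto ε atTop (𝓝[>] 0) :=
    tendsto_nhdsWithin_iff.2 ⟨hε0, Eventually.of_forall hε⟩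
  have h1 : Tendsto (fun k => c / ε k) atTop atTop := by
    simp_rw [div_eq_mul_inv]
    exact (tendsto_inv_nhdsGT_zero.comp h0).const_mul_atTop hc
  simpa using ENNReal.tendsto_ofReal (Real.tendsto_exp_neg_atTop_nhds_zero.comp h1)

theorem phaseMeasure_ball_ne_top (x : Space d) (r : ℝ) :
    phaseMeasure d U (Metric.ball x r ×ˢ univ) ≠ ⊤ := by
  rw [phaseMeasure, Measure.prod_prod]
  exact ENNReal.mul_ne_top measure_ball_lt_top.ne (measure_ne_top _ _)

theorem phaseMeasure_ball_pos (hd : 0 < d) (hU : 0 < U) (x : Space d) {r : ℝ} (hr : 0 < r) :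
    0 < phaseMeasure d U (Metric.ball x r ×ˢ univ) := by
  have := isOpenPosMeasure_velMeasure (d := d) hU
  have := nonempty_vel hd hU
  rw [phaseMeasure, Measure.prod_prod]
  exact ENNReal.mul_pos (Metric.measure_ball_pos _ _ hr).ne' (isOpen_univ.measure_pos _ univ_nonempty).ne'

theorem measureAt_ball_le {ε : ℝ} (hε : 0 < ε) {φ : ℝ → Space d → Vel d U → ℝ} {c s r : ℝ}
    {x₀ : Space d} (h : ∀ x ∈ Metric.ball x₀ r, ∀ w, c ≤ φ s x w) :
    measureAt (hopfCole ε φ) s (Metric.ball x₀ r ×ˢ univ)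
      ≤ ENNReal.ofReal (Real.exp (-(c / ε))) * phaseMeasure d U (Metric.ball x₀ r ×ˢ univ) := by
  have hB : MeasurableSet (Metric.ball x₀ r ×ˢ (univ : Set (Vel d U))) :=
    Metric.isOpen_ball.measurableSet.prod MeasurableSet.univ
  rw [measureAt, withDensity_apply _ hB, ← setLIntegral_const]
  refine setLIntegral_mono' hB fun z hz => ENNReal.ofReal_le_ofReal (Real.exp_le_exp.2 ?_)
  rw [neg_div, neg_le_neg_iff]
  exact div_le_div_of_nonneg_right (h z.1 hz.1 z.2) hε.le

theorem le_measureAt_ball {ε : ℝ} (hε : 0 < ε) {φ : ℝ → Space d → Vel d U → ℝ} {c s r : ℝ}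
    {x₀ : Space d} (h : ∀ x ∈ Metric.ball x₀ r, ∀ w, φ s x w ≤ c) :
    ENNReal.ofReal (Real.exp (-(c / ε))) * phaseMeasure d U (Metric.ball x₀ r ×ˢ univ)
      ≤ measureAt (hopfCole ε φ) s (Metric.ball x₀ r ×ˢ univ) := by
  have hB : MeasurableSet (Metric.ball x₀ r ×ˢ (univ : Set (Vel d U))) :=
    Metric.isOpen_ball.measurableSet.prod MeasurableSet.univ
  rw [measureAt, withDensity_apply _ hB, ← setLIntegral_const]
  refine setLIntegral_mono' hB fun z hz => ENNReal.ofReal_le_ofReal (Real.exp_le_exp.2 ?_)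
  rw [neg_div, neg_le_neg_iff]
  exact div_le_div_of_nonneg_right (h z.1 hz.1 z.2) hε.le

variable {u : ℝ → Space d → ℝ}

theorem ConvergesOnBounded.eventually_near (hu : ConvergesOnBounded ψ u)
    (hcont : ContinuousOn (fun z : ℝ × Space d => u z.1 z.2) {z | 0 ≤ z.1}) {t : ℝ} (ht : 0 ≤ t)
    (x₀ : Space d) {c : ℝ} (hc : 0 < c) :
    ∃ r > 0, ∀ᶠ k in atTop, ∀ s, 0 ≤ s → |s - t| < r → ∀ x ∈ Metric.ball x₀ r, ∀ w,
      |ψ k s x w - u t x₀| ≤ c := by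
  obtain ⟨r, hr, h⟩ := Metric.continuousOn_iff.1 hcont (t, x₀) ht (c / 2) (by positivity)
  refine ⟨r, hr, ?_⟩
  filter_upwards [hu (t + r) (‖x₀‖ + r) (c / 2) (by positivity)] with k hk s hs hst x hx w
  have hx' : dist x x₀ < r := hx
  have h1 := h (s, x) hs (by
    rw [Prod.dist_eq]
    exact max_lt (by rw [Real.dist_eq]; exact hst) hx')
  rw [Real.dist_eq] at h1
  have h2 := hk s ⟨hs, by linarith [(abs_lt.1 hst).2]⟩ x (by
    have : ‖x‖ ≤ ‖x₀‖ + ‖x - x₀‖ := by simpa using norm_add_le x₀ (x - x₀)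
    rw [dist_eq_norm] at hx'
    linarith) w
  have e : ψ k s x w - u t x₀ = (ψ k s x w - u s x) + (u s x - u t x₀) := by ring
  rw [e]
  exact (abs_add_le _ _).trans (by linarith [h1])

/-- If `u` were negative at a point, `f` would be at least `exp (c/ε)` on a fixed ball, whose mass
would eventually exceed one. -/
theorem limit_nonneg (hS : ∀ k, Setup (ε k) Tmin LM K₀ C₀ (T k) (ψ k))
    (hε0 : Tendsto ε atTop (𝓝 0))
    (hmass : ∀ k, ∫⁻ z, ENNReal.ofReal (hopfCole (ε k) (ψ k) 0 z.1 z.2) ∂(phaseMeasure d U) = 1)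
    (hu : ConvergesOnBounded ψ u)
    (hcont : ContinuousOn (fun z : ℝ × Space d => u z.1 z.2) {z | 0 ≤ z.1}) {t : ℝ} (ht : 0 ≤ t)
    (x₀ : Space d) : 0 ≤ u t x₀ := by
  by_contra! hneg
  set c := -(u t x₀) / 2 with hc
  have hc0 : 0 < c := by linarith
  obtain ⟨r, hr, hev⟩ := hu.eventually_near hcont ht x₀ hc0
  have hpos := phaseMeasure_ball_pos (hS 0).dim_pos (hS 0).speed_pos x₀ hr
  have hlim := tendsto_ofReal_exp_neg_div (fun k => (hS k).eps_pos) hε0 hc0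
  refine not_le.2 hpos (ge_of_tendsto hlim ?_)
  filter_upwards [hev] with k hk
  have := (hS k).isProbabilityMeasure_measureAt (hmass k) ht
  have h1 : ENNReal.ofReal (Real.exp (-(-c / ε k))) * phaseMeasure d U (Metric.ball x₀ r ×ˢ univ)
      ≤ 1 := (le_measureAt_ball (hS k).eps_pos fun x hx w => by
    have := (abs_le.1 (hk t ht (by simpa using hr) x hx w)).2
    linarith).trans prob_le_one
  calc phaseMeasure d U (Metric.ball x₀ r ×ˢ univ)
      = ENNReal.ofReal (Real.exp (-(c / ε k))) * (ENNReal.ofReal (Real.exp (-(-c / ε k))) *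
          phaseMeasure d U (Metric.ball x₀ r ×ˢ univ)) := by
        rw [← mul_assoc, ← ENNReal.ofReal_mul (Real.exp_pos _).le, ← Real.exp_add, neg_div,
          neg_neg, neg_add_cancel, Real.exp_zero, ENNReal.ofReal_one, one_mul]
    _ ≤ ENNReal.ofReal (Real.exp (-(c / ε k))) * 1 := mul_le_mul' le_rfl h1
    _ = _ := mul_one _

/-- Off the zero set `u` is positive, so `f` is at most `exp (-c/ε)` on a small ball; the ball has
finite volume, hence vanishing mass. -/
theorem measureAt_limit_null (hS : ∀ k, Setup (ε k) Tmin LM K₀ C₀ (T k) (ψ k))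
    (hε0 : Tendsto ε atTop (𝓝 0))
    (hmass : ∀ k, ∫⁻ z, ENNReal.ofReal (hopfCole (ε k) (ψ k) 0 z.1 z.2) ∂(phaseMeasure d U) = 1)
    (hu : ConvergesOnBounded ψ u)
    (hcont : ContinuousOn (fun z : ℝ × Space d => u z.1 z.2) {z | 0 ≤ z.1}) {t : ℝ} (ht : 0 ≤ t)
    {ν : Measure (Space d × Vel d U)} (hν : IsProbabilityMeasure ν)
    (hlim : ConvergesWeakly (fun k => measureAt (hopfCole (ε k) (ψ k)) t) ν) :
    ν {z | u t z.1 = 0}ᶜ = 0 := by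
  refine hlim.measure_eq_zero_of_locally
    (fun k => (hS k).isProbabilityMeasure_measureAt (hmass k) ht) hν fun z hz => ?_
  have hpos : 0 < u t z.1 := lt_of_le_of_ne (limit_nonneg hS hε0 hmass hu hcont ht z.1) (Ne.symm hz)
  obtain ⟨r, hr, hev⟩ := hu.eventually_near hcont ht z.1 (half_pos hpos)
  refine ⟨Metric.ball z.1 r ×ˢ univ, Metric.isOpen_ball.prod isOpen_univ,
    ⟨Metric.mem_ball_self hr, mem_univ _⟩, ?_⟩
  have h1 : Tendsto (fun k => ENNReal.ofReal (Real.exp (-(u t z.1 / 2 / ε k))) *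
      phaseMeasure d U (Metric.ball z.1 r ×ˢ univ)) atTop (𝓝 0) := by
    simpa using ENNReal.Tendsto.mul_const
      (tendsto_ofReal_exp_neg_div (fun k => (hS k).eps_pos) hε0 (half_pos hpos))
      (Or.inr (phaseMeasure_ball_ne_top (U := U) z.1 r))
  refine tendsto_of_tendsto_of_tendsto_of_le_of_le' tendsto_const_nhds h1
    (Eventually.of_forall fun _ => zero_le) ?_
  filter_upwards [hev] with k hk
  refine measureAt_ball_le (hS k).eps_pos fun x hx w => ?_
  have := (abs_le.1 (hk t ht (by simpa using hr) x hx w)).1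
  linarith

theorem discounted_limit_null (hS : ∀ k, Setup (ε k) Tmin LM K₀ C₀ (T k) (ψ k))
    (hε0 : Tendsto ε atTop (𝓝 0))
    (hmass : ∀ k, ∫⁻ z, ENNReal.ofReal (hopfCole (ε k) (ψ k) 0 z.1 z.2) ∂(phaseMeasure d U) = 1)
    (hu : ConvergesOnBounded ψ u)
    (hcont : ContinuousOn (fun z : ℝ × Space d => u z.1 z.2) {z | 0 ≤ z.1})
    {m : Measure (ℝ × Space d × Vel d U)} (hm : IsProbabilityMeasure m)
    (hlim : ConvergesWeakly (fun k => discounted (hopfCole (ε k) (ψ k))) m) :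
    m {z | 0 ≤ z.1 ∧ u z.1 z.2.1 ≠ 0} = 0 := by
  refine hlim.measure_eq_zero_of_locally
    (fun k => (hS k).isProbabilityMeasure_discounted (hmass k)) hm fun z hz => ?_
  obtain ⟨ht, hz⟩ := hz
  set t := z.1 with ht'
  set x₀ := z.2.1 with hx₀
  have hpos : 0 < u t x₀ := lt_of_le_of_ne (limit_nonneg hS hε0 hmass hu hcont ht x₀) (Ne.symm hz)
  obtain ⟨r, hr, hev⟩ := hu.eventually_near hcont ht x₀ (half_pos hpos)
  have hB : MeasurableSet (Metric.ball x₀ r ×ˢ (univ : Set (Vel d U))) :=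
    Metric.isOpen_ball.measurableSet.prod MeasurableSet.univ
  refine ⟨Metric.ball t r ×ˢ (Metric.ball x₀ r ×ˢ univ),
    Metric.isOpen_ball.prod (Metric.isOpen_ball.prod isOpen_univ),
    ⟨Metric.mem_ball_self hr, Metric.mem_ball_self hr, mem_univ _⟩, ?_⟩
  have h1 : Tendsto (fun k => ENNReal.ofReal (Real.exp (-(u t x₀ / 2 / ε k))) *
      phaseMeasure d U (Metric.ball x₀ r ×ˢ univ)) atTop (𝓝 0) := by
    simpa using ENNReal.Tendsto.mul_const
      (tendsto_ofReal_exp_neg_div (fun k => (hS k).eps_pos) hε0 (half_pos hpos))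
      (Or.inr (phaseMeasure_ball_ne_top (U := U) x₀ r))
  refine tendsto_of_tendsto_of_tendsto_of_le_of_le' tendsto_const_nhds h1
    (Eventually.of_forall fun _ => zero_le) ?_
  filter_upwards [hev] with k hk
  have hA : MeasurableSet (Metric.ball t r) := Metric.isOpen_ball.measurableSet
  rw [(hS k).discounted_prod hA hB]
  calc ∫⁻ s in Metric.ball t r ∩ Ici 0, ENNReal.ofReal (Real.exp (-s)) *
        measureAt (hopfCole (ε k) (ψ k)) s (Metric.ball x₀ r ×ˢ univ)
      ≤ ∫⁻ s in Metric.ball t r ∩ Ici 0, ENNReal.ofReal (Real.exp (-s)) *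
        (ENNReal.ofReal (Real.exp (-(u t x₀ / 2 / ε k))) *
          phaseMeasure d U (Metric.ball x₀ r ×ˢ univ)) := by
        refine setLIntegral_mono' (hA.inter measurableSet_Ici) fun s hs => mul_le_mul' le_rfl
          (measureAt_ball_le (hS k).eps_pos fun x hx w => ?_)
        have := (abs_le.1 (hk s hs.2 (by simpa [Real.dist_eq] using hs.1) x hx w)).1
        linarith
    _ = expLaw (Metric.ball t r) * (ENNReal.ofReal (Real.exp (-(u t x₀ / 2 / ε k))) *
          phaseMeasure d U (Metric.ball x₀ r ×ˢ univ)) := by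
        rw [lintegral_mul_const _ (by fun_prop), expLaw_apply hA]
    _ ≤ 1 * (ENNReal.ofReal (Real.exp (-(u t x₀ / 2 / ε k))) *
          phaseMeasure d U (Metric.ball x₀ r ×ˢ univ)) := by
        gcongr
        exact prob_le_one
    _ = _ := one_mul _

end Limits


/-! ### Uniform estimates for a family of solutions -/

section Family

variable {ε₀ Tmin LM : ℝ} {K₀ : ℝ≥0} {C₀ : ℝ} {T : ℝ → Space d → Vel d U → ℝ}
  {φ : ℝ → ℝ → Space d → Vel d U → ℝ}

/-- Uniform limits of turning kernels are turning kernels. -/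
theorem isTurningKernel_limit (hε₀ : 0 < ε₀)
    (hF : ∀ ε ∈ Ioc 0 ε₀, Setup ε Tmin LM K₀ C₀ (T ε) (φ ε)) {T₀ : Space d → Vel d U → ℝ}
    (hlim : TendstoUniformly (fun ε (z : Space d × Vel d U) => T ε z.1 z.2)
      (fun z => T₀ z.1 z.2) (𝓝[>] 0)) : IsTurningKernel Tmin LM T₀ := by
  have h₀ := hF ε₀ ⟨hε₀, le_rfl⟩
  have hev : ∀ᶠ ε in 𝓝[>] 0, ε ∈ Ioc 0 ε₀ := Ioc_mem_nhdsGT hε₀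
  have hpt : ∀ x w, Tendsto (fun ε => T ε x w) (𝓝[>] 0) (𝓝 (T₀ x w)) := fun x w =>
    hlim.tendsto_at (x, w)
  refine ⟨h₀.dim_pos, h₀.speed_pos, h₀.min_pos, fun x => ?_, fun x w => ?_, fun x w => ?_,
    fun x y w => ?_, fun x w w' => ?_⟩
  · have h1 : Tendsto (fun ε => ∫ w, T ε x w ∂(velMeasure d U)) (𝓝[>] 0)
        (𝓝 (∫ w, T₀ x w ∂(velMeasure d U))) := by
      refine tendsto_integral_filter_of_dominated_convergence (fun _ => LM) ?_ ?_
        (integrable_const _) (Eventually.of_forall fun w => hpt x w)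
      · filter_upwards [hev] with ε hε
        exact ((hF ε hε).measurable_T.comp (f := fun w => (x, w)) (by fun_prop)).aestronglyMeasurable
      · filter_upwards [hev] with ε hε
        refine Eventually.of_forall fun w => ?_
        rw [Real.norm_of_nonneg ((hF ε hε).T_pos x w).le]
        exact (hF ε hε).upper x w
    refine tendsto_nhds_unique h1 (tendsto_const_nhds.congr' ?_)
    filter_upwards [hev] with ε hε
    exact ((hF ε hε).prob x).symm
  · exact ge_of_tendsto (hpt x w) (hev.mono fun ε hε => (hF ε hε).lower x w)
  · exact le_of_tendsto (hpt x w) (hev.mono fun ε hε => (hF ε hε).upper x w)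
  · exact le_of_tendsto ((hpt x w).sub (hpt y w)).abs
      (hev.mono fun ε hε => (hF ε hε).lip_x x y w)
  · exact le_of_tendsto ((hpt x w).sub (hpt x w')).abs
      (hev.mono fun ε hε => (hF ε hε).lip_v x w w')

theorem exists_phase_bound_of_init (hε₀ : 0 < ε₀)
    (hF : ∀ ε ∈ Ioc 0 ε₀, Setup ε Tmin LM K₀ C₀ (T ε) (φ ε))
    (h : ∃ M : ℝ, ∀ ε ∈ Ioc 0 ε₀, ∀ x w, |φ ε 0 x w| ≤ M) (t : ℝ) :
    ∃ M : ℝ, ∀ ε ∈ Ioc 0 ε₀, ∀ s ∈ Icc 0 t, ∀ x w, |φ ε s x w| ≤ M := by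
  obtain ⟨M, hM⟩ := h
  refine ⟨M + timeLip d U LM K₀ C₀ * t, fun ε hε s hs x w => ?_⟩
  have h1 := abs_phase_sub_init_le_of_family hε₀ hF t ε hε s hs x w
  have h2 := abs_add_le (φ ε 0 x w) (φ ε s x w - φ ε 0 x w)
  rw [add_sub_cancel] at h2
  linarith [hM ε hε x w]

theorem exists_lipschitz_of_init (hε₀ : 0 < ε₀)
    (hF : ∀ ε ∈ Ioc 0 ε₀, Setup ε Tmin LM K₀ C₀ (T ε) (φ ε))
    (h : ∃ L : ℝ, ∀ ε ∈ Ioc 0 ε₀, ∀ x w w', |φ ε 0 x w - φ ε 0 x w'| ≤ L * dist w w') (t : ℝ) :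
    ∃ L : ℝ, ∀ ε ∈ Ioc 0 ε₀, ∀ r ∈ Icc 0 t, ∀ s ∈ Icc 0 t, ∀ x y w w',
      |φ ε r x w - φ ε s y w'| ≤ L * (|r - s| + ‖x - y‖ + dist w w') := by
  obtain ⟨L, hL⟩ := h
  have h₀ := hF ε₀ ⟨hε₀, le_rfl⟩
  set A := timeLip d U LM K₀ C₀ + spaceLip d U Tmin LM K₀ C₀ t with hA
  set B := L + (1 + U) * t * spaceLip d U Tmin LM K₀ C₀ t
    + ε₀ * (LM / Tmin * (1 + (1 + U) * t)) with hB
  refine ⟨max A B, fun ε hε r hr s hs x y w w' => ?_⟩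
  have hF' := hF ε hε
  have ht : 0 ≤ t := hr.1.trans hr.2
  have hU := h₀.speed_pos
  have hc : 0 ≤ LM / Tmin := div_nonneg h₀.LM_pos.le h₀.min_pos.le
  have hsp : 0 ≤ spaceLip d U Tmin LM K₀ C₀ s := K₀.2.trans (hF'.le_spaceLip hs.1)
  have h1 := hF'.abs_phase_sub_le hr hs x y w
  have h2 := hF'.abs_phase_sub_vel_le (L := L) (q := 0) (by simpa using hL ε hε) hs.1 y w w'
  rw [add_zero] at h2
  have h3 : (1 + U) * s * spaceLip d U Tmin LM K₀ C₀ s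
      ≤ (1 + U) * t * spaceLip d U Tmin LM K₀ C₀ t :=
    mul_le_mul (mul_le_mul_of_nonneg_left hs.2 (by linarith)) (hF'.spaceLip_mono hs.2) hsp
      (mul_nonneg (by linarith) ht)
  have h4 : ε * (LM / Tmin * (1 + (1 + U) * s)) ≤ ε₀ * (LM / Tmin * (1 + (1 + U) * t)) := by
    have e1 : (1 + U) * s ≤ (1 + U) * t := mul_le_mul_of_nonneg_left hs.2 (by linarith)
    have e2 : 0 ≤ (1 + U) * s := mul_nonneg (by linarith) hs.1
    exact mul_le_mul hε.2 (mul_le_mul_of_nonneg_left (by linarith) hc)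
      (mul_nonneg hc (by linarith)) hε₀.le
  have h5 : |φ ε s y w - φ ε s y w'| ≤ B * dist w w' :=
    h2.trans (mul_le_mul_of_nonneg_right (by linarith) dist_nonneg)
  have h6 := abs_sub_le (φ ε r x w) (φ ε s y w) (φ ε s y w')
  have h7 : A * (|r - s| + ‖x - y‖) ≤ max A B * (|r - s| + ‖x - y‖) :=
    mul_le_mul_of_nonneg_right (le_max_left _ _) (by positivity)
  have h8 : B * dist w w' ≤ max A B * dist w w' :=
    mul_le_mul_of_nonneg_right (le_max_right _ _) dist_nonneg
  rw [mul_add (max A B)]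
  linarith

theorem lipschitzWith_spaceLip (hF : ∀ ε ∈ Ioc 0 ε₀, Setup ε Tmin LM K₀ C₀ (T ε) (φ ε)) {t : ℝ}
    {K : ℝ≥0} (hK : spaceLip d U Tmin LM K₀ C₀ t ≤ K) :
    ∀ ε ∈ Ioc 0 ε₀, ∀ s ∈ Icc 0 t, ∀ w, LipschitzWith K (fun x => φ ε s x w) := by
  intro ε hε s hs w
  refine LipschitzWith.of_dist_le_mul fun x y => ?_
  rw [Real.dist_eq, dist_eq_norm]
  exact ((hF ε hε).abs_phase_sub_space_le hs.1 x y w).trans (mul_le_mul_of_nonneg_right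
    (((hF ε hε).spaceLip_mono hs.2).trans hK) (norm_nonneg _))

theorem slopesBelow_top (hF : ∀ ε ∈ Ioc 0 ε₀, Setup ε Tmin LM K₀ C₀ (T ε) (φ ε)) :
    SlopesBelow ε₀ φ ⊤ ⊤ := fun _ _ _ =>
  ⟨_, ENNReal.coe_lt_top, lipschitzWith_spaceLip hF (Real.le_coe_toNNReal _)⟩

/-- `spaceLip` is continuous in time with value `K₀` at zero, so it stays below some `K < P` for a
short time. -/
theorem exists_slopesBelow (hε₀ : 0 < ε₀)
    (hF : ∀ ε ∈ Ioc 0 ε₀, Setup ε Tmin LM K₀ C₀ (T ε) (φ ε)) {P : ℝ≥0∞} (hP : (K₀ : ℝ≥0∞) < P) :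
    ∃ τ : ℝ≥0∞, 0 < τ ∧ SlopesBelow ε₀ φ P τ := by
  obtain ⟨K, hK₀, hK⟩ := ENNReal.lt_iff_exists_nnreal_btwn.1 hP
  have hcont : Continuous (spaceLip d U Tmin LM K₀ C₀) := by
    unfold spaceLip; fun_prop
  have h0 : spaceLip d U Tmin LM K₀ C₀ 0 < K := by
    simpa [spaceLip] using ENNReal.coe_lt_coe.1 hK₀
  obtain ⟨t₁, ht₁, hpos⟩ := (((hcont.tendsto 0).eventually_lt_const h0).filter_mono
    nhdsWithin_le_nhds |>.and (self_mem_nhdsWithin (s := Ioi (0 : ℝ)))).exists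
  refine ⟨ENNReal.ofReal t₁, by simpa using hpos, fun t _ ht => ⟨K, hK, ?_⟩⟩
  have htt : t ≤ t₁ := (ENNReal.ofReal_lt_ofReal_iff hpos).1 ht |>.le
  exact lipschitzWith_spaceLip hF (((hF ε₀ ⟨hε₀, le_rfl⟩).spaceLip_mono htt).trans ht₁.le)

end Family

end BGK

/-! ### Assembly of the main theorem -/

theorem mainTheorem1
    (d : ℕ) (hd : 0 < d) (U : ℝ) (hU : 0 < U) (ε₀ : ℝ) (hε₀ : 0 < ε₀)
    -- the turning kernels and their limit
    (T : ℝ → BGK.Space d → BGK.Vel d U → ℝ) (T₀ : BGK.Space d → BGK.Vel d U → ℝ)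
    (Tmin LM : ℝ) (hTmin : 0 < Tmin)
    (hT_prob : ∀ ε ∈ Set.Ioc 0 ε₀, ∀ x, ∫ w, T ε x w ∂(BGK.velMeasure d U) = 1)
    (hT_lower : ∀ ε ∈ Set.Ioc 0 ε₀, ∀ x w, Tmin ≤ T ε x w)
    (hT_upper : ∀ ε ∈ Set.Ioc 0 ε₀, ∀ x w, T ε x w ≤ LM)
    (hT_lip_x : ∀ ε ∈ Set.Ioc 0 ε₀, ∀ x y w, |T ε x w - T ε y w| ≤ LM * ‖x - y‖)
    (hT_lip_v : ∀ ε ∈ Set.Ioc 0 ε₀, ∀ x w w', |T ε x w - T ε x w'| ≤ LM * dist w w')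
    (hT_lim : TendstoUniformly (fun ε (z : BGK.Space d × BGK.Vel d U) => T ε z.1 z.2)
      (fun z => T₀ z.1 z.2) (𝓝[>] 0))
    -- nondegeneracy for all `p` with `|p| < P`, where `P = ∞` is allowed
    (P : ℝ≥0∞) (hH : ∀ p : BGK.Space d, ENNReal.ofReal ‖p‖ < P → BGK.Nondegenerate T₀ p)
    -- the phases: `exp (-φ_ε/ε)` solves the kinetic equation
    (φ : ℝ → ℝ → BGK.Space d → BGK.Vel d U → ℝ)
    (hφ : ∀ ε ∈ Set.Ioc 0 ε₀, BGK.IsKineticSolution ε (T ε) (BGK.hopfCole ε (φ ε)))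
    -- the initial data
    (φ₀ : BGK.Space d → ℝ) (K₀ : ℝ≥0) (C₀ : ℝ)
    (hφ_lip : ∀ ε ∈ Set.Ioc 0 ε₀, ∀ w, LipschitzWith K₀ (fun x => φ ε 0 x w))
    (hφ_init : ∀ ε ∈ Set.Ioc 0 ε₀, ∀ x w, |φ ε 0 x w - φ₀ x| ≤ C₀ * ε) :
    -- (i) bounds, uniform in `ε` and local in time
    (∀ t R : ℝ, ∃ M : ℝ, ∀ ε ∈ Set.Ioc 0 ε₀, ∀ s ∈ Set.Icc 0 t, ∀ x : BGK.Space d, ‖x‖ ≤ R →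
      ∀ w, |φ ε s x w| ≤ M) ∧
    ((∃ M : ℝ, ∀ ε ∈ Set.Ioc 0 ε₀, ∀ x w, |φ ε 0 x w| ≤ M) →
      ∀ t : ℝ, ∃ M : ℝ, ∀ ε ∈ Set.Ioc 0 ε₀, ∀ s ∈ Set.Icc 0 t, ∀ x w, |φ ε s x w| ≤ M) ∧
    -- (i) Lipschitz estimates, uniform in `ε` and local in time
    (∀ t : ℝ, ∃ L : ℝ, ∀ ε ∈ Set.Ioc 0 ε₀, ∀ r ∈ Set.Icc 0 t, ∀ s ∈ Set.Icc 0 t, ∀ x y w,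
      |φ ε r x w - φ ε s y w| ≤ L * (|r - s| + ‖x - y‖)) ∧
    ((∃ L : ℝ, ∀ ε ∈ Set.Ioc 0 ε₀, ∀ x w w', |φ ε 0 x w - φ ε 0 x w'| ≤ L * dist w w') →
      ∀ t : ℝ, ∃ L : ℝ, ∀ ε ∈ Set.Ioc 0 ε₀, ∀ r ∈ Set.Icc 0 t, ∀ s ∈ Set.Icc 0 t, ∀ x y w w',
        |φ ε r x w - φ ε s y w'| ≤ L * (|r - s| + ‖x - y‖ + dist w w')) ∧
    -- if nondegeneracy holds for all `p`, then the horizon below may be infinite;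
    -- if it holds beyond the initial slopes, then some positive horizon is available
    (P = ⊤ → BGK.SlopesBelow ε₀ φ P ⊤) ∧
    ((K₀ : ℝ≥0∞) < P → ∃ τ : ℝ≥0∞, 0 < τ ∧ BGK.SlopesBelow ε₀ φ P τ) ∧
    -- the Hamiltonian is the unique solution of the implicit equation, and convex in `p`
    (∀ x p : BGK.Space d, ENNReal.ofReal ‖p‖ < P →
      BGK.IsRoot T₀ x p (BGK.hamiltonian T₀ x p) ∧
      ∀ h : ℝ, BGK.IsRoot T₀ x p h → h = BGK.hamiltonian T₀ x p) ∧
    (∀ x : BGK.Space d, ConvexOn ℝ Set.univ (BGK.hamiltonian T₀ x)) ∧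
    -- (ii) and (iii), after extraction from an arbitrary sequence of parameters tending to zero
    (∀ τ : ℝ≥0∞, 0 < τ → BGK.SlopesBelow ε₀ φ P τ →
      ∀ e : ℕ → ℝ, (∀ k, e k ∈ Set.Ioc 0 ε₀) → Tendsto e atTop (𝓝 0) →
      ∃ (θ : ℕ → ℕ) (u : ℝ → BGK.Space d → ℝ), StrictMono θ ∧
        -- (ii)
        TendstoLocallyUniformlyOn
          (fun k (z : ℝ × BGK.Space d × BGK.Vel d U) => φ (e (θ k)) z.1 z.2.1 z.2.2)
          (fun z => u z.1 z.2.1) atTop {z | 0 ≤ z.1 ∧ ENNReal.ofReal z.1 < τ} ∧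
        BGK.IsViscositySolution (BGK.hamiltonian T₀) τ φ₀ u ∧
        (∀ u' : ℝ → BGK.Space d → ℝ,
          BGK.IsViscositySolution (BGK.hamiltonian T₀) τ φ₀ u' →
          ∀ t x, 0 ≤ t → ENNReal.ofReal t < τ → u' t x = u t x) ∧
        -- (iii), for initial data of unit mass and bounded first moment
        ((∀ ε ∈ Set.Ioc 0 ε₀, ∫⁻ z, ENNReal.ofReal (BGK.hopfCole ε (φ ε) 0 z.1 z.2)
            ∂(BGK.phaseMeasure d U) = 1) →
          (∃ M : ℝ, ∀ ε ∈ Set.Ioc 0 ε₀,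
            ∫⁻ z, ENNReal.ofReal (‖z.1‖ * BGK.hopfCole ε (φ ε) 0 z.1 z.2)
              ∂(BGK.phaseMeasure d U) ≤ ENNReal.ofReal M) →
          -- as measures in `(t,x,v,v̂)`
          (∃ μ : Measure (ℝ × BGK.Space d × BGK.Vel d U),
            (∀ t : ℝ, 0 ≤ t → ENNReal.ofReal t < τ →
              BGK.ConvergesWeakly
                (fun k => BGK.measureUpTo (BGK.hopfCole (e (θ k)) (φ (e (θ k)))) t)
                (μ.restrict (Set.Icc 0 t ×ˢ Set.univ)) ∧
              μ (Set.Icc 0 t ×ˢ Set.univ) = ENNReal.ofReal t) ∧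
            μ {z | 0 ≤ z.1 ∧ ENNReal.ofReal z.1 < τ ∧ u z.1 z.2.1 = 0}ᶜ = 0) ∧
          -- as probability measures in `(x,v,v̂)` at each time, after a further extraction
          (∀ t : ℝ, 0 ≤ t → ENNReal.ofReal t < τ →
            ∃ (θ' : ℕ → ℕ) (ν : Measure (BGK.Space d × BGK.Vel d U)), StrictMono θ' ∧
              IsProbabilityMeasure ν ∧
              BGK.ConvergesWeakly
                (fun k => BGK.measureAt
                  (BGK.hopfCole (e (θ (θ' k))) (φ (e (θ (θ' k))))) t) ν ∧
              ν {z | u t z.1 = 0}ᶜ = 0))) := by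
  have hF : ∀ ε ∈ Set.Ioc 0 ε₀, BGK.Setup ε Tmin LM K₀ C₀ (T ε) (φ ε) := fun ε hε =>
    { dim_pos := hd
      speed_pos := hU
      eps_pos := hε.1
      min_pos := hTmin
      prob := hT_prob ε hε
      lower := hT_lower ε hε
      upper := hT_upper ε hε
      lip_x := hT_lip_x ε hε
      lip_v := hT_lip_v ε hε
      sol := hφ ε hε
      init_lip := hφ_lip ε hε
      init_osc := fun x w w' => by
        have h1 := abs_le.1 (hφ_init ε hε x w)
        have h2 := abs_le.1 (hφ_init ε hε x w')
        exact abs_le.2 ⟨by linarith [h1.1, h2.2], by linarith [h1.2, h2.1]⟩ }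
  have hT₀ : BGK.IsTurningKernel Tmin LM T₀ := BGK.isTurningKernel_limit hε₀ hF hT_lim
  have hlim : ∀ δ > 0, ∀ᶠ ε in 𝓝[>] 0, ∀ x w, |T ε x w - T₀ x w| ≤ δ := fun δ hδ =>
    (Metric.tendstoUniformly_iff.1 hT_lim δ hδ).mono fun ε h x w => by
      rw [abs_sub_comm, ← Real.dist_eq]
      exact (h (x, w)).le
  refine ⟨BGK.exists_phase_bound hε₀ hF hφ_init, BGK.exists_phase_bound_of_init hε₀ hF,
    fun t => ⟨_, fun ε hε r hr s hs x y w => (hF ε hε).abs_phase_sub_le hr hs x y w⟩,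
    BGK.exists_lipschitz_of_init hε₀ hF, fun hP => hP ▸ BGK.slopesBelow_top hF,
    BGK.exists_slopesBelow hε₀ hF, fun x p hp => hT₀.isRoot_hamiltonian (hH p hp),
    hT₀.convexOn_hamiltonian, fun τ _ hslope e he he0 => ?_⟩
  obtain ⟨θ₁, u, hθ₁, hu₁⟩ := BGK.exists_subseq_convergesOnBounded hε₀ hF hφ_init he he0
  -- The subsequence is chosen before the hypotheses of (iii) are available, so it must serve both
  -- cases: a case split extracts further if they hold and keeps the sequence otherwise.
  obtain ⟨θ₂, hθ₂, hmeas⟩ : ∃ θ₂ : ℕ → ℕ, StrictMono θ₂ ∧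
      ((∀ ε ∈ Set.Ioc 0 ε₀, ∫⁻ z, ENNReal.ofReal (BGK.hopfCole ε (φ ε) 0 z.1 z.2)
          ∂(BGK.phaseMeasure d U) = 1) →
        (∃ M : ℝ, ∀ ε ∈ Set.Ioc 0 ε₀,
          ∫⁻ z, ENNReal.ofReal (‖z.1‖ * BGK.hopfCole ε (φ ε) 0 z.1 z.2)
            ∂(BGK.phaseMeasure d U) ≤ ENNReal.ofReal M) →
        ∃ m : Measure (ℝ × BGK.Space d × BGK.Vel d U), IsProbabilityMeasure m ∧
          BGK.ConvergesWeakly (fun k => BGK.discounted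
            (BGK.hopfCole (e (θ₁ (θ₂ k))) (φ (e (θ₁ (θ₂ k)))))) m) := by
    by_cases h : (∀ ε ∈ Set.Ioc 0 ε₀, ∫⁻ z, ENNReal.ofReal (BGK.hopfCole ε (φ ε) 0 z.1 z.2)
          ∂(BGK.phaseMeasure d U) = 1) ∧
        (∃ M : ℝ, ∀ ε ∈ Set.Ioc 0 ε₀,
          ∫⁻ z, ENNReal.ofReal (‖z.1‖ * BGK.hopfCole ε (φ ε) 0 z.1 z.2)
            ∂(BGK.phaseMeasure d U) ≤ ENNReal.ofReal M)
    · obtain ⟨hmass, M, hmom⟩ := h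
      obtain ⟨θ₂, m, hθ₂, hm, hw⟩ := BGK.exists_subseq_discounted
        (fun k => hF _ (he (θ₁ k))) (fun k => hmass _ (he (θ₁ k))) (fun k => hmom _ (he (θ₁ k)))
      exact ⟨θ₂, hθ₂, fun _ _ => ⟨m, hm, hw⟩⟩
    · exact ⟨id, strictMono_id, fun h1 h2 => absurd ⟨h1, h2⟩ h⟩
  set θ : ℕ → ℕ := fun k => θ₁ (θ₂ k) with hθ
  have hθm : StrictMono θ := hθ₁.comp hθ₂
  have hu : BGK.ConvergesOnBounded (fun k => φ (e (θ k))) u := hu₁.comp hθ₂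
  have heθ : ∀ k, e (θ k) ∈ Set.Ioc 0 ε₀ := fun k => he _
  have heθ0 : Tendsto (fun k => e (θ k)) atTop (𝓝 0) := he0.comp hθm.tendsto_atTop
  have hcont := BGK.limit_continuousOn hF heθ hu
  have hvisc := BGK.limit_isViscositySolution hF hT₀ hlim hH hslope hφ_init heθ heθ0 hu
  have hc : 0 ≤ LM / Tmin := div_nonneg hT₀.LM_pos.le hTmin.le
  refine ⟨θ, u, hθm, hu.tendstoLocallyUniformlyOn _ fun z hz => hz.1, hvisc,
    fun u' hu' t x ht htτ => le_antisymm
      (BGK.viscosity_le hU hc hT₀.hamiltonian_sub_le hT₀.hamiltonian_sub_le_space hu' hvisc x ht htτ)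
      (BGK.viscosity_le hU hc hT₀.hamiltonian_sub_le hT₀.hamiltonian_sub_le_space hvisc hu' x ht htτ),
    fun hmass hmom => ⟨?_, fun t ht _ => ?_⟩⟩
  · obtain ⟨m, hm, hw⟩ := hmeas hmass hmom
    refine ⟨BGK.undiscounted τ m, fun t _ htτ =>
      ⟨BGK.convergesWeakly_measureUpTo (fun k => hF _ (heθ k)) (fun k => hmass _ (heθ k)) hw htτ,
        BGK.undiscounted_prod_univ (BGK.map_fst_of_convergesWeakly (fun k => hF _ (heθ k))
          (fun k => hmass _ (heθ k)) hw) htτ⟩, BGK.undiscounted_null ?_⟩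
    -- The undiscounted measure does not charge the complement of `[0,τ)`, so only points of the
    -- slab with nonzero limit phase remain.
    refine measure_mono_null (fun z hz => ?_) (BGK.discounted_limit_null
      (fun k => hF _ (heθ k)) heθ0 (fun k => hmass _ (heθ k)) hu hcont hm hw)
    exact ⟨hz.1.1, fun h0 => hz.2 ⟨hz.1.1, hz.1.2, h0⟩⟩
  · obtain ⟨M, hM⟩ := hmom
    obtain ⟨θ', ν, hθ', hν, hw⟩ := BGK.exists_subseq_measureAt (fun k => hF _ (heθ k))
      (fun k => hmass _ (heθ k)) (fun k => hM _ (heθ k)) ht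
    exact ⟨θ', ν, hθ', hν, hw, BGK.measureAt_limit_null (fun k => hF _ (heθ (θ' k)))
      (heθ0.comp hθ'.tendsto_atTop) (fun k => hmass _ (heθ (θ' k))) (hu.comp hθ') hcont ht hν hw⟩
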